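/- Let $T(s,t,u)=\sum_{m,n\ge 1} m^{-s}n^{-t}(m+n)^{-u}$, absolutely convergent for $\Re(s+u)>1$, $\Re(t+u)>1$, $\Re(s+t+u)>2$. It continues (uniquely) to a holomorphic function, also denoted $T$, on the complement in $\mathbb C^3$ of the hyperplanes $s+u\in\mathbb Z_{\le 1}$, $t+u\in\mathbb Z_{\le1}$, $s+t+u=2$. Put $$S_3(s,t,u)=T(s,t,u)+T(u,s,t)+T(t,u,s),\qquad S_4(s,t,u)=-T(s,t,u)+T(u,s,t)+T(t,u,s),$$ $$\Gamma_{\cos}(s)=\frac{2\Gamma(s)}{(2\pi)^s}\cos\frac{\pi s}{2},\qquad \Gamma_{\sin}(s)=\frac{2\Gamma(s)}{(2\pi)^s}\sin\frac{\pi s}{2},\qquad \eta_k(s)=2^{-k}\binom{k-s}{k}\zeta(k+1-s)\quad(k\ge 0),$$ $$G_{ccc}(s,t,u)=\frac{4}{\Gamma_{\cos}(s)\Gamma_{\cos}(t)\Gamma_{\cos}(u)},\qquad G_{ssc}(s,t,u)=\frac{4}{\Gamma_{\sin}(s)\Gamma_{\sin}(t)\Gamma_{\cos}(u)},$$ where $\Gamma_{\cos}$,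 $\Gamma_{\sin}$ and $\eta_k$ take their limit values at removable singularities. Let $\mathbb Z^{od}_{\le1}$ be the set of odd integers $\le 1$ and $\mathbb Z^{ev}_{\le0}$ the set of even integers $\le0$. A point is called a true singularity of a function holomorphic off a union of hyperplanes if the function does not continue holomorphically to any neighbourhood of the point. (1) $S_3$ continues holomorphically to the set of all $(s,t,u)\in\mathbb C^3$ with $s+t,\ t+u,\ u+s\notin\mathbb Z^{od}_{\le1}$ and $s+t+u\ne2$, and every point outside this set is a true singularity of $S_3$. On this set $$\begin{aligned}S_3(s,t,u)=G_{ccc}(s,t,u)\Biggl\{&\frac{2^{-s-t-u}}{s+t+u-2}+\sum_{l,m,n\ge0}\frac{\eta_{2l}(s)\eta_{2m}(t)\eta_{2n}(u)}{2l+2m+2n+1}\\ &+\sum_{l,m\ge0}\frac{2^{-u}\eta_{2l}(s)\eta_{2m}(t)}{u+2l+2m}+\sum_{m,n\ge0}\frac{2^{-s}\eta_{2m}(t)\eta_{2n}(u)}{s+2m+2n}+\sum_{n,l\ge0}\frac{2^{-t}\eta_{2n}(u)\eta_{2l}(s)}{t+2n+2l}\\ &+\sum_{l\ge0}\frac{2^{-t-u}\eta_{2l}(s)}{t+u+2l-1}+\sum_{m\ge0}\frac{2^{-u-s}\eta_{2m}(t)}{u+s+2m-1}+\sum_{n\ge0}\frac{2^{-s-t}\eta_{2n}(u)}{s+t+2n-1}\Biggr\}.\end{aligned}$$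 The equation holds literally if none of $s,t,u$ is a zero ($1,3,5,\dots$) or a pole ($0,-2,-4,\dots$) of $\Gamma_{\cos}$; at the remaining points of the set the right-hand side has a removable singularity and the equation holds by continuity. (2) $S_4$ continues holomorphically to the set of all $(s,t,u)\in\mathbb C^3$ with $s+t\notin\mathbb Z^{od}_{\le1}$, $t+u,\ u+s\notin\mathbb Z^{ev}_{\le0}$ and $s+t+u\ne2$, and every point outside this set is a true singularity of $S_4$. On this set $$\begin{aligned}S_4(s,t,u)=G_{ssc}(s,t,u)\Biggl\{&\frac{2^{-s-t-u}}{s+t+u-2}+\sum_{l,m,n\ge0}\frac{\eta_{2l+1}(s)\eta_{2m+1}(t)\eta_{2n}(u)}{2l+2m+2n+3}\\ &+\sum_{l,m\ge0}\frac{2^{-u}\eta_{2l+1}(s)\eta_{2m+1}(t)}{u+2l+2m+2}-\sum_{m,n\ge0}\frac{2^{-s}\eta_{2m+1}(t)\eta_{2n}(u)}{s+2m+2n+1}-\sum_{n,l\ge0}\frac{2^{-t}\eta_{2n}(u)\eta_{2l+1}(s)}{t+2n+2l+1}\\ &-\sum_{l\ge0}\frac{2^{-t-u}\eta_{2l+1}(s)}{t+u+2l}-\sum_{m\ge0}\frac{2^{-u-s}\eta_{2m+1}(t)}{u+s+2m}+\sum_{n\ge0}\frac{2^{-s-t}\eta_{2n}(u)}{s+t+2n-1}\Biggr\}.\end{aligned}$$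 The equation holds literally if neither $s$ nor $t$ is a zero ($2,4,6,\dots$) or a pole ($-1,-3,-5,\dots$) of $\Gamma_{\sin}$ and $u$ is neither a zero nor a pole of $\Gamma_{\cos}$; at the remaining points of the set the right-hand side has a removable singularity and the equation holds by continuity. In (1) and (2), wherever the equation holds literally, all the series converge absolutely and rapidly: for every $r>1/4$ the terms are $O(r^{l+m+n})$, $O(r^{l+m})$ (with the two indices of the double series), $O(r^{l})$ (with the index of the simple series), respectively. -/

import Mathlib

open Filter Topology

namespace Tornheim

noncomputable section

/-! ### Sets of integers, seen in `ℂ` -/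

/-- The integers `≤ 1`. -/
def intLEOne : Set ℂ := {z | ∃ n : ℤ, n ≤ 1 ∧ z = n}

/-- The odd integers `≤ 1`. -/
def oddLEOne : Set ℂ := {z | ∃ n : ℤ, n ≤ 1 ∧ Odd n ∧ z = n}

/-- The even integers `≤ 0`. -/
def evenLEZero : Set ℂ := {z | ∃ n : ℤ, n ≤ 0 ∧ Even n ∧ z = n}

/-! ### The Tornheim double zeta function -/

/-- The region of absolute convergence of the double series; points are `(s, t, u)`. -/
def convRegion : Set (ℂ × ℂ × ℂ) :=
  {p | 1 < (p.1 + p.2.2).re ∧ 1 < (p.2.1 + p.2.2).re ∧ 2 < (p.1 + p.2.1 + p.2.2).re}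

/-- The summand `1 / (m ^ s n ^ t (m + n) ^ u)` with `m = k.1 + 1` and `n = k.2 + 1`. -/
def tornheimTerm (s t u : ℂ) (k : ℕ × ℕ) : ℂ :=
  1 / (((k.1 : ℂ) + 1) ^ s * ((k.2 : ℂ) + 1) ^ t * ((k.1 : ℂ) + 1 + ((k.2 : ℂ) + 1)) ^ u)

/-- The complement of the polar hyperplanes of the continued double series. It is open and
connected, so that a holomorphic function on it is determined by its values on `convRegion`. -/
def tornheimDomain : Set (ℂ × ℂ × ℂ) :=
  {p | p.1 + p.2.2 ∉ intLEOne ∧ p.2.1 + p.2.2 ∉ intLEOne ∧ p.1 + p.2.1 + p.2.2 ≠ 2}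

/-- `T` is the continuation of the Tornheim double series: it is holomorphic off the polar
hyperplanes and is the sum of the (absolutely convergent) double series in `convRegion`. -/
def IsTornheim (T : ℂ × ℂ × ℂ → ℂ) : Prop :=
  DifferentiableOn ℂ T tornheimDomain ∧
    ∀ s t u : ℂ, (s, t, u) ∈ convRegion → HasSum (tornheimTerm s t u) (T (s, t, u))

/-- All of `(s, t, u)`, `(u, s, t)`, `(t, u, s)` are in the domain of the continued series. -/
def InCyclicDomain (s t u : ℂ) : Prop :=
  (s, t, u) ∈ tornheimDomain ∧ (u, s, t) ∈ tornheimDomain ∧ (t, u, s) ∈ tornheimDomain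

/-! ### Singularities of holomorphic functions on open subsets of `ℂ³` -/

/-- `p` is a true (that is, not removable) singularity of the function `f`, holomorphic on `U`:
`f` does not continue holomorphically to any neighbourhood of `p`. -/
def IsTrueSingularity (f : ℂ × ℂ × ℂ → ℂ) (U : Set (ℂ × ℂ × ℂ)) (p : ℂ × ℂ × ℂ) : Prop :=
  ¬ ∃ (V : Set (ℂ × ℂ × ℂ)) (g : ℂ × ℂ × ℂ → ℂ), IsOpen V ∧ p ∈ V ∧
    DifferentiableOn ℂ g V ∧ Set.EqOn g f (V ∩ U)

/-! ### The special functions -/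

/-- The value of `f` at `s` by continuity: it is `f s` where `f` is continuous, and the limit of
`f` where `f` has a removable singularity (and meaningless where `f` has no limit). -/
def valueAt (f : ℂ → ℂ) (s : ℂ) : ℂ := limUnder (𝓝[≠] s) f

/-- `η_k^+ (s) = 2 ^ (-k) * binom (k - s) k * ζ (k + 1 - s)`, holomorphic for all `s` if `1 ≤ k`,
and for `s ≠ 0` if `k = 0`. -/
def eta (k : ℕ) (s : ℂ) : ℂ :=
  valueAt (fun z => ((2 : ℂ) ^ k)⁻¹ * Ring.choose ((k : ℂ) - z) k * riemannZeta ((k : ℂ) + 1 - z)) s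

/-- `Γ_cos (s) = 2 Γ(s) (2π) ^ (-s) cos (π s / 2)`, with simple poles at `0, -2, -4, …`. -/
def gammaCos (s : ℂ) : ℂ :=
  valueAt (fun z => 2 * Complex.Gamma z / (2 * (Real.pi : ℂ)) ^ z * Complex.cos (Real.pi * z / 2)) s

/-- `Γ_sin (s) = 2 Γ(s) (2π) ^ (-s) sin (π s / 2)`, with simple poles at `-1, -3, -5, …`. -/
def gammaSin (s : ℂ) : ℂ :=
  valueAt (fun z => 2 * Complex.Gamma z / (2 * (Real.pi : ℂ)) ^ z * Complex.sin (Real.pi * z / 2)) s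

/-- The poles (`0, -2, -4, …`) and zeros (`1, 3, 5, …`) of `gammaCos`. -/
def cosExceptional : Set ℂ := {z | ∃ n : ℤ, (n ≤ 0 ∧ Even n ∨ 0 < n ∧ Odd n) ∧ z = n}

/-- The poles (`-1, -3, -5, …`) and zeros (`2, 4, 6, …`) of `gammaSin`. -/
def sinExceptional : Set ℂ := {z | ∃ n : ℤ, (n < 0 ∧ Odd n ∨ 0 < n ∧ Even n) ∧ z = n}

def Gccc (s t u : ℂ) : ℂ := 4 / (gammaCos s * gammaCos t * gammaCos u)

def Gssc (s t u : ℂ) : ℂ := 4 / (gammaSin s * gammaSin t * gammaCos u)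

/-! ### The series -/

/-- `k ↦ η_{2k}^+ (s)`. -/
def etaEven (s : ℂ) (k : ℕ) : ℂ := eta (2 * k) s

/-- `k ↦ η_{2k+1}^+ (s)`. -/
def etaOdd (s : ℂ) (k : ℕ) : ℂ := eta (2 * k + 1) s

/-- `(l, m, n) ↦ a_l b_m c_n / (2l + 2m + 2n + d)`. -/
def tripleTerm (a b c : ℕ → ℂ) (d : ℂ) (k : ℕ × ℕ × ℕ) : ℂ :=
  a k.1 * b k.2.1 * c k.2.2 / (2 * k.1 + 2 * k.2.1 + 2 * k.2.2 + d)

/-- `(l, m) ↦ 2 ^ (-w) a_l b_m / (d + 2l + 2m)`. -/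
def doubleTerm (a b : ℕ → ℂ) (w d : ℂ) (k : ℕ × ℕ) : ℂ :=
  (2 : ℂ) ^ (-w) * a k.1 * b k.2 / (d + 2 * k.1 + 2 * k.2)

/-- `l ↦ 2 ^ (-w) a_l / (d + 2l)`. -/
def singleTerm (a : ℕ → ℂ) (w d : ℂ) (k : ℕ) : ℂ :=
  (2 : ℂ) ^ (-w) * a k / (d + 2 * k)

/-- The family `f` is summable, and its terms decay geometrically in the weight `wt`, with every
ratio `r > 1 / 4`. -/
def ConvergesRapidly {ι : Type} (wt : ι → ℕ) (f : ι → ℂ) : Prop :=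
  Summable f ∧ ∀ r : ℝ, 1 / 4 < r → ∃ C : ℝ, ∀ i, ‖f i‖ ≤ C * r ^ wt i

def weight3 (k : ℕ × ℕ × ℕ) : ℕ := k.1 + k.2.1 + k.2.2

def weight2 (k : ℕ × ℕ) : ℕ := k.1 + k.2

/-! ### The sum `T(s,t,u) + T(u,s,t) + T(t,u,s)` -/

def regularSet3 : Set (ℂ × ℂ × ℂ) :=
  {p | p.1 + p.2.1 ∉ oddLEOne ∧ p.2.1 + p.2.2 ∉ oddLEOne ∧ p.2.2 + p.1 ∉ oddLEOne ∧
    p.1 + p.2.1 + p.2.2 ≠ 2}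

/-- The points where no single factor or term of `expansion3` has a pole in `s`, `t` or `u`
alone. -/
def genericSet3 : Set (ℂ × ℂ × ℂ) :=
  {p | p.1 ∉ cosExceptional ∧ p.2.1 ∉ cosExceptional ∧ p.2.2 ∉ cosExceptional}

def expansion3 (s t u : ℂ) : ℂ :=
  Gccc s t u *
    ((2 : ℂ) ^ (-s - t - u) / (s + t + u - 2)
      + ∑' k, tripleTerm (etaEven s) (etaEven t) (etaEven u) 1 k
      + ∑' k, doubleTerm (etaEven s) (etaEven t) u u k
      + ∑' k, doubleTerm (etaEven t) (etaEven u) s s k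
      + ∑' k, doubleTerm (etaEven u) (etaEven s) t t k
      + ∑' k, singleTerm (etaEven s) (t + u) (t + u - 1) k
      + ∑' k, singleTerm (etaEven t) (u + s) (u + s - 1) k
      + ∑' k, singleTerm (etaEven u) (s + t) (s + t - 1) k)

/-- All seven series in `expansion3` converge rapidly. -/
def RapidExpansion3 (s t u : ℂ) : Prop :=
  ConvergesRapidly weight3 (tripleTerm (etaEven s) (etaEven t) (etaEven u) 1) ∧
  ConvergesRapidly weight2 (doubleTerm (etaEven s) (etaEven t) u u) ∧
  ConvergesRapidly weight2 (doubleTerm (etaEven t) (etaEven u) s s) ∧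
  ConvergesRapidly weight2 (doubleTerm (etaEven u) (etaEven s) t t) ∧
  ConvergesRapidly id (singleTerm (etaEven s) (t + u) (t + u - 1)) ∧
  ConvergesRapidly id (singleTerm (etaEven t) (u + s) (u + s - 1)) ∧
  ConvergesRapidly id (singleTerm (etaEven u) (s + t) (s + t - 1))

/-! ### The sum `-T(s,t,u) + T(u,s,t) + T(t,u,s)` -/

def regularSet4 : Set (ℂ × ℂ × ℂ) :=
  {p | p.1 + p.2.1 ∉ oddLEOne ∧ p.2.1 + p.2.2 ∉ evenLEZero ∧ p.2.2 + p.1 ∉ evenLEZero ∧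
    p.1 + p.2.1 + p.2.2 ≠ 2}

/-- The points where no single factor or term of `expansion4` has a pole in `s`, `t` or `u`
alone. -/
def genericSet4 : Set (ℂ × ℂ × ℂ) :=
  {p | p.1 ∉ sinExceptional ∧ p.2.1 ∉ sinExceptional ∧ p.2.2 ∉ cosExceptional}

def expansion4 (s t u : ℂ) : ℂ :=
  Gssc s t u *
    ((2 : ℂ) ^ (-s - t - u) / (s + t + u - 2)
      + ∑' k, tripleTerm (etaOdd s) (etaOdd t) (etaEven u) 3 k
      + ∑' k, doubleTerm (etaOdd s) (etaOdd t) u (u + 2) k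
      - ∑' k, doubleTerm (etaOdd t) (etaEven u) s (s + 1) k
      - ∑' k, doubleTerm (etaEven u) (etaOdd s) t (t + 1) k
      - ∑' k, singleTerm (etaOdd s) (t + u) (t + u) k
      - ∑' k, singleTerm (etaOdd t) (u + s) (u + s) k
      + ∑' k, singleTerm (etaEven u) (s + t) (s + t - 1) k)

/-- All seven series in `expansion4` converge rapidly. -/
def RapidExpansion4 (s t u : ℂ) : Prop :=
  ConvergesRapidly weight3 (tripleTerm (etaOdd s) (etaOdd t) (etaEven u) 3) ∧
  ConvergesRapidly weight2 (doubleTerm (etaOdd s) (etaOdd t) u (u + 2)) ∧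
  ConvergesRapidly weight2 (doubleTerm (etaOdd t) (etaEven u) s (s + 1)) ∧
  ConvergesRapidly weight2 (doubleTerm (etaEven u) (etaOdd s) t (t + 1)) ∧
  ConvergesRapidly id (singleTerm (etaOdd s) (t + u) (t + u)) ∧
  ConvergesRapidly id (singleTerm (etaOdd t) (u + s) (u + s)) ∧
  ConvergesRapidly id (singleTerm (etaEven u) (s + t) (s + t - 1))

end

end Tornheim

open Tornheim

/-!
For `s, t, u` of real part `> 1`, the functions `∑ cos (π n y) / n ^ s` and `∑ sin (π n y) / n ^ s`
are multiplied together, two of the same kind in `s` and `t` and the cosine one in `u`. On `[0, 1]`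
only the terms with `k = m + n` up to a permutation have a nonzero mean, so the integral of the
product over `[0, 1]` is `S₃ / 4` or `S₄ / 4`. On the other hand, by the functional equation of the
Hurwitz zeta function each factor is a Gamma factor times `2 ^ (-s) y ^ (s - 1) + ∑ ± η_k (s) y ^ k`
(with `k` of one parity), so that integrating term by term gives the expansion.

All the poles of the expansion are cancelled by reciprocals of `Γ_ℝ`, so `S₃` and `S₄` are quotients
of entire functions on `ℂ³`. The factors of the denominator that come from the zeros of `Γ_cos` and
`Γ_sin` have simple zeros, on hyperplanes that meet the region of convergence, hence divide the
numerator. What remains of the denominator vanishes exactly on the singular hyperplanes, where the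
numerator is nonzero on a dense subset; this gives both the continuation and the true singularities.
Finally `(S₃ - S₄) / 2` and half the sum of the two other rotations of `S₄` both continue `T`, and
their domains cover the domain of `T`.
-/

namespace Tornheim

noncomputable section

/-! ### Holomorphic functions of several variables -/

section SeveralVariables

open Metric

variable {E E₁ E₂ F : Type*} [NormedAddCommGroup E] [NormedSpace ℂ E]
  [NormedAddCommGroup E₁] [NormedSpace ℂ E₁] [NormedAddCommGroup E₂] [NormedSpace ℂ E₂]
  [NormedAddCommGroup F] [NormedSpace ℂ F]

lemma differentiableAt_div {f g : E → ℂ} {x : E} (hf : DifferentiableAt ℂ f x)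
    (hg : DifferentiableAt ℂ g x) (h : g x ≠ 0) : DifferentiableAt ℂ (fun y => f y / g y) x := by
  simp_rw [div_eq_mul_inv]
  exact hf.mul (hg.inv h)

lemma mapsTo_closedBall_of_norm_le {X Y : Type*} [PseudoMetricSpace X]
    [SeminormedAddCommGroup Y] {f : X → Y} {c : X} {R C : ℝ} (hR : 0 < R)
    (hb : ∀ x ∈ ball c R, ‖f x‖ ≤ C) :
    Set.MapsTo f (ball c R) (closedBall (f c) (2 * C)) := by
  intro x hx
  rw [mem_closedBall, dist_eq_norm]
  linarith [norm_sub_le (f x) (f c), hb x hx, hb c (mem_ball_self hR)]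

lemma norm_fderiv_le_of_norm_le {f : E → F} {c : E} {R C : ℝ} (hR : 0 < R)
    (hd : DifferentiableOn ℂ f (ball c R)) (hb : ∀ x ∈ ball c R, ‖f x‖ ≤ C) :
    ‖fderiv ℂ f c‖ ≤ 2 * C / R :=
  Complex.norm_fderiv_le_div_of_mapsTo_ball hd (mapsTo_closedBall_of_norm_le hR hb) hR

lemma norm_sub_le_of_norm_le {f : E → F} {c z : E} {R C : ℝ}
    (hd : DifferentiableOn ℂ f (ball c R)) (hb : ∀ x ∈ ball c R, ‖f x‖ ≤ C)
    (hz : z ∈ ball c R) : ‖f z - f c‖ ≤ 2 * C / R * ‖z - c‖ := by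
  rw [← dist_eq_norm, ← dist_eq_norm]
  exact Complex.dist_le_div_mul_dist_of_mapsTo_ball hd
    (mapsTo_closedBall_of_norm_le (pos_of_mem_ball hz) hb) hz

lemma uniformCauchySeqOn_fderiv {ι : Type*} {l : Filter ι} {f : ι → E → F} {c : E} {R : ℝ}
    (hR : 0 < R) (hd : ∀ᶠ n in l, DifferentiableOn ℂ (f n) (ball c R))
    (h : UniformCauchySeqOn f l (ball c R)) :
    UniformCauchySeqOn (fun n x => fderiv ℂ (f n) x) l (ball c (R / 2)) := by
  intro u hu
  obtain ⟨ε, hε, hεu⟩ := Metric.mem_uniformity_dist.1 hu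
  have hclose := h {p | dist p.1 p.2 < ε * R / 8} (Metric.dist_mem_uniformity (by positivity))
  filter_upwards [hclose, hd.prod_mk hd] with m hm hdm x hx
  have hsub : ball x (R / 2) ⊆ ball c R :=
    ball_subset_ball' (by rw [mem_ball] at hx; linarith)
  have hx' : ball c R ∈ 𝓝 x := isOpen_ball.mem_nhds (hsub (mem_ball_self (by positivity)))
  apply hεu
  rw [dist_eq_norm, ← fderiv_sub (hdm.1.differentiableAt hx') (hdm.2.differentiableAt hx')]
  calc ‖fderiv ℂ (f m.1 - f m.2) x‖ ≤ 2 * (ε * R / 8) / (R / 2) :=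
        norm_fderiv_le_of_norm_le (by positivity) ((hdm.1.mono hsub).sub (hdm.2.mono hsub))
          fun y hy => (mem_ball_iff_norm.1 (hm y (hsub hy))).le
    _ = ε / 2 := by field_simp; ring
    _ < ε := by linarith

lemma differentiableAt_of_tendstoUniformlyOn [CompleteSpace F] {ι : Type*} {l : Filter ι}
    [NeBot l] {f : ι → E → F} {g : E → F} {c : E} {R : ℝ} (hR : 0 < R)
    (hd : ∀ᶠ n in l, DifferentiableOn ℂ (f n) (ball c R))
    (h : TendstoUniformlyOn f g l (ball c R)) : DifferentiableAt ℂ g c := by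
  have hsub : ball c (R / 2) ⊆ ball c R := ball_subset_ball (by linarith)
  have hnhds : ball c (R / 2) ∈ 𝓝 c := ball_mem_nhds c (by positivity)
  have hcauchy := uniformCauchySeqOn_fderiv hR hd h.uniformCauchySeqOn
  have hlim : ∀ x ∈ ball c (R / 2), ∃ L, Tendsto (fun n => fderiv ℂ (f n) x) l (𝓝 L) :=
    fun x hx => cauchy_map_iff_exists_tendsto.1 (hcauchy.cauchy_map hx)
  choose! g' hg' using hlim
  have hunif : TendstoUniformlyOnFilter (fun n x => fderiv ℂ (f n) x) g' l (𝓝 c) :=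
    (tendstoUniformlyOn_iff_tendstoUniformlyOnFilter.1
      (hcauchy.tendstoUniformlyOn_of_tendsto hg')).mono_right (le_principal_iff.2 hnhds)
  refine (hasFDerivAt_of_tendstoUniformlyOnFilter (f := f) hunif ?_ ?_).differentiableAt
  · filter_upwards [hd.prod_mk hnhds] with q hq
    exact (hq.1.differentiableAt (isOpen_ball.mem_nhds (hsub hq.2))).hasFDerivAt
  · filter_upwards [hnhds] with x hx using h.tendsto_at (hsub hx)

lemma differentiableOn_tsum_of_locally_summable [CompleteSpace F] {ι : Type*} {f : ι → E → F}
    {U : Set E} (hU : IsOpen U) (hf : ∀ i, DifferentiableOn ℂ (f i) U)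
    (hb : ∀ p ∈ U, ∃ v : ι → ℝ, Summable v ∧ ∀ᶠ q in 𝓝 p, ∀ i, ‖f i q‖ ≤ v i) :
    DifferentiableOn ℂ (fun q => ∑' i, f i q) U := by
  intro p hp
  obtain ⟨v, hv, h⟩ := hb p hp
  obtain ⟨R, hR, hRb⟩ := Metric.eventually_nhds_iff_ball.1 (h.and (hU.eventually_mem hp))
  refine (differentiableAt_of_tendstoUniformlyOn hR (f := fun (t : Finset ι) q => ∑ i ∈ t, f i q)
    (.of_forall fun t => ?_)
    (tendstoUniformlyOn_tsum hv fun i x hx => (hRb x hx).1 i)).differentiableWithinAt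
  exact DifferentiableOn.fun_sum fun i _ => (hf i).mono fun x hx => (hRb x hx).2

/-- Holomorphy in each of two variables, the hypothesis of Osgood's lemma. Differentiability is
asked at the point itself, not within `s`. -/
def SeparatelyDifferentiableOn (f : E₁ × E₂ → F) (s : Set (E₁ × E₂)) : Prop :=
  ∀ q ∈ s, DifferentiableAt ℂ (fun x => f (x, q.2)) q.1 ∧
    DifferentiableAt ℂ (fun y => f (q.1, y)) q.2

lemma SeparatelyDifferentiableOn.mono {f : E₁ × E₂ → F} {s t : Set (E₁ × E₂)}
    (h : SeparatelyDifferentiableOn f t) (hst : s ⊆ t) : SeparatelyDifferentiableOn f s :=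
  fun q hq => h q (hst hq)

lemma prodMk_mem_ball {X Y : Type*} [PseudoMetricSpace X] [PseudoMetricSpace Y] {p : X × Y}
    {R : ℝ} {x : X} {y : Y} (hx : x ∈ ball p.1 R) (hy : y ∈ ball p.2 R) : (x, y) ∈ ball p R := by
  rw [← ball_prod_same]
  exact ⟨hx, hy⟩

lemma SeparatelyDifferentiableOn.norm_sub_le {f : E₁ × E₂ → F} {p q : E₁ × E₂} {R C : ℝ}
    (hf : SeparatelyDifferentiableOn f (ball p R)) (hb : ∀ q ∈ ball p R, ‖f q‖ ≤ C)
    (hq : q ∈ ball p R) : ‖f q - f p‖ ≤ 4 * C / R * dist q p := by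
  have hR : 0 < R := pos_of_mem_ball hq
  have hC : 0 ≤ C := (norm_nonneg _).trans (hb p (mem_ball_self hR))
  obtain ⟨hq₁, hq₂⟩ : q.1 ∈ ball p.1 R ∧ q.2 ∈ ball p.2 R := by rwa [← ball_prod_same] at hq
  have hfst : ‖f q - f (p.1, q.2)‖ ≤ 2 * C / R * dist q.1 p.1 := by
    rw [dist_eq_norm]
    exact norm_sub_le_of_norm_le (f := fun x => f (x, q.2))
      (fun z hz => (hf _ (prodMk_mem_ball hz hq₂)).1.differentiableWithinAt)
      (fun z hz => hb _ (prodMk_mem_ball hz hq₂)) hq₁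
  have hsnd : ‖f (p.1, q.2) - f p‖ ≤ 2 * C / R * dist q.2 p.2 := by
    rw [dist_eq_norm]
    exact norm_sub_le_of_norm_le (f := fun y => f (p.1, y))
      (fun z hz => (hf _ (prodMk_mem_ball (mem_ball_self hR) hz)).2.differentiableWithinAt)
      (fun z hz => hb _ (prodMk_mem_ball (mem_ball_self hR) hz)) hq₂
  calc ‖f q - f p‖ ≤ ‖f q - f (p.1, q.2)‖ + ‖f (p.1, q.2) - f p‖ :=
        norm_sub_le_norm_sub_add_norm_sub ..
    _ ≤ 2 * C / R * dist q.1 p.1 + 2 * C / R * dist q.2 p.2 := add_le_add hfst hsnd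
    _ ≤ 2 * C / R * dist q p + 2 * C / R * dist q p := by
      gcongr
      · exact le_max_left _ _
      · exact le_max_right _ _
    _ = 4 * C / R * dist q p := by ring

lemma SeparatelyDifferentiableOn.norm_fderiv_sub_le {f : E₁ × E₂ → F} {p q : E₁ × E₂} {R C : ℝ}
    (hf : SeparatelyDifferentiableOn f (ball p R)) (hb : ∀ q ∈ ball p R, ‖f q‖ ≤ C)
    (hq : q ∈ ball p (R / 4)) :
    ‖fderiv ℂ (fun x => f (x, q.2)) q.1 - fderiv ℂ (fun x => f (x, p.2)) p.1‖ ≤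
      64 * C / R ^ 2 * dist q p := by
  have hR : 0 < R := by linarith [pos_of_mem_ball hq]
  set δ := q.1 - p.1 with hδ
  have hshift : ∀ x, dist (x + δ, q.2) (x, p.2) = dist q p := fun x => by
    rw [Prod.dist_eq, Prod.dist_eq, hδ]
    simp [dist_eq_norm]
  have hball : ∀ x ∈ ball p.1 (R / 4), ball (x, p.2) (R / 2) ⊆ ball p R := fun x hx =>
    ball_subset_ball' (by
      have : dist (x, p.2) p = dist x p.1 := by simp [Prod.dist_eq]
      linarith [mem_ball.1 hx])
  have hmem : ∀ x, (x + δ, q.2) ∈ ball (x, p.2) (R / 2) := fun x => by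
    rw [mem_ball, hshift]; linarith [mem_ball.1 hq]
  have hd : ∀ x ∈ ball p.1 (R / 4), DifferentiableAt ℂ (fun x => f (x, p.2)) x := fun x hx =>
    (hf _ (hball x hx (mem_ball_self (by positivity)))).1
  have hdshift : ∀ x ∈ ball p.1 (R / 4), DifferentiableAt ℂ (fun x => f (x + δ, q.2)) x :=
    fun x hx => DifferentiableAt.comp (g := fun x => f (x, q.2)) x (hf _ (hball x hx (hmem x))).1
      (differentiableAt_id.add_const δ)
  have hp : p.1 ∈ ball p.1 (R / 4) := mem_ball_self (by positivity)
  have htranslate : fderiv ℂ (fun x => f (x, q.2)) q.1 =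
      fderiv ℂ (fun x => f (x + δ, q.2)) p.1 := by
    rw [fderiv_comp_add_right (f := fun x => f (x, q.2)), hδ, add_sub_cancel]
  rw [htranslate, ← fderiv_sub (hdshift _ hp) (hd _ hp)]
  calc _ ≤ 2 * (4 * C / (R / 2) * dist q p) / (R / 4) :=
        norm_fderiv_le_of_norm_le (by positivity)
          (fun x hx => ((hdshift x hx).sub (hd x hx)).differentiableWithinAt) fun x hx => by
            rw [← hshift x]
            exact (hf.mono (hball x hx)).norm_sub_le (fun y hy => hb y (hball x hx hy)) (hmem x)
    _ = 64 * C / R ^ 2 * dist q p := by field_simp; ring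

lemma SeparatelyDifferentiableOn.continuousAt_fderiv {f : E₁ × E₂ → F} {p : E₁ × E₂} {R C : ℝ}
    (hR : 0 < R) (hf : SeparatelyDifferentiableOn f (ball p R))
    (hb : ∀ q ∈ ball p R, ‖f q‖ ≤ C) :
    ContinuousAt (fun q : E₁ × E₂ => fderiv ℂ (fun x => f (x, q.2)) q.1) p := by
  rw [ContinuousAt, tendsto_iff_norm_sub_tendsto_zero]
  refine squeeze_zero' (.of_forall fun _ => norm_nonneg _)
    (g := fun q => 64 * C / R ^ 2 * dist q p) ?_ ?_
  · filter_upwards [ball_mem_nhds p (show 0 < R / 4 by positivity)] with q hq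
      using hf.norm_fderiv_sub_le hb hq
  · have hcont : Continuous fun q : E₁ × E₂ => 64 * C / R ^ 2 * dist q p := by fun_prop
    simpa using hcont.tendsto p

lemma SeparatelyDifferentiableOn.swap {f : E₁ × E₂ → F} {p : E₁ × E₂} {R : ℝ}
    (hf : SeparatelyDifferentiableOn f (ball p R)) :
    SeparatelyDifferentiableOn (fun q : E₂ × E₁ => f q.swap) (ball p.swap R) := fun q hq =>
  (hf q.swap (by rw [← ball_prod_same] at hq ⊢; exact hq.symm)).symm

/-- **Osgood's lemma**. -/
lemma SeparatelyDifferentiableOn.differentiableAt {f : E₁ × E₂ → F} {p : E₁ × E₂} {R C : ℝ}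
    (hR : 0 < R) (hf : SeparatelyDifferentiableOn f (ball p R))
    (hb : ∀ q ∈ ball p R, ‖f q‖ ≤ C) : DifferentiableAt ℂ f p := by
  have hfst := hf.continuousAt_fderiv hR hb
  have hswap : ContinuousAt (fun q : E₁ × E₂ => fderiv ℂ (fun y => f (q.1, y)) q.2) p :=
    ContinuousAt.comp (f := Prod.swap) (x := p)
      (hf.swap.continuousAt_fderiv hR fun q hq =>
        hb _ (by rw [← ball_prod_same] at hq ⊢; exact hq.symm))
      continuous_swap.continuousAt
  have hnhds := ball_mem_nhds p hR
  exact (hasStrictFDerivAt_uncurry_coprod (u := p) (f := fun x y => f (x, y))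
    (f₁ := fun x y => fderiv ℂ (fun x => f (x, y)) x)
    (f₂ := fun x y => fderiv ℂ (fun y => f (x, y)) y)
    (mem_of_superset hnhds fun q hq => (hf q hq).1.hasFDerivAt)
    (mem_of_superset hnhds fun q hq => (hf q hq).2.hasFDerivAt)
    hfst hswap).hasFDerivAt.differentiableAt

lemma norm_dslope_le_of_norm_le {f : ℂ → F} {c z : ℂ} {R C : ℝ}
    (hd : DifferentiableOn ℂ f (ball c R)) (hb : ∀ x ∈ ball c R, ‖f x‖ ≤ C)
    (hz : z ∈ ball c R) : ‖dslope f c z‖ ≤ 2 * C / R :=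
  Complex.norm_dslope_le_div_of_mapsTo_ball hd
    (mapsTo_closedBall_of_norm_le (pos_of_mem_ball hz) hb) hz

lemma differentiable_dslope [CompleteSpace F] {f : ℂ → F} (hf : Differentiable ℂ f) (c : ℂ) :
    Differentiable ℂ (dslope f c) :=
  differentiableOn_univ.1
    ((Complex.differentiableOn_dslope univ_mem).2 (differentiableOn_univ.2 hf))

lemma exists_norm_le_on_ball {X Y : Type*} [PseudoMetricSpace X] [SeminormedAddCommGroup Y]
    {f : X → Y} {p : X} (hf : ContinuousAt f p) : ∃ R > 0, ∃ C, ∀ q ∈ ball p R, ‖f q‖ ≤ C := by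
  have h : ∀ᶠ q in 𝓝 p, ‖f q‖ < ‖f p‖ + 1 := hf.norm.eventually (gt_mem_nhds (lt_add_one _))
  obtain ⟨R, hR, hRb⟩ := Metric.eventually_nhds_iff_ball.1 h
  exact ⟨R, hR, _, fun q hq => (hRb q hq).le⟩

section PartialSlope

variable {f : ℂ × E → F}

lemma differentiable_comp_prodMk_left (hf : Differentiable ℂ f) (w : E) :
    Differentiable ℂ (fun z => f (z, w)) :=
  hf.comp (differentiable_id.prodMk (differentiable_const w))

lemma differentiable_comp_prodMk_right (hf : Differentiable ℂ f) (z : ℂ) :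
    Differentiable ℂ (fun w => f (z, w)) :=
  hf.comp ((differentiable_const z).prodMk differentiable_id)

lemma differentiable_dslope_of_ne (hf : Differentiable ℂ f) {c z : ℂ} (hz : z ≠ c) :
    Differentiable ℂ (fun w => dslope (fun z => f (z, w)) c z) := by
  simp_rw [dslope_of_ne _ hz, slope_def_module]
  exact ((differentiable_comp_prodMk_right hf z).sub
    (differentiable_comp_prodMk_right hf c)).const_smul _

variable [CompleteSpace F]

lemma differentiable_dslope_same (hf : Differentiable ℂ f) (c : ℂ) :
    Differentiable ℂ (fun w => dslope (fun z => f (z, w)) c c) := by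
  intro w₀
  obtain ⟨R, hR, C, hC⟩ := exists_norm_le_on_ball (hf.continuous.continuousAt (x := (c, w₀)))
  have hfst := differentiable_comp_prodMk_left hf
  have hlip : ∀ z ∈ ball c R, ∀ w ∈ ball w₀ R,
      ‖dslope (fun z => f (z, w)) c z - dslope (fun z => f (z, w)) c c‖ ≤
        2 * (2 * C / R) / R * ‖z - c‖ := fun z hz w hw =>
    norm_sub_le_of_norm_le (differentiable_dslope (hfst w) c).differentiableOn
      (fun x hx => norm_dslope_le_of_norm_le (hfst w).differentiableOn
        (fun y hy => hC _ (prodMk_mem_ball hy hw)) hx) hz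
  refine differentiableAt_of_tendstoUniformlyOn hR (l := 𝓝[≠] c)
    (f := fun z w => dslope (fun z => f (z, w)) c z) ?_ ?_
  · filter_upwards [self_mem_nhdsWithin] with z hz
      using (differentiable_dslope_of_ne hf hz).differentiableOn
  · refine Metric.tendstoUniformlyOn_iff.2 fun ε hε => ?_
    have hlim : Tendsto (fun z => 2 * (2 * C / R) / R * ‖z - c‖) (𝓝 c) (𝓝 0) := by
      have hcont : Continuous fun z : ℂ => 2 * (2 * C / R) / R * ‖z - c‖ := by fun_prop
      simpa using hcont.tendsto c
    filter_upwards [nhdsWithin_le_nhds (hlim.eventually (gt_mem_nhds hε)),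
      nhdsWithin_le_nhds (ball_mem_nhds c hR)] with z hsmall hz w hw
    rw [dist_comm, dist_eq_norm]
    exact (hlip z hz w hw).trans_lt hsmall

lemma differentiable_partial_dslope (hf : Differentiable ℂ f) (c : ℂ) :
    Differentiable ℂ (fun p : ℂ × E => dslope (fun z => f (z, p.2)) c p.1) := by
  have hfst := differentiable_comp_prodMk_left hf
  have hsep : ∀ s, SeparatelyDifferentiableOn
      (fun p : ℂ × E => dslope (fun z => f (z, p.2)) c p.1) s := by
    refine fun s q _ => ⟨differentiable_dslope (hfst q.2) c q.1, ?_⟩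
    rcases eq_or_ne q.1 c with hq | hq
    · simp only [hq]
      exact differentiable_dslope_same hf c q.2
    · exact differentiable_dslope_of_ne hf hq q.2
  rintro ⟨z, w⟩
  rcases eq_or_ne z c with rfl | hz
  · obtain ⟨R, hR, C, hC⟩ := exists_norm_le_on_ball (hf.continuous.continuousAt (x := (z, w)))
    refine (hsep _).differentiableAt hR (C := 2 * C / R) fun q hq => ?_
    rw [← ball_prod_same] at hq
    exact norm_dslope_le_of_norm_le (hfst _).differentiableOn
      (fun y hy => hC _ (prodMk_mem_ball hy hq.2)) hq.1
  · have heq : (fun p : ℂ × E => dslope (fun z => f (z, p.2)) c p.1) =ᶠ[𝓝 (z, w)]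
        fun p => (p.1 - c)⁻¹ • (f p - f (c, p.2)) := by
      filter_upwards [continuousAt_fst.eventually_ne hz] with p hp
      rw [dslope_of_ne _ hp, slope_def_module]
    refine DifferentiableAt.congr_of_eventuallyEq ?_ heq
    have hconst : Differentiable ℂ (fun p : ℂ × E => f (c, p.2)) :=
      hf.comp ((differentiable_const c).prodMk differentiable_snd)
    exact ((differentiableAt_fst.sub_const c).inv (sub_ne_zero.2 hz)).smul
      ((hf _).sub (hconst _))

end PartialSlope

lemma eq_sub_smul_dslope {f : ℂ → F} {c : ℂ} (h : f c = 0) (z : ℂ) :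
    f z = (z - c) • dslope f c z := by
  rw [sub_smul_dslope, h, sub_zero]

/-- At a zero `c` of `D` the quotient is the quotient of the difference quotients based at `c`. -/
lemma exists_eq_mul_of_vanishing {f : ℂ × E → ℂ} (hf : Differentiable ℂ f) {D : ℂ → ℂ}
    (hD : Differentiable ℂ D) (hsimple : ∀ z, D z = 0 → deriv D z ≠ 0)
    (hv : ∀ z w, D z = 0 → f (z, w) = 0) :
    ∃ g : ℂ × E → ℂ, Differentiable ℂ g ∧ ∀ p, f p = D p.1 * g p := by
  classical
  refine ⟨fun p => if D p.1 = 0 then deriv (fun z => f (z, p.2)) p.1 / deriv D p.1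
    else f p / D p.1, ?_, fun p => ?_⟩
  · rintro ⟨c, w⟩
    by_cases hc : D c = 0
    · have hD₀ : dslope D c c ≠ 0 := by rw [dslope_same]; exact hsimple c hc
      have hslope : ∀ᶠ z in 𝓝 c, dslope D c z ≠ 0 :=
        (differentiable_dslope hD c).continuous.continuousAt.eventually_ne hD₀
      have hquot : DifferentiableAt ℂ
          (fun p : ℂ × E => dslope (fun z => f (z, p.2)) c p.1 / dslope D c p.1) (c, w) :=
        differentiableAt_div (differentiable_partial_dslope hf c _)
          (((differentiable_dslope hD c) c).comp (c, w) differentiableAt_fst) hD₀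
      refine hquot.congr_of_eventuallyEq ?_
      filter_upwards [continuousAt_fst.eventually hslope] with p hp
      rcases eq_or_ne p.1 c with hpc | hpc
      · rw [hpc, if_pos hc, dslope_same, dslope_same]
      · have hsub : p.1 - c ≠ 0 := sub_ne_zero.2 hpc
        have hDp : D p.1 = (p.1 - c) * dslope D c p.1 := eq_sub_smul_dslope hc _
        have hfp : f p = (p.1 - c) * dslope (fun z => f (z, p.2)) c p.1 :=
          eq_sub_smul_dslope (f := fun z => f (z, p.2)) (hv c p.2 hc) p.1
        rw [if_neg (hDp ▸ mul_ne_zero hsub hp), hDp, hfp, mul_div_mul_left _ _ hsub]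
    · have hne : ∀ᶠ p : ℂ × E in 𝓝 (c, w), D p.1 ≠ 0 :=
        (hD.continuous.comp continuous_fst).continuousAt.eventually_ne hc
      refine DifferentiableAt.congr_of_eventuallyEq ?_
        (hne.mono fun p hp => if_neg hp : _ =ᶠ[𝓝 (c, w)] fun p => f p / D p.1)
      exact differentiableAt_div (hf _) ((hD c).comp (c, w) differentiableAt_fst) hc
  · by_cases hp : D p.1 = 0
    · rw [hp, zero_mul]; exact hv p.1 p.2 hp
    · simp only [if_neg hp, mul_div_cancel₀ _ hp]

lemma eq_zero_of_mul_eq_zero {D g : ℂ → ℂ} (hD : Differentiable ℂ D)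
    (hsimple : ∀ z, D z = 0 → deriv D z ≠ 0) (hg : Continuous g) (h : ∀ z, D z * g z = 0)
    (z : ℂ) : g z = 0 := by
  by_cases hz : D z = 0
  · have hlim : Tendsto g (𝓝[≠] z) (𝓝 0) := tendsto_const_nhds.congr' <| by
      filter_upwards [(hD z).hasDerivAt.eventually_ne (c := 0) (hsimple z hz)] with w hw
      exact ((mul_eq_zero.1 (h w)).resolve_left hw).symm
    exact tendsto_nhds_unique ((hg.tendsto z).mono_left nhdsWithin_le_nhds) hlim
  · exact (mul_eq_zero.1 (h z)).resolve_left hz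

lemma exists_eq_mul_mul_mul_of_vanishing {f : ℂ × ℂ × ℂ → ℂ} (hf : Differentiable ℂ f)
    {D₁ D₂ D₃ : ℂ → ℂ} (hD₁ : Differentiable ℂ D₁) (hD₂ : Differentiable ℂ D₂)
    (hD₃ : Differentiable ℂ D₃) (hsimple₁ : ∀ z, D₁ z = 0 → deriv D₁ z ≠ 0)
    (hsimple₂ : ∀ z, D₂ z = 0 → deriv D₂ z ≠ 0) (hsimple₃ : ∀ z, D₃ z = 0 → deriv D₃ z ≠ 0)
    (hv : ∀ p, D₁ p.1 * D₂ p.2.1 * D₃ p.2.2 = 0 → f p = 0) :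
    ∃ g : ℂ × ℂ × ℂ → ℂ, Differentiable ℂ g ∧
      ∀ p, f p = D₁ p.1 * D₂ p.2.1 * D₃ p.2.2 * g p := by
  obtain ⟨g₁, hg₁, hfg₁⟩ := exists_eq_mul_of_vanishing hf hD₁ hsimple₁ fun z w hz =>
    hv (z, w) (by simp [hz])
  obtain ⟨g₂, hg₂, hg₁g₂⟩ := exists_eq_mul_of_vanishing
    (f := fun q : ℂ × ℂ × ℂ => g₁ (q.2.1, q.1, q.2.2)) (by fun_prop) hD₂ hsimple₂ fun t w ht =>
      eq_zero_of_mul_eq_zero (g := fun s => g₁ (s, t, w.2)) hD₁ hsimple₁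
        (hg₁.continuous.comp (by fun_prop))
        (fun s => by rw [← hfg₁ (s, t, w.2), hv _ (by simp [ht])]) w.1
  obtain ⟨g₃, hg₃, hg₂g₃⟩ := exists_eq_mul_of_vanishing
    (f := fun q : ℂ × ℂ × ℂ => g₂ (q.2.2, q.2.1, q.1)) (by fun_prop) hD₃ hsimple₃ fun u w hu =>
      eq_zero_of_mul_eq_zero (g := fun t => g₂ (t, w.1, u)) hD₂ hsimple₂
        (hg₂.continuous.comp (by fun_prop)) (fun t => by
          rw [← hg₁g₂ (t, w.1, u)]
          exact eq_zero_of_mul_eq_zero (g := fun s => g₁ (s, t, u)) hD₁ hsimple₁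
            (hg₁.continuous.comp (by fun_prop))
            (fun s => by rw [← hfg₁ (s, t, u), hv _ (by simp [hu])]) w.1) w.2
  refine ⟨fun p => g₃ (p.2.2, p.1, p.2.1), by fun_prop, fun p => ?_⟩
  rw [hfg₁, hg₁g₂ (p.2.1, p.1, p.2.2), hg₂g₃ (p.2.2, p.1, p.2.1)]
  ring

section Identity

variable [CompleteSpace F] {f g : E → F} {U : Set E} {p q : E}

lemma eq_of_eventuallyEq_of_line (hU : IsOpen U) (hf : DifferentiableOn ℂ f U)
    (hg : DifferentiableOn ℂ g U) (hp : p ∈ U) (hq : q ∈ U)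
    (hline : IsPreconnected {z : ℂ | p + z • (q - p) ∈ U}) (h : f =ᶠ[𝓝 q] g) : f p = g p := by
  have hcont : Continuous (fun z : ℂ => p + z • (q - p)) := by fun_prop
  have hopen : IsOpen {z : ℂ | p + z • (q - p) ∈ U} := hU.preimage hcont
  have hcomp : ∀ {k : E → F}, DifferentiableOn ℂ k U →
      AnalyticOnNhd ℂ (fun z : ℂ => k (p + z • (q - p))) {z : ℂ | p + z • (q - p) ∈ U} :=
    fun hk => DifferentiableOn.analyticOnNhd
      (hk.comp (f := fun z : ℂ => p + z • (q - p)) (by fun_prop) fun z hz => hz) hopen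
  have hlim : Tendsto (fun z : ℂ => p + z • (q - p)) (𝓝 1) (𝓝 q) := by
    simpa using hcont.tendsto 1
  have heqOn := (hcomp hf).eqOn_of_preconnected_of_eventuallyEq (hcomp hg) hline (z₀ := 1)
    (by simpa using hq) (hlim.eventually h)
  simpa using heqOn (x := 0) (by simpa using hp)

lemma eq_of_eventuallyEq_of_countable (hU : IsOpen U) (hf : DifferentiableOn ℂ f U)
    (hg : DifferentiableOn ℂ g U) (hp : p ∈ U) (hq : q ∈ U)
    (hline : {z : ℂ | p + z • (q - p) ∉ U}.Countable) (h : f =ᶠ[𝓝 q] g) : f p = g p := by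
  refine eq_of_eventuallyEq_of_line hU hf hg hp hq ?_ h
  convert (hline.isConnected_compl_of_one_lt_rank (by
    rw [Complex.rank_real_complex]; norm_num)).isPreconnected using 1
  ext z
  simp only [Set.mem_ofPred_eq, Set.mem_compl_iff, not_not]

lemma eqOn_of_eventuallyEq_of_convex (hU : IsOpen U) (hconv : Convex ℝ U)
    (hf : DifferentiableOn ℂ f U) (hg : DifferentiableOn ℂ g U) (hq : q ∈ U)
    (h : f =ᶠ[𝓝 q] g) : Set.EqOn f g U := by
  intro p hp
  refine eq_of_eventuallyEq_of_line hU hf hg hp hq (Convex.isPreconnected ?_) h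
  intro x hx y hy a b ha hb hab
  change p + (a • x + b • y) • (q - p) ∈ U
  convert hconv hx hy ha hb hab using 1
  have hab' : (a : ℂ) + b = 1 := by exact_mod_cast hab
  have hp' : p = ((a : ℂ) + b) • p := by rw [hab', one_smul]
  rw [Complex.real_smul, Complex.real_smul, ← Complex.coe_smul, ← Complex.coe_smul]
  nth_rewrite 1 [hp']
  module

end Identity

lemma countable_preimage_line {A : Set ℂ} (hA : A.Countable) {x y : ℂ} (hx : x ∉ A) :
    {z : ℂ | x + z * (y - x) ∈ A}.Countable := by
  by_cases hxy : y - x = 0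
  · simp [hxy, hx]
  · exact hA.preimage_of_injOn (f := fun z => x + z * (y - x)) fun z _ w _ h => by
      simpa [hxy] using h

lemma eventually_ne_zero_of_entire [CompleteSpace F] {f : ℂ → F} (hf : Differentiable ℂ f)
    {z₁ : ℂ} (h : f z₁ ≠ 0) (z₀ : ℂ) : ∀ᶠ z in 𝓝[≠] z₀, f z ≠ 0 := by
  refine (hf.analyticAt z₀).eventually_eq_zero_or_eventually_ne_zero.resolve_left fun h₀ => h ?_
  exact (hf.differentiableOn.analyticOnNhd isOpen_univ)
    |>.eqOn_zero_of_preconnected_of_eventuallyEq_zero isPreconnected_univ (Set.mem_univ z₀) h₀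
      (Set.mem_univ z₁)

end SeveralVariables

/-! ### The reciprocal of `Γ_ℝ` -/

section RGamma

open Complex Metric

/-- `1 / Γ_ℝ`, an entire function with simple zeros at `0, -2, -4, …`. The functional equations of
the Gamma and zeta functions are used in terms of it, so that no poles have to be excluded. -/
def rgamma (z : ℂ) : ℂ := (Gammaℝ z)⁻¹

/-- `rgamma z / (z + 2 * n)`, extended to an entire function. -/
def rgammaQuot (n : ℕ) (z : ℂ) : ℂ := dslope rgamma (-(2 * n)) z

@[fun_prop]
lemma differentiable_rgamma : Differentiable ℂ rgamma := differentiable_Gammaℝ_inv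

lemma continuous_rgamma : Continuous rgamma := differentiable_rgamma.continuous

lemma rgamma_eq_zero_iff {z : ℂ} : rgamma z = 0 ↔ ∃ n : ℕ, z = -(2 * n) := by
  rw [rgamma, inv_eq_zero, Gammaℝ_eq_zero_iff]

lemma rgamma_neg_two_mul (n : ℕ) : rgamma (-(2 * n)) = 0 := rgamma_eq_zero_iff.2 ⟨n, rfl⟩

lemma rgamma_ne_zero_of_re_pos {z : ℂ} (h : 0 < z.re) : rgamma z ≠ 0 :=
  inv_ne_zero (Gammaℝ_ne_zero_of_re_pos h)

lemma rgamma_eq_rgamma_add_two (z : ℂ) : rgamma z = rgamma (z + 2) * z / (2 * Real.pi) := by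
  rcases eq_or_ne z 0 with rfl | hz
  · simpa using rgamma_neg_two_mul 0
  · have hpi : (Real.pi : ℂ) ≠ 0 := ofReal_ne_zero.2 Real.pi_ne_zero
    rw [rgamma, rgamma, Gammaℝ_add_two hz]
    rcases eq_or_ne (Gammaℝ z) 0 with h | h
    · simp [h]
    · field_simp

lemma deriv_rgamma_eq (z : ℂ) :
    deriv rgamma z = (deriv rgamma (z + 2) * z + rgamma (z + 2)) / (2 * Real.pi) := by
  have hshift : HasDerivAt (fun z => rgamma (z + 2)) (deriv rgamma (z + 2)) z :=
    (differentiable_rgamma (z + 2)).hasDerivAt.comp_add_const z 2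
  have hder : HasDerivAt rgamma _ z :=
    ((hshift.mul (hasDerivAt_id z)).div_const (2 * Real.pi : ℂ)).congr_of_eventuallyEq
      (.of_forall rgamma_eq_rgamma_add_two)
  rw [hder.deriv, id, mul_one]

lemma deriv_rgamma_neg_two_mul_ne_zero (n : ℕ) : deriv rgamma (-(2 * n)) ≠ 0 := by
  have hpi : (2 * Real.pi : ℂ) ≠ 0 := by simp [Real.pi_ne_zero]
  rw [deriv_rgamma_eq]
  refine div_ne_zero ?_ hpi
  induction n with
  | zero => simpa using rgamma_ne_zero_of_re_pos (z := 2) (by norm_num)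
  | succ n ih =>
    have hshift : -(2 * ((n + 1 : ℕ) : ℂ)) + 2 = -(2 * n) := by push_cast; ring
    have hne : -(2 * ((n + 1 : ℕ) : ℂ)) ≠ 0 :=
      neg_ne_zero.2 (mul_ne_zero two_ne_zero (Nat.cast_ne_zero.2 n.succ_ne_zero))
    rw [hshift, rgamma_neg_two_mul, add_zero, deriv_rgamma_eq]
    exact mul_ne_zero (div_ne_zero ih hpi) hne

lemma deriv_rgamma_ne_zero {z : ℂ} (h : rgamma z = 0) : deriv rgamma z ≠ 0 := by
  obtain ⟨n, rfl⟩ := rgamma_eq_zero_iff.1 h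
  exact deriv_rgamma_neg_two_mul_ne_zero n

@[fun_prop]
lemma differentiable_rgammaQuot (n : ℕ) : Differentiable ℂ (rgammaQuot n) :=
  differentiable_dslope differentiable_rgamma _

lemma rgammaQuot_mul (n : ℕ) (z : ℂ) : rgammaQuot n z * (z + 2 * n) = rgamma z := by
  rw [eq_sub_smul_dslope (rgamma_neg_two_mul n) z, smul_eq_mul, sub_neg_eq_add, mul_comm,
    rgammaQuot]

lemma rgammaQuot_eq_div {n : ℕ} {z : ℂ} (h : z + 2 * n ≠ 0) :
    rgammaQuot n z = rgamma z / (z + 2 * n) := by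
  rw [← rgammaQuot_mul n z, mul_div_cancel_right₀ _ h]

lemma add_two_mul_ne_zero_of_rgamma_ne_zero {z : ℂ} (h : rgamma z ≠ 0) (n : ℕ) :
    z + 2 * n ≠ 0 :=
  fun h₀ => h (rgamma_eq_zero_iff.2 ⟨n, eq_neg_of_add_eq_zero_left h₀⟩)

lemma rgammaQuot_self_ne_zero (n : ℕ) : rgammaQuot n (-(2 * n)) ≠ 0 := by
  rw [rgammaQuot, dslope_same]
  exact deriv_rgamma_neg_two_mul_ne_zero n

lemma rgammaQuot_eq_zero {m n : ℕ} (h : m ≠ n) : rgammaQuot m (-(2 * n)) = 0 := by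
  have hne : -(2 * (n : ℂ)) + 2 * m ≠ 0 := fun h₀ => h (by
    have : (m : ℂ) = n := by linear_combination h₀ / 2
    exact_mod_cast this)
  rw [rgammaQuot_eq_div hne, rgamma_neg_two_mul, zero_div]

lemma exists_rgammaQuot_bound (z₀ : ℂ) :
    ∃ C : ℝ, ∀ᶠ z in 𝓝 z₀, ∀ n, ‖rgammaQuot n z‖ ≤ C := by
  obtain ⟨C, hC⟩ := (isCompact_closedBall z₀ 3).exists_bound_of_continuousOn
    continuous_rgamma.continuousOn
  have hC₀ : 0 ≤ C := (norm_nonneg _).trans (hC z₀ (mem_closedBall_self (by norm_num)))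
  refine ⟨2 * C, ?_⟩
  filter_upwards [ball_mem_nhds z₀ one_pos] with z hz n
  rcases le_or_gt 1 ‖z + 2 * n‖ with hfar | hnear
  · have hzC : ‖rgamma z‖ ≤ C := hC z (ball_subset_closedBall (ball_subset_ball (by norm_num) hz))
    rw [rgammaQuot_eq_div (norm_pos_iff.1 (by linarith)), norm_div]
    exact (div_le_self (norm_nonneg _) hfar).trans (by linarith)
  · have hz' : z ∈ ball (-(2 * n : ℂ)) 1 := by rwa [mem_ball, dist_eq_norm, sub_neg_eq_add]
    have hsub : ball (-(2 * n : ℂ)) 1 ⊆ closedBall z₀ 3 := fun x hx => by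
      rw [mem_ball] at hz hz' hx
      rw [dist_comm] at hz'
      rw [mem_closedBall]
      linarith [dist_triangle4 x (-(2 * n : ℂ)) z z₀]
    simpa [rgammaQuot] using norm_dslope_le_of_norm_le (R := 1)
      differentiable_rgamma.differentiableOn (fun x hx => hC x (hsub hx)) hz'

end RGamma

/-! ### The factors `Γ_cos` and `Γ_sin` -/

section GammaFactors

open Complex

lemma valueAt_eq {f g : ℂ → ℂ} {s : ℂ} (h : f =ᶠ[𝓝[≠] s] g) (hg : ContinuousAt g s) :
    valueAt f s = g s :=
  Tendsto.limUnder_eq ((hg.tendsto.mono_left nhdsWithin_le_nhds).congr' h.symm)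

lemma eventually_ne_neg_nat (s : ℂ) : ∀ᶠ z in 𝓝[≠] s, ∀ n : ℕ, z ≠ -(n : ℂ) := by
  filter_upwards [eventually_ne_zero_of_entire differentiable_one_div_Gamma
    (z₁ := 1) (by simp) s] with z hz n hn
  exact hz (inv_eq_zero.2 ((Complex.Gamma_eq_zero_iff z).2 ⟨n, hn⟩))

lemma two_mul_Gamma_div (z : ℂ) : 2 * Gamma z / (2 * (Real.pi : ℂ)) ^ z = Gammaℂ z := by
  rw [Gammaℂ_def, cpow_neg]; ring

lemma gammaCos_eq {s : ℂ} (h : rgamma s ≠ 0) : gammaCos s = rgamma (1 - s) / rgamma s := by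
  refine valueAt_eq (g := fun z => rgamma (1 - z) / rgamma z) ?_ ?_
  · filter_upwards [eventually_ne_neg_nat s,
      nhdsWithin_le_nhds (continuous_rgamma.continuousAt.eventually_ne h)] with z hz hrz
    rw [two_mul_Gamma_div, eq_div_iff hrz, rgamma, rgamma, ← inv_Gammaℝ_one_sub hz]
  · exact (continuous_rgamma.comp (continuous_const.sub continuous_id)).continuousAt.div
      continuous_rgamma.continuousAt h

lemma gammaSin_eq {s : ℂ} (h : rgamma (s + 1) ≠ 0) :
    gammaSin s = rgamma (2 - s) / rgamma (s + 1) := by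
  have hcont : Continuous (fun z => rgamma (z + 1)) :=
    continuous_rgamma.comp (continuous_id.add continuous_const)
  refine valueAt_eq (g := fun z => rgamma (2 - z) / rgamma (z + 1)) ?_ ?_
  · filter_upwards [eventually_ne_neg_nat s,
      nhdsWithin_le_nhds (hcont.continuousAt.eventually_ne h)] with z hz hrz
    rw [two_mul_Gamma_div, eq_div_iff hrz, rgamma, rgamma, ← inv_Gammaℝ_two_sub hz]
  · exact (continuous_rgamma.comp (continuous_const.sub continuous_id)).continuousAt.div
      hcont.continuousAt h

end GammaFactors

/-! ### The functions `η_k` -/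

section Eta

open Complex Metric

/-- `(w - 1) * ζ w`, extended to an entire function. -/
def zetaReg : ℂ → ℂ := Function.update (fun w => (w - 1) * riemannZeta w) 1 1

lemma zetaReg_of_ne {w : ℂ} (h : w ≠ 1) : zetaReg w = (w - 1) * riemannZeta w :=
  Function.update_of_ne h _ _

@[fun_prop]
lemma differentiable_zetaReg : Differentiable ℂ zetaReg := by
  rw [← differentiableOn_univ, ← Complex.differentiableOn_compl_singleton_and_continuousAt_iff
    (c := 1) univ_mem]
  refine ⟨fun z hz => ?_, continuousAt_update_same.2 riemannZeta_residue_one⟩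
  have hdiff : DifferentiableAt ℂ (fun w => (w - 1) * riemannZeta w) z :=
    (differentiableAt_id.sub_const 1).mul (differentiableAt_riemannZeta hz.2)
  refine (hdiff.congr_of_eventuallyEq ?_).differentiableWithinAt
  filter_upwards [eventually_ne_nhds hz.2] with w hw using zetaReg_of_ne hw

/-- `∏_{1 ≤ j ≤ k} (1 - s / j)`, the polynomial `binom (k - s) k` of the definition of `η_k`. -/
def binomProd (k : ℕ) (s : ℂ) : ℂ := ∏ i ∈ Finset.range k, (1 - s / (i + 1))

@[fun_prop]
lemma differentiable_binomProd (k : ℕ) : Differentiable ℂ (binomProd k) := by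
  unfold binomProd
  fun_prop

lemma binomProd_succ (k : ℕ) (s : ℂ) : binomProd (k + 1) s = binomProd k s * (1 - s / (k + 1)) :=
  Finset.prod_range_succ _ _

lemma ringChoose_eq_binomProd (k : ℕ) (s : ℂ) : Ring.choose ((k : ℂ) - s) k = binomProd k s := by
  have hk : (k.factorial : ℂ) ≠ 0 := Nat.cast_ne_zero.2 k.factorial_ne_zero
  have h := Ring.descPochhammer_eq_factorial_smul_choose ((k : ℂ) - s) k
  rw [← Polynomial.aeval_eq_smeval, Polynomial.aeval_def, Polynomial.eval₂_eq_eval_map,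
    descPochhammer_map, descPochhammer_eval_eq_prod_range, nsmul_eq_mul] at h
  rw [← mul_right_inj' hk, ← h, ← Finset.prod_range_reflect, binomProd,
    ← Finset.prod_range_add_one_eq_factorial, Nat.cast_prod, ← Finset.prod_mul_distrib]
  refine Finset.prod_congr rfl fun i hi => ?_
  have hik := Finset.mem_range.1 hi
  have hcast : ((k - 1 - i : ℕ) : ℂ) = k - 1 - i := by
    rw [Nat.cast_sub (by omega), Nat.cast_sub (by omega), Nat.cast_one]
  have hi₀ : (i : ℂ) + 1 ≠ 0 := Nat.cast_add_one_ne_zero i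
  rw [hcast]
  push_cast
  field_simp
  ring

lemma binomProd_ne_zero_of_re_neg {s : ℂ} (hs : s.re < 0) (k : ℕ) : binomProd k s ≠ 0 := by
  refine Finset.prod_ne_zero_iff.2 fun i _ h => ?_
  have hi : (i : ℂ) + 1 ≠ 0 := Nat.cast_add_one_ne_zero i
  have hs' : s = ((i + 1 : ℕ) : ℂ) := by
    push_cast
    field_simp at h
    linear_combination -h
  rw [hs', natCast_re] at hs
  exact hs.not_ge (Nat.cast_nonneg _)

lemma eta_succ (k : ℕ) (s : ℂ) :
    eta (k + 1) s = ((2 : ℂ) ^ (k + 1))⁻¹ * binomProd k s / (k + 1) * zetaReg (k + 2 - s) := by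
  refine valueAt_eq (g := fun s => ((2 : ℂ) ^ (k + 1))⁻¹ * binomProd k s / (k + 1) *
    zetaReg (k + 2 - s)) ?_ ?_
  · have hne : ∀ᶠ z : ℂ in 𝓝[≠] s, z - (k + 1) ≠ 0 :=
      eventually_ne_zero_of_entire (f := fun z : ℂ => z - (k + 1)) (z₁ := k + 2) (by fun_prop)
        (by ring_nf; simp) s
    filter_upwards [hne] with z hz
    have hw : (k : ℂ) + 1 + 1 - z ≠ 1 := fun h => hz (by linear_combination -h)
    have hk : (k : ℂ) + 1 ≠ 0 := Nat.cast_add_one_ne_zero k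
    rw [ringChoose_eq_binomProd, binomProd_succ, show (k : ℂ) + 2 - z = k + 1 + 1 - z by ring,
      zetaReg_of_ne hw]
    push_cast
    field_simp
    ring
  · have hbinom := (differentiable_binomProd k).continuous
    have hzeta := differentiable_zetaReg.continuous
    fun_prop

lemma eta_of_ne {k : ℕ} {s : ℂ} (h : s ≠ k) :
    eta k s = ((2 : ℂ) ^ k)⁻¹ * binomProd k s * riemannZeta (k + 1 - s) := by
  refine valueAt_eq (g := fun s => ((2 : ℂ) ^ k)⁻¹ * binomProd k s * riemannZeta (k + 1 - s))
    (.of_forall fun z => by simp only [ringChoose_eq_binomProd]) ?_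
  have hbinom := (differentiable_binomProd k).continuous.continuousAt (x := s)
  have hzeta : ContinuousAt (fun s => riemannZeta (k + 1 - s)) s :=
    ContinuousAt.comp (f := fun s : ℂ => (k : ℂ) + 1 - s)
      (differentiableAt_riemannZeta fun h₀ => h (by linear_combination -h₀)).continuousAt
      (by fun_prop)
  exact (continuousAt_const.mul hbinom).mul hzeta

@[fun_prop]
lemma differentiable_eta_succ (k : ℕ) : Differentiable ℂ (eta (k + 1)) := by
  rw [funext (eta_succ k)]
  fun_prop

lemma differentiableAt_eta {k : ℕ} {s : ℂ} (h : k ≠ 0 ∨ s ≠ 0) : DifferentiableAt ℂ (eta k) s := by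
  rcases k with - | k
  · have hs : s ≠ 0 := h.resolve_left (by simp)
    have hzeta : DifferentiableAt ℂ (fun s : ℂ => riemannZeta (1 - s)) s :=
      DifferentiableAt.comp (g := riemannZeta) s
        (differentiableAt_riemannZeta fun h₀ => hs (by linear_combination -h₀)) (by fun_prop)
    refine hzeta.congr_of_eventuallyEq ?_
    filter_upwards [eventually_ne_nhds hs] with z hz
    rw [eta_of_ne (by simpa using hz)]
    simp [binomProd]
  · exact differentiable_eta_succ k s

end Eta

section EtaBounds

open Complex Metric

lemma exists_prod_one_add_div_le {R x : ℝ} (hR : 0 ≤ R) (hx : 1 < x) :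
    ∃ B : ℝ, 0 ≤ B ∧ ∀ k : ℕ, ∏ i ∈ Finset.range k, (1 + R / ((i : ℝ) + 1)) ≤ B * x ^ k := by
  have : 0 < x := by linarith
  set P : ℕ → ℝ := fun k => ∏ i ∈ Finset.range k, (1 + R / ((i : ℝ) + 1))
  have hpos : ∀ k, 0 < P k / x ^ k := fun k =>
    div_pos (Finset.prod_pos fun i _ => by positivity) (by positivity)
  have hratio : Tendsto (fun n : ℕ => (1 + R / ((n : ℝ) + 1)) / x) atTop (𝓝 x⁻¹) := by
    have hdiv : Tendsto (fun n : ℕ => R / ((n : ℝ) + 1)) atTop (𝓝 0) :=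
      ((tendsto_const_div_atTop_nhds_zero_nat R).comp (tendsto_add_atTop_nat 1)).congr
        fun n => by simp
    simpa using (hdiv.const_add 1).div_const x
  have hsum : Summable fun k => P k / x ^ k := by
    refine summable_of_ratio_test_tendsto_lt_one (inv_lt_one_of_one_lt₀ hx)
      (.of_forall fun k => (hpos k).ne') (hratio.congr fun k => ?_)
    have hsucc : P (k + 1) = P k * (1 + R / ((k : ℝ) + 1)) := Finset.prod_range_succ _ _
    rw [Real.norm_of_nonneg (hpos _).le, Real.norm_of_nonneg (hpos _).le, eq_div_iff (hpos k).ne',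
      hsucc, pow_succ]
    field_simp
  refine ⟨∑' k, P k / x ^ k, tsum_nonneg fun k => (hpos k).le, fun k => ?_⟩
  rw [← div_le_iff₀ (by positivity)]
  exact hsum.le_tsum k fun j _ => (hpos j).le

lemma norm_binomProd_le {R : ℝ} {s : ℂ} (hs : ‖s‖ ≤ R) (k : ℕ) :
    ‖binomProd k s‖ ≤ ∏ i ∈ Finset.range k, (1 + R / ((i : ℝ) + 1)) := by
  rw [binomProd, norm_prod]
  refine Finset.prod_le_prod (fun _ _ => norm_nonneg _) fun i _ => (norm_sub_le _ _).trans ?_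
  have hi : ‖(i : ℂ) + 1‖ = (i : ℝ) + 1 := by exact_mod_cast norm_natCast (i + 1)
  rw [norm_one, norm_div, hi]
  gcongr

lemma exists_riemannZeta_bound : ∃ C : ℝ, 0 ≤ C ∧ ∀ w : ℂ, 2 ≤ w.re → ‖riemannZeta w‖ ≤ C := by
  have hsum : Summable (fun n : ℕ => 1 / ((n : ℝ) + 1) ^ (2 : ℝ)) := by
    simpa using (summable_nat_add_iff 1).2 (Real.summable_one_div_nat_rpow.2 one_lt_two)
  refine ⟨∑' n : ℕ, 1 / ((n : ℝ) + 1) ^ (2 : ℝ), tsum_nonneg fun n => by positivity,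
    fun w hw => ?_⟩
  rw [zeta_eq_tsum_one_div_nat_add_one_cpow (by linarith)]
  refine tsum_of_norm_bounded hsum.hasSum fun n => ?_
  have hcast : (n : ℂ) + 1 = ((n + 1 : ℝ) : ℂ) := by push_cast; rfl
  rw [norm_div, norm_one, hcast, Complex.norm_cpow_eq_rpow_re_of_pos (by positivity)]
  gcongr
  linarith [(Nat.cast_nonneg n : (0 : ℝ) ≤ n)]

lemma exists_eta_bound_of_lt {R ρ : ℝ} (hR : 0 ≤ R) (hρ : 1 / 2 < ρ) :
    ∃ C : ℝ, 0 ≤ C ∧ ∀ k : ℕ, R + 1 < k → ∀ s : ℂ, ‖s‖ ≤ R → ‖eta k s‖ ≤ C * ρ ^ k := by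
  obtain ⟨Z, hZ₀, hZ⟩ := exists_riemannZeta_bound
  obtain ⟨B, hB₀, hB⟩ := exists_prod_one_add_div_le hR (x := 2 * ρ) (by linarith)
  refine ⟨B * Z, by positivity, fun k hk s hs => ?_⟩
  have hre : s.re ≤ R := (Complex.re_le_norm s).trans hs
  have hne : s ≠ k := fun h => by
    rw [h, Complex.natCast_re] at hre
    linarith
  have hzeta : ‖riemannZeta (k + 1 - s)‖ ≤ Z := hZ _ (by simp; linarith)
  rw [eta_of_ne hne, norm_mul, norm_mul, norm_inv, norm_pow, Complex.norm_ofNat]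
  calc ((2 : ℝ) ^ k)⁻¹ * ‖binomProd k s‖ * ‖riemannZeta (k + 1 - s)‖
      ≤ ((2 : ℝ) ^ k)⁻¹ * (B * (2 * ρ) ^ k) * Z := by
        gcongr
        exact (norm_binomProd_le hs k).trans (hB k)
    _ = B * Z * ρ ^ k := by rw [mul_pow]; field_simp

lemma exists_eta_bound_of_ne_zero {k : ℕ} (hk : k ≠ 0) (R : ℝ) :
    ∃ C : ℝ, ∀ s : ℂ, ‖s‖ ≤ R → ‖eta k s‖ ≤ C := by
  obtain ⟨m, rfl⟩ := Nat.exists_eq_succ_of_ne_zero hk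
  obtain ⟨C, hC⟩ := (isCompact_closedBall (0 : ℂ) R).exists_bound_of_continuousOn
    (differentiable_eta_succ m).continuous.continuousOn
  exact ⟨C, fun s hs => hC s (by simpa using hs)⟩

lemma exists_eta_bound {R ρ : ℝ} (hR : 0 ≤ R) (hρ : 1 / 2 < ρ) :
    ∃ C : ℝ, 0 ≤ C ∧ ∀ k : ℕ, k ≠ 0 → ∀ s : ℂ, ‖s‖ ≤ R → ‖eta k s‖ ≤ C * ρ ^ k := by
  have : 0 < ρ := by linarith
  obtain ⟨A, hA₀, hA⟩ := exists_eta_bound_of_lt hR hρ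
  choose! c hc using fun k (hk : k ≠ 0) => exists_eta_bound_of_ne_zero hk R
  obtain ⟨K, hK⟩ := exists_nat_gt (R + 1)
  set S := ∑ k ∈ Finset.range K, |c k| / ρ ^ k
  have hS₀ : 0 ≤ S := Finset.sum_nonneg fun k _ => by positivity
  refine ⟨A + S, by positivity, fun k hk s hs => ?_⟩
  rcases lt_or_ge k K with hkK | hkK
  · have hle : |c k| / ρ ^ k ≤ S :=
      Finset.single_le_sum (f := fun k => |c k| / ρ ^ k) (fun k _ => by positivity)
        (Finset.mem_range.2 hkK)
    calc ‖eta k s‖ ≤ |c k| := (hc k hk s hs).trans (le_abs_self _)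
      _ ≤ S * ρ ^ k := (div_le_iff₀ (by positivity)).1 hle
      _ ≤ (A + S) * ρ ^ k := by gcongr; linarith
  · calc ‖eta k s‖ ≤ A * ρ ^ k := hA k (hK.trans_le (by exact_mod_cast hkK)) s hs
      _ ≤ (A + S) * ρ ^ k := by gcongr; linarith

end EtaBounds

section EtaReg

open Complex Metric

/-- `(-1) ^ a * η_{2l + a} s / Γ_ℝ (s + a)`, extended to an entire function: only `η_0` has a pole,
at `0`, which the reciprocal Gamma factor cancels. -/
def etaReg (a l : ℕ) (s : ℂ) : ℂ :=
  if 2 * l + a = 0 then -rgammaQuot 0 s * zetaReg (1 - s)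
  else (-1) ^ a * rgamma (s + a) * eta (2 * l + a) s

lemma etaReg_eq {a l : ℕ} {s : ℂ} (h : a ≠ 0 ∨ s ≠ 0) :
    etaReg a l s = (-1) ^ a * rgamma (s + a) * eta (2 * l + a) s := by
  unfold etaReg
  split_ifs with h₀
  · obtain ⟨rfl, rfl⟩ : l = 0 ∧ a = 0 := by omega
    have hs : s ≠ 0 := h.resolve_left (by simp)
    rw [rgammaQuot_eq_div (by simpa using hs),
      zetaReg_of_ne (fun h => hs (by linear_combination -h)), eta_of_ne (by simpa using hs)]
    simp only [binomProd, CharP.cast_eq_zero, mul_zero, add_zero, pow_zero, Finset.range_zero,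
      Finset.prod_empty, inv_one, one_mul, zero_add]
    field_simp
    ring
  · rfl

@[fun_prop]
lemma differentiable_etaReg (a l : ℕ) : Differentiable ℂ (etaReg a l) := by
  unfold etaReg
  split_ifs with h₀
  · fun_prop
  · obtain ⟨k, hk⟩ := Nat.exists_eq_succ_of_ne_zero h₀
    rw [hk]
    fun_prop

lemma three_quarters_pow_le (a l : ℕ) : ((3 : ℝ) / 4) ^ (2 * l + a) ≤ (9 / 16) ^ l := by
  rw [pow_add, pow_mul, show ((3 : ℝ) / 4) ^ 2 = 9 / 16 by norm_num]
  exact mul_le_of_le_one_right (by positivity) (pow_le_one₀ (by norm_num) (by norm_num))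

lemma exists_etaReg_bound (a : ℕ) (s₀ : ℂ) :
    ∃ C : ℝ, 0 ≤ C ∧ ∀ᶠ s in 𝓝 s₀, ∀ l, ‖etaReg a l s‖ ≤ C * (9 / 16) ^ l := by
  obtain ⟨A, hA₀, hA⟩ := exists_eta_bound (R := ‖s₀‖ + 1) (ρ := 3 / 4) (by positivity)
    (by norm_num)
  have hloc : ∀ f : ℂ → ℂ, Continuous f → ∀ᶠ s in 𝓝 s₀, ‖f s‖ < ‖f s₀‖ + 1 := fun f hf =>
    (hf.norm.tendsto s₀).eventually (gt_mem_nhds (lt_add_one _))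
  set G := ‖rgamma (s₀ + a)‖ + 1
  set H := ‖etaReg a 0 s₀‖ + 1
  refine ⟨G * A + H, by positivity, ?_⟩
  filter_upwards [hloc _ (continuous_rgamma.comp (continuous_add_const (a : ℂ))), hloc id
    continuous_id, hloc _ (differentiable_etaReg a 0).continuous] with s hG hs hH l
  rcases eq_or_ne (2 * l + a) 0 with h₀ | h₀
  · obtain ⟨rfl, rfl⟩ : l = 0 ∧ a = 0 := by omega
    rw [pow_zero, mul_one]
    have : 0 ≤ G * A := by positivity
    linarith
  · rw [etaReg, if_neg h₀, norm_mul, norm_mul, norm_pow, norm_neg, norm_one, one_pow, one_mul]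
    calc ‖rgamma (s + a)‖ * ‖eta (2 * l + a) s‖ ≤ G * (A * (9 / 16) ^ l) := by
          gcongr
          · exact hG.le
          · exact (hA _ h₀ s hs.le).trans (by gcongr; exact three_quarters_pow_le a l)
      _ = G * A * (9 / 16) ^ l := by ring
      _ ≤ (G * A + H) * (9 / 16) ^ l := by
        gcongr
        exact le_add_of_nonneg_right (by positivity)

/-- At `-1 / 2` the zeta value in `etaReg a l` lies in the half-plane of absolute convergence. -/
lemma etaReg_ne_zero (a l : ℕ) : etaReg a l (-1 / 2) ≠ 0 := by
  have hcast : (0 : ℝ) ≤ ((2 * l + a : ℕ) : ℝ) := Nat.cast_nonneg _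
  have hre : ((-1 / 2 : ℂ)).re < 0 := by norm_num
  have hne : (-1 / 2 : ℂ) ≠ ((2 * l + a : ℕ) : ℂ) := fun h => by
    rw [h, natCast_re] at hre
    exact hre.not_ge hcast
  have hgamma : rgamma (-1 / 2 + a) ≠ 0 := fun h => by
    obtain ⟨n, hn⟩ := rgamma_eq_zero_iff.1 h
    have hint : (2 * a + 4 * n : ℂ) = 1 := by linear_combination 2 * hn
    have : 2 * a + 4 * n = 1 := by exact_mod_cast hint
    omega
  have hzeta : riemannZeta (((2 * l + a : ℕ) : ℂ) + 1 - -1 / 2) ≠ 0 :=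
    riemannZeta_ne_zero_of_one_lt_re (by
      rw [sub_re, add_re, natCast_re, one_re]
      linarith)
  rw [etaReg_eq (.inr (by norm_num)), eta_of_ne hne]
  exact mul_ne_zero (mul_ne_zero (by simp) hgamma)
    (mul_ne_zero (mul_ne_zero (by simp) (binomProd_ne_zero_of_re_neg hre _)) hzeta)

end EtaReg

/-! ### Rapidly convergent series -/

section Rapid

lemma summable_geometric_two {r : ℝ} (h₀ : 0 ≤ r) (h₁ : r < 1) :
    Summable (fun k : ℕ × ℕ => r ^ weight2 k) := by
  have h := summable_geometric_of_lt_one h₀ h₁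
  simpa only [weight2, pow_add] using
    h.mul_of_nonneg h (fun n => by positivity) (fun n => by positivity)

lemma summable_geometric_three {r : ℝ} (h₀ : 0 ≤ r) (h₁ : r < 1) :
    Summable (fun k : ℕ × ℕ × ℕ => r ^ weight3 k) := by
  simpa only [weight3, weight2, pow_add, mul_assoc] using
    (summable_geometric_of_lt_one h₀ h₁).mul_of_nonneg (summable_geometric_two h₀ h₁)
      (fun n => by positivity) (fun n => by positivity)

/-- The coefficients `(-1) ^ a * η_{2k + a} s`; the expansion of `S₃` is the case `a = 0`, and with
this sign that of `S₄` is the case `a = 1` of the same formula. -/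
def etaSigned (a : ℕ) (s : ℂ) (k : ℕ) : ℂ := (-1) ^ a * eta (2 * k + a) s

lemma norm_etaSigned (a : ℕ) (s : ℂ) (k : ℕ) : ‖etaSigned a s k‖ = ‖eta (2 * k + a) s‖ := by
  rw [etaSigned, norm_mul, norm_pow, norm_neg, norm_one, one_pow, one_mul]

lemma etaSigned_zero (s : ℂ) : etaSigned 0 s = etaEven s := by
  ext k; simp [etaSigned, etaEven]

lemma etaSigned_one (s : ℂ) : etaSigned 1 s = fun k => -etaOdd s k := by
  ext k; simp [etaSigned, etaOdd]

lemma etaReg_eq_rgamma_mul {a : ℕ} {s : ℂ} (h : rgamma (s + a) ≠ 0) (l : ℕ) :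
    etaReg a l s = rgamma (s + a) * etaSigned a s l := by
  rw [etaReg_eq, etaSigned]
  · ring
  · by_contra! h₀
    obtain ⟨rfl, rfl⟩ := h₀
    exact h (rgamma_eq_zero_iff.2 ⟨0, by simp⟩)

/-- Geometric decay with every ratio above `1 / 4`, the decay of the coefficients of the series. -/
def RapidSeq (a : ℕ → ℂ) : Prop :=
  ∀ r : ℝ, 1 / 4 < r → ∃ C : ℝ, 0 ≤ C ∧ ∀ l, ‖a l‖ ≤ C * r ^ l

lemma rapidSeq_etaSigned (a : ℕ) (s : ℂ) : RapidSeq (etaSigned a s) := by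
  intro r hr
  have hr₀ : 0 ≤ r := by linarith
  have hρ : 1 / 2 < √r := by
    rw [Real.lt_sqrt (by norm_num)]
    linarith
  obtain ⟨C, hC₀, hC⟩ := exists_eta_bound (norm_nonneg s) hρ
  refine ⟨C * √r ^ a + ‖eta 0 s‖, by positivity, fun l => ?_⟩
  rw [norm_etaSigned]
  rcases eq_or_ne (2 * l + a) 0 with h₀ | h₀
  · obtain ⟨rfl, rfl⟩ : l = 0 ∧ a = 0 := by omega
    simp [hC₀]
  · calc ‖eta (2 * l + a) s‖ ≤ C * √r ^ (2 * l + a) := hC _ h₀ s le_rfl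
      _ = C * √r ^ a * r ^ l := by rw [pow_add, pow_mul, Real.sq_sqrt hr₀]; ring
      _ ≤ (C * √r ^ a + ‖eta 0 s‖) * r ^ l := by
        gcongr
        exact le_add_of_nonneg_right (norm_nonneg _)

lemma rapidSeq_etaEven (s : ℂ) : RapidSeq (etaEven s) :=
  etaSigned_zero s ▸ rapidSeq_etaSigned 0 s

lemma rapidSeq_etaOdd (s : ℂ) : RapidSeq (etaOdd s) := fun r hr => by
  simpa [etaSigned_one] using rapidSeq_etaSigned 1 s r hr

lemma RapidSeq.summable_norm {a : ℕ → ℂ} (ha : RapidSeq a) : Summable fun l => ‖a l‖ := by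
  obtain ⟨C, -, hC⟩ := ha (1 / 2) (by norm_num)
  exact .of_nonneg_of_le (fun _ => norm_nonneg _) hC
    ((summable_geometric_of_lt_one (by norm_num) (by norm_num)).mul_left C)

lemma exists_inv_add_two_mul_bound (d : ℂ) :
    ∃ C : ℝ, ∀ n : ℕ, ‖(d + 2 * n)⁻¹‖ ≤ C := by
  have hlower : ∀ n : ℕ, -‖d‖ + 2 * (n : ℝ) ≤ ‖d + 2 * n‖ := fun n => by
    have := norm_sub_le (d + 2 * n) d
    rw [add_sub_cancel_left, norm_mul, Complex.norm_ofNat, Complex.norm_natCast] at this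
    linarith
  have htop : Tendsto (fun n : ℕ => ‖d + 2 * n‖) atTop atTop :=
    tendsto_atTop_mono hlower (tendsto_atTop_add_const_left _ _
      (tendsto_natCast_atTop_atTop.const_mul_atTop two_pos))
  have hinv : Tendsto (fun n : ℕ => ‖(d + 2 * n)⁻¹‖) atTop (𝓝 0) := by
    simp_rw [norm_inv]
    exact tendsto_inv_atTop_zero.comp htop
  obtain ⟨C, hC⟩ := hinv.bddAbove_range
  exact ⟨C, fun n => hC ⟨n, rfl⟩⟩

lemma convergesRapidly_of_bound {ι : Type} {wt : ι → ℕ} {f : ι → ℂ}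
    (hwt : Summable (fun i => (1 / 2 : ℝ) ^ wt i))
    (hf : ∀ r : ℝ, 1 / 4 < r → ∃ C : ℝ, ∀ i, ‖f i‖ ≤ C * r ^ wt i) : ConvergesRapidly wt f := by
  obtain ⟨C, hC⟩ := hf (1 / 2) (by norm_num)
  exact ⟨.of_norm_bounded (hwt.mul_left C) hC, hf⟩

lemma convergesRapidly_singleTerm {a : ℕ → ℂ} (ha : RapidSeq a) (w d : ℂ) :
    ConvergesRapidly id (singleTerm a w d) := by
  refine convergesRapidly_of_bound (summable_geometric_of_lt_one (by norm_num) (by norm_num))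
    fun r hr => ?_
  have : 0 ≤ r := by linarith
  obtain ⟨A, hA₀, hA⟩ := ha r hr
  obtain ⟨D, hD⟩ := exists_inv_add_two_mul_bound d
  refine ⟨‖(2 : ℂ) ^ (-w)‖ * A * D, fun k => ?_⟩
  rw [singleTerm, div_eq_mul_inv, norm_mul, norm_mul]
  calc ‖(2 : ℂ) ^ (-w)‖ * ‖a k‖ * ‖(d + 2 * k)⁻¹‖ ≤ ‖(2 : ℂ) ^ (-w)‖ * (A * r ^ k) * D := by
        gcongr
        · exact hA k
        · exact hD k
    _ = ‖(2 : ℂ) ^ (-w)‖ * A * D * r ^ id k := by rw [id]; ring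

lemma convergesRapidly_doubleTerm {a b : ℕ → ℂ} (ha : RapidSeq a) (hb : RapidSeq b) (w d : ℂ) :
    ConvergesRapidly weight2 (doubleTerm a b w d) := by
  refine convergesRapidly_of_bound (summable_geometric_two (by norm_num) (by norm_num))
    fun r hr => ?_
  have : 0 ≤ r := by linarith
  obtain ⟨A, hA₀, hA⟩ := ha r hr
  obtain ⟨B, hB₀, hB⟩ := hb r hr
  obtain ⟨D, hD⟩ := exists_inv_add_two_mul_bound d
  refine ⟨‖(2 : ℂ) ^ (-w)‖ * A * B * D, fun k => ?_⟩
  have hDk : ‖(d + 2 * k.1 + 2 * k.2)⁻¹‖ ≤ D := by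
    convert hD (k.1 + k.2) using 3
    push_cast
    ring
  rw [doubleTerm, div_eq_mul_inv, norm_mul, norm_mul, norm_mul]
  calc ‖(2 : ℂ) ^ (-w)‖ * ‖a k.1‖ * ‖b k.2‖ * ‖(d + 2 * k.1 + 2 * k.2)⁻¹‖
      ≤ ‖(2 : ℂ) ^ (-w)‖ * (A * r ^ k.1) * (B * r ^ k.2) * D := by
        gcongr
        · exact hA _
        · exact hB _
    _ = ‖(2 : ℂ) ^ (-w)‖ * A * B * D * r ^ weight2 k := by rw [weight2, pow_add]; ring

lemma convergesRapidly_tripleTerm {a b c : ℕ → ℂ} (ha : RapidSeq a) (hb : RapidSeq b)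
    (hc : RapidSeq c) (d : ℂ) : ConvergesRapidly weight3 (tripleTerm a b c d) := by
  refine convergesRapidly_of_bound (summable_geometric_three (by norm_num) (by norm_num))
    fun r hr => ?_
  have : 0 ≤ r := by linarith
  obtain ⟨A, hA₀, hA⟩ := ha r hr
  obtain ⟨B, hB₀, hB⟩ := hb r hr
  obtain ⟨C, hC₀, hC⟩ := hc r hr
  obtain ⟨D, hD⟩ := exists_inv_add_two_mul_bound d
  refine ⟨A * B * C * D, fun k => ?_⟩
  have hDk : ‖(2 * (k.1 : ℂ) + 2 * k.2.1 + 2 * k.2.2 + d)⁻¹‖ ≤ D := by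
    convert hD (k.1 + k.2.1 + k.2.2) using 3
    push_cast
    ring
  rw [tripleTerm, div_eq_mul_inv, norm_mul, norm_mul, norm_mul]
  calc ‖a k.1‖ * ‖b k.2.1‖ * ‖c k.2.2‖ * ‖(2 * (k.1 : ℂ) + 2 * k.2.1 + 2 * k.2.2 + d)⁻¹‖
      ≤ (A * r ^ k.1) * (B * r ^ k.2.1) * (C * r ^ k.2.2) * D := by
        gcongr
        · exact hA _
        · exact hB _
        · exact hC _
    _ = A * B * C * D * r ^ weight3 k := by rw [weight3, pow_add, pow_add]; ring

lemma rapidExpansion3 (s t u : ℂ) : RapidExpansion3 s t u :=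
  have hs := rapidSeq_etaEven s
  have ht := rapidSeq_etaEven t
  have hu := rapidSeq_etaEven u
  ⟨convergesRapidly_tripleTerm hs ht hu _, convergesRapidly_doubleTerm hs ht _ _,
    convergesRapidly_doubleTerm ht hu _ _, convergesRapidly_doubleTerm hu hs _ _,
    convergesRapidly_singleTerm hs _ _, convergesRapidly_singleTerm ht _ _,
    convergesRapidly_singleTerm hu _ _⟩

lemma rapidExpansion4 (s t u : ℂ) : RapidExpansion4 s t u :=
  have hs := rapidSeq_etaOdd s
  have ht := rapidSeq_etaOdd t
  have hu := rapidSeq_etaEven u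
  ⟨convergesRapidly_tripleTerm hs ht hu _, convergesRapidly_doubleTerm hs ht _ _,
    convergesRapidly_doubleTerm ht hu _ _, convergesRapidly_doubleTerm hu hs _ _,
    convergesRapidly_singleTerm hs _ _, convergesRapidly_singleTerm ht _ _,
    convergesRapidly_singleTerm hu _ _⟩

end Rapid

/-! ### The bracket of the expansions and its entire numerator -/

section Numerator

/-- The bracket of the two expansions, for the signed coefficients `etaSigned a`: that of `S₃` is
the case `a = 0`, that of `S₄` the case `a = 1`. -/
def bracket (a : ℕ) (s t u : ℂ) : ℂ :=
  (2 : ℂ) ^ (-s - t - u) / (s + t + u - 2)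
    + ∑' k, tripleTerm (etaSigned a s) (etaSigned a t) (etaSigned 0 u) (2 * a + 1) k
    + ∑' k, doubleTerm (etaSigned a s) (etaSigned a t) u (u + 2 * a) k
    + ∑' k, doubleTerm (etaSigned a t) (etaSigned 0 u) s (s + a) k
    + ∑' k, doubleTerm (etaSigned 0 u) (etaSigned a s) t (t + a) k
    + ∑' k, singleTerm (etaSigned a s) (t + u) (t + u - 1 + a) k
    + ∑' k, singleTerm (etaSigned a t) (u + s) (u + s - 1 + a) k
    + ∑' k, singleTerm (etaSigned 0 u) (s + t) (s + t - 1) k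

lemma expansion3_eq (s t u : ℂ) : expansion3 s t u = Gccc s t u * bracket 0 s t u := by
  simp [expansion3, bracket, etaSigned_zero]

lemma expansion4_eq (s t u : ℂ) : expansion4 s t u = Gssc s t u * bracket 1 s t u := by
  have htriple : ∀ (a b c : ℕ → ℂ) d, tripleTerm (fun k => -a k) (fun k => -b k) c d =
      tripleTerm a b c d := fun a b c d => by ext k; simp [tripleTerm]
  have hdouble : ∀ (a b : ℕ → ℂ) w d, doubleTerm (fun k => -a k) (fun k => -b k) w d =
      doubleTerm a b w d := fun a b w d => by ext k; simp [doubleTerm]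
  have hdouble_left : ∀ (a b : ℕ → ℂ) w d, doubleTerm (fun k => -a k) b w d =
      fun k => -doubleTerm a b w d k := fun a b w d => by ext k; simp [doubleTerm, neg_div]
  have hdouble_right : ∀ (a b : ℕ → ℂ) w d, doubleTerm a (fun k => -b k) w d =
      fun k => -doubleTerm a b w d k := fun a b w d => by ext k; simp [doubleTerm, neg_div]
  have hsingle : ∀ (a : ℕ → ℂ) w d, singleTerm (fun k => -a k) w d =
      fun k => -singleTerm a w d k := fun a w d => by ext k; simp [singleTerm, neg_div]
  simp only [expansion4, bracket, etaSigned_zero, etaSigned_one, htriple, hdouble, hdouble_left,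
    hdouble_right, hsingle, tsum_neg]
  norm_num
  left
  ring

/-- The double series of `bracket` multiplied by the reciprocal Gamma factors that cancel its
poles; `z` is the variable of its denominators `z + 2 (l + m + j)`. -/
def doubleSum (a b j : ℕ) (x y z : ℂ) : ℂ :=
  ∑' k : ℕ × ℕ, etaReg a k.1 x * etaReg b k.2 y * rgammaQuot (k.1 + k.2 + j) z

/-- The simple series of `bracket` multiplied by the reciprocal Gamma factors that cancel its
poles; `z` is the variable of its denominators `z + 2 l`. -/
def singleSum (a : ℕ) (x z : ℂ) : ℂ := ∑' k : ℕ, etaReg a k x * rgammaQuot k z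

/-- The triple series of `bracket` multiplied by the reciprocal Gamma factors that cancel its
poles. -/
def tripleSum (a : ℕ) (s t u : ℂ) : ℂ :=
  ∑' k : ℕ × ℕ × ℕ, tripleTerm (fun l => etaReg a l s) (fun l => etaReg a l t)
    (fun l => etaReg 0 l u) (2 * a + 1) k

@[fun_prop]
lemma differentiable_singleSum (a : ℕ) : Differentiable ℂ fun p : ℂ × ℂ => singleSum a p.1 p.2 := by
  refine differentiableOn_univ.1 (differentiableOn_tsum_of_locally_summable isOpen_univ
    (fun k => Differentiable.differentiableOn (by fun_prop)) fun p _ => ?_)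
  obtain ⟨A, hA₀, hA⟩ := exists_etaReg_bound a p.1
  obtain ⟨D, hD⟩ := exists_rgammaQuot_bound p.2
  refine ⟨fun l => A * (9 / 16) ^ l * D, ((summable_geometric_of_lt_one (by norm_num)
    (by norm_num)).mul_left A).mul_right D, ?_⟩
  filter_upwards [continuousAt_fst.eventually hA, continuousAt_snd.eventually hD] with q hqA hqD l
  rw [norm_mul]
  gcongr
  · exact hqA l
  · exact hqD l

@[fun_prop]
lemma differentiable_doubleSum (a b j : ℕ) :
    Differentiable ℂ fun p : ℂ × ℂ × ℂ => doubleSum a b j p.1 p.2.1 p.2.2 := by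
  refine differentiableOn_univ.1 (differentiableOn_tsum_of_locally_summable isOpen_univ
    (fun k => Differentiable.differentiableOn (by fun_prop)) fun p _ => ?_)
  obtain ⟨A, hA₀, hA⟩ := exists_etaReg_bound a p.1
  obtain ⟨B, hB₀, hB⟩ := exists_etaReg_bound b p.2.1
  obtain ⟨D, hD⟩ := exists_rgammaQuot_bound p.2.2
  refine ⟨fun k => A * B * D * (9 / 16) ^ weight2 k,
    (summable_geometric_two (by norm_num) (by norm_num)).mul_left _, ?_⟩
  filter_upwards [continuousAt_fst.eventually hA,
    (continuousAt_fst.comp continuousAt_snd).eventually hB,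
    (continuousAt_snd.comp continuousAt_snd).eventually hD] with q hqA hqB hqD k
  rw [norm_mul, norm_mul]
  calc ‖etaReg a k.1 q.1‖ * ‖etaReg b k.2 q.2.1‖ * ‖rgammaQuot (k.1 + k.2 + j) q.2.2‖
      ≤ (A * (9 / 16) ^ k.1) * (B * (9 / 16) ^ k.2) * D := by
        gcongr
        · exact hqA _
        · exact hqB _
        · exact hqD _
    _ = A * B * D * (9 / 16) ^ weight2 k := by rw [weight2, pow_add]; ring

@[fun_prop]
lemma differentiable_tripleSum (a : ℕ) :
    Differentiable ℂ fun p : ℂ × ℂ × ℂ => tripleSum a p.1 p.2.1 p.2.2 := by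
  refine differentiableOn_univ.1 (differentiableOn_tsum_of_locally_summable isOpen_univ
    (fun k => Differentiable.differentiableOn ?_) fun p _ => ?_)
  · simp only [tripleTerm, div_eq_mul_inv]
    fun_prop
  obtain ⟨A, hA₀, hA⟩ := exists_etaReg_bound a p.1
  obtain ⟨B, hB₀, hB⟩ := exists_etaReg_bound a p.2.1
  obtain ⟨C, hC₀, hC⟩ := exists_etaReg_bound 0 p.2.2
  obtain ⟨D, hD⟩ := exists_inv_add_two_mul_bound (2 * a + 1)
  refine ⟨fun k => A * B * C * D * (9 / 16) ^ weight3 k,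
    (summable_geometric_three (by norm_num) (by norm_num)).mul_left _, ?_⟩
  filter_upwards [continuousAt_fst.eventually hA,
    (continuousAt_fst.comp continuousAt_snd).eventually hB,
    (continuousAt_snd.comp continuousAt_snd).eventually hC] with q hqA hqB hqC k
  have hDk : ‖(2 * (k.1 : ℂ) + 2 * k.2.1 + 2 * k.2.2 + (2 * a + 1))⁻¹‖ ≤ D := by
    convert hD (k.1 + k.2.1 + k.2.2) using 3
    push_cast
    ring
  rw [tripleTerm, div_eq_mul_inv, norm_mul, norm_mul, norm_mul]
  calc ‖etaReg a k.1 q.1‖ * ‖etaReg a k.2.1 q.2.1‖ * ‖etaReg 0 k.2.2 q.2.2‖ *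
        ‖(2 * (k.1 : ℂ) + 2 * k.2.1 + 2 * k.2.2 + (2 * a + 1))⁻¹‖
      ≤ (A * (9 / 16) ^ k.1) * (B * (9 / 16) ^ k.2.1) * (C * (9 / 16) ^ k.2.2) * D := by
        gcongr
        · exact hqA _
        · exact hqB _
        · exact hqC _
    _ = A * B * C * D * (9 / 16) ^ weight3 k := by rw [weight3, pow_add, pow_add]; ring

/-- The product of the factors which vanish on the singular hyperplanes. -/
def polarFactor (a : ℕ) (p : ℂ × ℂ × ℂ) : ℂ :=
  rgamma (p.1 + p.2.1 - 1) * rgamma (p.2.1 + p.2.2 - 1 + a) * rgamma (p.2.2 + p.1 - 1 + a) *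
    (p.1 + p.2.1 + p.2.2 - 2)

/-- The reciprocals of the Gamma factors with the poles of `Γ_cos` and `Γ_sin`. -/
def gammaFactor (a : ℕ) (p : ℂ × ℂ × ℂ) : ℂ :=
  rgamma (p.1 + a) * rgamma (p.2.1 + a) * rgamma p.2.2

/-- The factors which vanish at the zeros of `Γ_cos` and `Γ_sin`. -/
def zeroFactor (a : ℕ) (p : ℂ × ℂ × ℂ) : ℂ :=
  rgamma (1 + a - p.1) * rgamma (1 + a - p.2.1) * rgamma (1 - p.2.2)

/-- The bracket multiplied by `polarFactor` and by `gammaFactor`, as an entire function. -/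
def numer (a : ℕ) (p : ℂ × ℂ × ℂ) : ℂ :=
  (2 : ℂ) ^ (-p.1 - p.2.1 - p.2.2) * gammaFactor a p *
      (rgamma (p.1 + p.2.1 - 1) * rgamma (p.2.1 + p.2.2 - 1 + a) * rgamma (p.2.2 + p.1 - 1 + a))
    + polarFactor a p * (tripleSum a p.1 p.2.1 p.2.2
      + (2 : ℂ) ^ (-p.2.2) * doubleSum a a a p.1 p.2.1 p.2.2
      + (2 : ℂ) ^ (-p.1) * doubleSum a 0 0 p.2.1 p.2.2 (p.1 + a)
      + (2 : ℂ) ^ (-p.2.1) * doubleSum 0 a 0 p.2.2 p.1 (p.2.1 + a))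
    + (p.1 + p.2.1 + p.2.2 - 2) *
      ((2 : ℂ) ^ (-(p.2.1 + p.2.2)) * (rgamma (p.2.1 + a) * rgamma p.2.2) *
          (rgamma (p.1 + p.2.1 - 1) * rgamma (p.2.2 + p.1 - 1 + a)) *
          singleSum a p.1 (p.2.1 + p.2.2 - 1 + a)
        + (2 : ℂ) ^ (-(p.2.2 + p.1)) * (rgamma p.2.2 * rgamma (p.1 + a)) *
          (rgamma (p.1 + p.2.1 - 1) * rgamma (p.2.1 + p.2.2 - 1 + a)) *
          singleSum a p.2.1 (p.2.2 + p.1 - 1 + a)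
        + (2 : ℂ) ^ (-(p.1 + p.2.1)) * (rgamma (p.1 + a) * rgamma (p.2.1 + a)) *
          (rgamma (p.2.1 + p.2.2 - 1 + a) * rgamma (p.2.2 + p.1 - 1 + a)) *
          singleSum 0 p.2.2 (p.1 + p.2.1 - 1))

@[fun_prop]
lemma differentiable_polarFactor (a : ℕ) : Differentiable ℂ (polarFactor a) := by
  unfold polarFactor
  fun_prop

@[fun_prop]
lemma differentiable_gammaFactor (a : ℕ) : Differentiable ℂ (gammaFactor a) := by
  unfold gammaFactor
  fun_prop

@[fun_prop]
lemma differentiable_zeroFactor (a : ℕ) : Differentiable ℂ (zeroFactor a) := by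
  unfold zeroFactor
  fun_prop

@[fun_prop]
lemma differentiable_numer (a : ℕ) : Differentiable ℂ (numer a) := by
  unfold numer
  fun_prop

lemma two_cpow_mul_singleSum {a : ℕ} {x z : ℂ} (hx : rgamma (x + a) ≠ 0) (hz : rgamma z ≠ 0)
    (w : ℂ) : (2 : ℂ) ^ (-w) * singleSum a x z =
      rgamma (x + a) * rgamma z * ∑' k, singleTerm (etaSigned a x) w z k := by
  rw [singleSum, ← tsum_mul_left, ← tsum_mul_left]
  refine tsum_congr fun k => ?_
  rw [etaReg_eq_rgamma_mul hx, rgammaQuot_eq_div (add_two_mul_ne_zero_of_rgamma_ne_zero hz k),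
    singleTerm]
  ring

lemma two_cpow_mul_doubleSum {a b : ℕ} {x y z : ℂ} (hx : rgamma (x + a) ≠ 0)
    (hy : rgamma (y + b) ≠ 0) (hz : rgamma z ≠ 0) (j : ℕ) (w : ℂ) :
    (2 : ℂ) ^ (-w) * doubleSum a b j x y z = rgamma (x + a) * rgamma (y + b) * rgamma z *
      ∑' k, doubleTerm (etaSigned a x) (etaSigned b y) w (z + 2 * j) k := by
  rw [doubleSum, ← tsum_mul_left, ← tsum_mul_left]
  refine tsum_congr fun k => ?_
  have hindex : z + 2 * ((k.1 + k.2 + j : ℕ) : ℂ) = z + 2 * j + 2 * k.1 + 2 * k.2 := by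
    push_cast
    ring
  rw [etaReg_eq_rgamma_mul hx, etaReg_eq_rgamma_mul hy,
    rgammaQuot_eq_div (add_two_mul_ne_zero_of_rgamma_ne_zero hz _), doubleTerm, hindex]
  ring

lemma tripleSum_eq {a : ℕ} {s t u : ℂ} (hs : rgamma (s + a) ≠ 0) (ht : rgamma (t + a) ≠ 0)
    (hu : rgamma u ≠ 0) : tripleSum a s t u = gammaFactor a (s, t, u) *
      ∑' k, tripleTerm (etaSigned a s) (etaSigned a t) (etaSigned 0 u) (2 * a + 1) k := by
  have hu₀ : rgamma (u + (0 : ℕ)) ≠ 0 := by simpa using hu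
  rw [tripleSum, ← tsum_mul_left]
  refine tsum_congr fun k => ?_
  simp only [tripleTerm, gammaFactor]
  rw [etaReg_eq_rgamma_mul hs, etaReg_eq_rgamma_mul ht, etaReg_eq_rgamma_mul hu₀, Nat.cast_zero,
    add_zero]
  ring

lemma numer_eq_mul_bracket {a : ℕ} {s t u : ℂ} (hgamma : gammaFactor a (s, t, u) ≠ 0)
    (hpolar : polarFactor a (s, t, u) ≠ 0) : numer a (s, t, u) =
      polarFactor a (s, t, u) * gammaFactor a (s, t, u) * bracket a s t u := by
  have hne := hpolar
  have hne' := hgamma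
  simp only [polarFactor, gammaFactor, mul_ne_zero_iff] at hne hne'
  obtain ⟨⟨⟨hst, htu⟩, hus⟩, hstu⟩ := hne
  obtain ⟨⟨hs, ht⟩, hu⟩ := hne'
  have hu₀ : rgamma (u + (0 : ℕ)) ≠ 0 := by simpa using hu
  have single_s := two_cpow_mul_singleSum hs htu (t + u)
  have single_t := two_cpow_mul_singleSum ht hus (u + s)
  have single_u := two_cpow_mul_singleSum hu₀ hst (s + t)
  have double_tu := two_cpow_mul_doubleSum ht hu₀ hs 0 s
  have double_us := two_cpow_mul_doubleSum hu₀ hs ht 0 t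
  simp only [Nat.cast_zero, add_zero, mul_zero] at single_u double_tu double_us
  have htotal : (2 : ℂ) ^ (-s - t - u) =
      (s + t + u - 2) * ((2 : ℂ) ^ (-s - t - u) / (s + t + u - 2)) := by field_simp
  simp only [numer, bracket]
  rw [two_cpow_mul_doubleSum hs ht hu a u, double_tu, double_us, tripleSum_eq hs ht hu]
  simp only [polarFactor, gammaFactor]
  linear_combination (s + t + u - 2) * (rgamma (t + a) * rgamma u * (rgamma (s + t - 1) *
      rgamma (u + s - 1 + a))) * single_s + (s + t + u - 2) * (rgamma u * rgamma (s + a) *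
      (rgamma (s + t - 1) * rgamma (t + u - 1 + a))) * single_t + (s + t + u - 2) *
      (rgamma (s + a) * rgamma (t + a) * (rgamma (t + u - 1 + a) * rgamma (u + s - 1 + a))) *
      single_u + (rgamma (s + a) * rgamma (t + a) * rgamma u) * (rgamma (s + t - 1) *
      rgamma (t + u - 1 + a) * rgamma (u + s - 1 + a)) * htotal

end Numerator

/-! ### The expansion of the even and odd Hurwitz zeta functions -/

section Hurwitz

open Complex HurwitzZeta

lemma summable_one_div_nat_add_cpow {x : ℝ} (hx : 0 < x) {w : ℂ} (hw : 1 < w.re) :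
    Summable fun n : ℕ => 1 / ((n : ℂ) + x) ^ w := by
  refine .of_norm (((Real.summable_one_div_nat_add_rpow x w.re).2 hw).congr fun n => ?_)
  have hpos : (0 : ℝ) < n + x := by positivity
  have hcast : (n : ℂ) + x = ((n + x : ℝ) : ℂ) := by push_cast; rfl
  rw [abs_of_pos hpos, norm_div, norm_one, hcast, Complex.norm_cpow_eq_rpow_re_of_pos hpos]

lemma hasSum_zeta {w : ℂ} (hw : 1 < w.re) :
    HasSum (fun n : ℕ => 1 / ((n : ℂ) + 1) ^ w) (riemannZeta w) := by
  rw [zeta_eq_tsum_one_div_nat_add_one_cpow hw]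
  simpa using (summable_one_div_nat_add_cpow one_pos hw).hasSum

lemma hasSum_one_div_one_sub_cpow (s : ℂ) {z : ℂ} (hz : ‖z‖ < 1) :
    HasSum (fun k : ℕ => binomProd k s * z ^ k) (1 / (1 - z) ^ (1 - s)) := by
  have h := (one_div_one_sub_cpow_hasFPowerSeriesOnBall_zero (1 - s)).hasSum (y := z)
    (by simpa [← ofReal_norm, enorm_eq_nnnorm, ← NNReal.coe_lt_coe] using hz)
  rw [zero_add] at h
  refine h.congr_fun fun k => ?_
  rw [FormalMultilinearSeries.ofScalars_apply_eq, smul_eq_mul, ← ringChoose_eq_binomProd]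
  congr 2
  ring

lemma hasSum_one_div_sub_cpow (s : ℂ) {x : ℝ} (hx : |x| < 1) (n : ℕ) :
    HasSum (fun k : ℕ => binomProd k s * (x : ℂ) ^ k / ((n : ℂ) + 1) ^ ((k : ℂ) + 1 - s))
      (1 / ((n : ℂ) + 1 - x) ^ (1 - s)) := by
  have hn : (0 : ℝ) < n + 1 := by positivity
  have hn₀ : (n : ℂ) + 1 ≠ 0 := Nat.cast_add_one_ne_zero n
  have hratio : |x / (n + 1)| < 1 := by
    rw [abs_div, abs_of_pos hn, div_lt_one hn]
    linarith [(Nat.cast_nonneg n : (0 : ℝ) ≤ n)]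
  have hfactor : 1 / ((n : ℂ) + 1 - x) ^ (1 - s) =
      1 / (1 - ((x / (n + 1) : ℝ) : ℂ)) ^ (1 - s) / ((n : ℂ) + 1) ^ (1 - s) := by
    have hpos : (0 : ℝ) ≤ 1 - x / (n + 1) := by linarith [le_abs_self (x / (n + 1))]
    have hmul : (n : ℂ) + 1 - x = ((n + 1 : ℝ) : ℂ) * ((1 - x / (n + 1) : ℝ) : ℂ) := by
      push_cast
      field_simp
    rw [hmul, mul_cpow_ofReal_nonneg hn.le hpos]
    push_cast
    ring
  rw [hfactor]
  refine ((hasSum_one_div_one_sub_cpow s (z := ((x / (n + 1) : ℝ) : ℂ))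
    (by rwa [Complex.norm_real])).div_const (((n : ℂ) + 1) ^ (1 - s))).congr_fun fun k => ?_
  rw [show (k : ℂ) + 1 - s = k + (1 - s) by ring, cpow_add _ _ hn₀, cpow_natCast]
  push_cast
  rw [div_pow]
  field_simp

/-- The terms of the even (`a = 0`) or odd (`a = 1`) part of the double series obtained by
expanding every `1 / (n + 1 ± x) ^ (1 - s)` in powers of `x`; the index is `(n, k)`, with `k` the
exponent of `x`. -/
def hurwitzTerm (a : ℕ) (s : ℂ) (x : ℝ) (p : ℕ × ℕ) : ℂ :=
  ((-1) ^ p.2 + (-1) ^ a) / 2 *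
    (binomProd p.2 s * (x : ℂ) ^ p.2 / ((p.1 : ℂ) + 1) ^ ((p.2 : ℂ) + 1 - s))

lemma norm_neg_one_pow_add_neg_one_pow_div_two_le (a k : ℕ) :
    ‖(((-1) ^ k + (-1) ^ a) / 2 : ℂ)‖ ≤ 1 := by
  rw [norm_div, Complex.norm_ofNat, div_le_one two_pos]
  refine (norm_add_le _ _).trans ?_
  simp only [norm_pow, norm_neg, norm_one, one_pow]
  norm_num

lemma neg_one_pow_add_neg_one_pow_eq_zero {a k : ℕ} (h : Odd (k + a)) :
    ((-1) ^ k + (-1) ^ a : ℂ) = 0 := by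
  rcases Nat.odd_add.1 h with ⟨hodd, -⟩
  rcases Nat.even_or_odd k with hk | hk
  · have ha : Odd a := by
      rcases Nat.even_or_odd a with ha | ha
      · exact absurd (hk.add ha) (Nat.not_even_iff_odd.2 h)
      · exact ha
    rw [hk.neg_one_pow, ha.neg_one_pow, add_neg_cancel]
  · rw [hk.neg_one_pow, (hodd hk).neg_one_pow, neg_add_cancel]

lemma summable_hurwitzTerm (a : ℕ) {s : ℂ} (hs : s.re < 0) {x : ℝ} (hx : |x| < 1) :
    Summable (hurwitzTerm a s x) := by
  have hrows : Summable fun n : ℕ => ‖1 / ((n : ℂ) + 1) ^ (1 - s)‖ :=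
    (hasSum_zeta (w := 1 - s) (by simp; linarith)).summable.norm
  have hcols : Summable fun k : ℕ => ‖binomProd k s * (x : ℂ) ^ k‖ :=
    (hasSum_one_div_one_sub_cpow s (by rwa [Complex.norm_real])).summable.norm
  refine .of_norm_bounded (hrows.mul_of_nonneg hcols (fun n => norm_nonneg _)
    fun k => norm_nonneg _) fun p => ?_
  have hone : (1 : ℝ) ≤ p.1 + 1 := by linarith [(Nat.cast_nonneg p.1 : (0 : ℝ) ≤ p.1)]
  have hcast : (p.1 : ℂ) + 1 = ((p.1 + 1 : ℝ) : ℂ) := by push_cast; rfl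
  have hpow : ‖((p.1 : ℂ) + 1) ^ (1 - s)‖ ≤ ‖((p.1 : ℂ) + 1) ^ ((p.2 : ℂ) + 1 - s)‖ := by
    rw [hcast, Complex.norm_cpow_eq_rpow_re_of_pos (by positivity),
      Complex.norm_cpow_eq_rpow_re_of_pos (by positivity)]
    exact Real.rpow_le_rpow_of_exponent_le hone (by simp)
  have hpos : 0 < ‖((p.1 : ℂ) + 1) ^ (1 - s)‖ := by
    rw [hcast, Complex.norm_cpow_eq_rpow_re_of_pos (by positivity)]
    positivity
  rw [hurwitzTerm, norm_mul, norm_div (binomProd p.2 s * (x : ℂ) ^ p.2)]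
  calc ‖(((-1) ^ p.2 + (-1) ^ a) / 2 : ℂ)‖ * (‖binomProd p.2 s * (x : ℂ) ^ p.2‖ /
        ‖((p.1 : ℂ) + 1) ^ ((p.2 : ℂ) + 1 - s)‖)
      ≤ 1 * (‖binomProd p.2 s * (x : ℂ) ^ p.2‖ / ‖((p.1 : ℂ) + 1) ^ (1 - s)‖) := by
        gcongr
        exact norm_neg_one_pow_add_neg_one_pow_div_two_le a p.2
    _ = ‖1 / ((p.1 : ℂ) + 1) ^ (1 - s)‖ * ‖binomProd p.2 s * (x : ℂ) ^ p.2‖ := by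
        rw [norm_div, norm_one]
        ring

lemma hasSum_hurwitzTerm_row (a : ℕ) (s : ℂ) {x : ℝ} (hx : |x| < 1) (n : ℕ) :
    HasSum (fun k => hurwitzTerm a s x (n, k)) ((1 / ((n : ℂ) + 1 + x) ^ (1 - s) +
      (-1) ^ a * (1 / ((n : ℂ) + 1 - x) ^ (1 - s))) / 2) := by
  have hplus := hasSum_one_div_sub_cpow s (x := -x) (by rwa [abs_neg]) n
  rw [ofReal_neg, sub_neg_eq_add] at hplus
  refine ((hplus.add ((hasSum_one_div_sub_cpow s hx n).mul_left ((-1) ^ a))).div_const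
    2).congr_fun fun k => ?_
  rw [hurwitzTerm, neg_pow]
  ring

lemma hasSum_hurwitzTerm_col (a : ℕ) {s : ℂ} (hs : s.re < 0) (x : ℝ) (k : ℕ) :
    HasSum (fun n => hurwitzTerm a s x (n, k)) (((-1) ^ k + (-1) ^ a) / 2 *
      (binomProd k s * (x : ℂ) ^ k * riemannZeta (k + 1 - s))) := by
  have hre : 1 < ((k : ℂ) + 1 - s).re := by
    simp
    linarith [(Nat.cast_nonneg k : (0 : ℝ) ≤ k)]
  refine (((hasSum_zeta hre).mul_left _).mul_left _).congr_fun fun n => ?_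
  rw [hurwitzTerm]
  ring

/-- The leading term of the expansion of `hurwitzTrig`. -/
def powTerm (s : ℂ) (y : ℝ) : ℂ := (2 : ℂ) ^ (-s) * (y : ℂ) ^ (s - 1)

/-- The regular part of the expansion of `hurwitzTrig`. -/
def etaSeries (a : ℕ) (s : ℂ) (y : ℝ) : ℂ := ∑' l : ℕ, etaSigned a s l * (y : ℂ) ^ (2 * l + a)

lemma etaSigned_of_re_neg {a : ℕ} {s : ℂ} (hs : s.re < 0) (l : ℕ) : etaSigned a s l =
    (-1) ^ a * (((2 : ℂ) ^ (2 * l + a))⁻¹ * binomProd (2 * l + a) s *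
      riemannZeta ((2 * l + a : ℕ) + 1 - s)) := by
  rw [etaSigned, eta_of_ne]
  rintro rfl
  rw [natCast_re] at hs
  exact hs.not_ge (Nat.cast_nonneg _)

/-- Only the exponents of the parity of `a` survive in the column sums of `hurwitzTerm`. -/
lemma hasSum_hurwitz_shifted {a : ℕ} (ha : a ≤ 1) {s : ℂ} (hs : s.re < 0) {x : ℝ} (hx : |x| < 1) :
    HasSum (fun n : ℕ => (1 / ((n : ℂ) + 1 + x) ^ (1 - s) +
        (-1) ^ a * (1 / ((n : ℂ) + 1 - x) ^ (1 - s))) / 2) (etaSeries a s (2 * x)) := by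
  have hsum := (summable_hurwitzTerm a hs hx).hasSum
  have hrows := hsum.prod_fiberwise (hasSum_hurwitzTerm_row a s hx)
  have hcols := ((Equiv.prodComm ℕ ℕ).hasSum_iff.2 hsum).prod_fiberwise
    (hasSum_hurwitzTerm_col a hs x)
  have hinj : Function.Injective fun l : ℕ => 2 * l + a := fun l m h => by simpa using h
  have hparity := (hinj.hasSum_iff fun k hk => by
    have hodd : Odd (k + a) := by
      by_contra h
      rw [Nat.not_odd_iff_even, Nat.even_iff] at h
      exact hk ⟨(k - a) / 2, by dsimp only; omega⟩
    rw [neg_one_pow_add_neg_one_pow_eq_zero hodd, zero_div, zero_mul]).2 hcols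
  rw [← hparity.tsum_eq] at hrows
  convert hrows using 1
  refine tsum_congr fun l => ?_
  have hsign : (-1 : ℂ) ^ (2 * l + a) = (-1) ^ a := by
    rw [pow_add, pow_mul, neg_one_sq, one_pow, one_mul]
  simp only [Function.comp_apply]
  rw [etaSigned_of_re_neg hs, hsign, ofReal_mul, ofReal_ofNat, mul_pow]
  field_simp
  ring

/-- The even (`a = 0`) and odd (`a = 1`) Hurwitz zeta functions. -/
def hurwitzTrig (a : ℕ) (x : UnitAddCircle) (w : ℂ) : ℂ :=
  if a = 0 then hurwitzZetaEven x w else hurwitzZetaOdd x w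

/-- The cosine (`a = 0`) and sine (`a = 1`) zeta functions. -/
def trigZeta (a : ℕ) (x : UnitAddCircle) (w : ℂ) : ℂ :=
  if a = 0 then cosZeta x w else sinZeta x w

lemma hasSum_hurwitzTrig {a : ℕ} (ha : a ≤ 1) {x : ℝ} (hx : x ∈ Set.Icc 0 1) {w : ℂ}
    (hw : 1 < w.re) : HasSum (fun n : ℕ => (1 / ((n : ℂ) + x) ^ w +
      (-1) ^ a * (1 / ((n : ℂ) + 1 - x) ^ w)) / 2) (hurwitzTrig a x w) := by
  unfold hurwitzTrig
  split_ifs with h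
  · subst h
    simpa using hasSum_nat_hurwitzZetaEven_of_mem_Icc hx hw
  · obtain rfl : a = 1 := by omega
    simpa [sub_eq_add_neg] using hasSum_nat_hurwitzZetaOdd_of_mem_Icc hx hw

lemma powTerm_eq_cpow_div_two {y : ℝ} (hy : 0 ≤ y) (s : ℂ) :
    powTerm s y = ((y / 2 : ℝ) : ℂ) ^ (s - 1) / 2 := by
  have hdouble : (y : ℂ) = ((2 : ℝ) : ℂ) * ((y / 2 : ℝ) : ℂ) := by push_cast; ring
  rw [powTerm, hdouble, mul_cpow_ofReal_nonneg (by norm_num) (by positivity), ofReal_ofNat,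
    ← mul_assoc, ← cpow_add _ _ two_ne_zero, show -s + (s - 1) = -1 by ring, cpow_neg_one]
  push_cast
  ring

lemma hurwitzTrig_one_sub_of_re_neg {a : ℕ} (ha : a ≤ 1) {s : ℂ} (hs : s.re < 0) {y : ℝ}
    (hy₀ : 0 < y) (hy : y < 2) :
    hurwitzTrig a ((y / 2 : ℝ) : UnitAddCircle) (1 - s) = powTerm s y + etaSeries a s y := by
  set x : ℝ := y / 2 with hx
  have hx₀ : 0 < x := by positivity
  have hx₁ : x < 1 := by linarith
  have hw : 1 < (1 - s).re := by simp; linarith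
  set f : ℕ → ℂ := fun n => 1 / ((n : ℂ) + x) ^ (1 - s) / 2 with hf
  have hfsum : HasSum f (∑' n, f n) :=
    ((summable_one_div_nat_add_cpow hx₀ hw).div_const 2).hasSum
  have hshift : HasSum (fun n => f (n + 1) - f n) (-f 0) := by
    simpa only [Finset.sum_range_one, sub_sub_cancel_left] using
      ((hasSum_nat_add_iff' 1).2 hfsum).sub hfsum
  have hhurwitz := (hasSum_hurwitzTrig ha ⟨hx₀.le, hx₁.le⟩ hw).add hshift
  have heta := hasSum_hurwitz_shifted ha hs (x := x) (by rwa [abs_of_pos hx₀])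
  have heq := (hhurwitz.congr_fun fun n => by simp only [hf]; push_cast; ring).unique heta
  have hzero : f 0 = powTerm s y := by
    rw [powTerm_eq_cpow_div_two hy₀.le, ← hx, ← neg_sub 1 s, cpow_neg, ← one_div]
    simp only [hf, Nat.cast_zero, zero_add]
  rw [hzero, hx, mul_div_cancel₀ _ two_ne_zero] at heq
  linear_combination heq

lemma differentiableOn_hurwitzTrig_one_sub (a : ℕ) (x : UnitAddCircle) :
    DifferentiableOn ℂ (fun s => hurwitzTrig a x (1 - s)) {0}ᶜ := by
  intro s hs
  have hsub : DifferentiableAt ℂ (fun s : ℂ => 1 - s) s := by fun_prop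
  have hs₁ : 1 - s ≠ 1 := fun h => hs (by simpa using h)
  unfold hurwitzTrig
  split_ifs
  · exact (DifferentiableAt.comp s (differentiableAt_hurwitzZetaEven x hs₁)
      hsub).differentiableWithinAt
  · exact (DifferentiableAt.comp s (differentiable_hurwitzZetaOdd x _) hsub).differentiableWithinAt

lemma exists_etaSigned_bound (a : ℕ) {s : ℂ} (hs : s ≠ 0) :
    ∃ C : ℝ, ∀ᶠ z in 𝓝 s, ∀ l, ‖etaSigned a z l‖ ≤ C * (9 / 16) ^ l := by
  obtain ⟨C, hC₀, hC⟩ := exists_eta_bound (R := ‖s‖ + 1) (ρ := 3 / 4) (by positivity)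
    (by norm_num)
  have hzero : ∀ᶠ z in 𝓝 s, ‖eta 0 z‖ < ‖eta 0 s‖ + 1 :=
    (differentiableAt_eta (k := 0) (.inr hs)).continuousAt.norm.tendsto.eventually
      (gt_mem_nhds (lt_add_one _))
  have hnorm : ∀ᶠ z in 𝓝 s, ‖z‖ < ‖s‖ + 1 :=
    continuous_norm.tendsto s |>.eventually (gt_mem_nhds (lt_add_one _))
  refine ⟨C + (‖eta 0 s‖ + 1), ?_⟩
  filter_upwards [hzero, hnorm] with z hz₀ hz l
  rw [norm_etaSigned]
  rcases eq_or_ne (2 * l + a) 0 with h₀ | h₀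
  · obtain ⟨rfl, rfl⟩ : l = 0 ∧ a = 0 := by omega
    rw [pow_zero, mul_one]
    linarith
  · calc ‖eta (2 * l + a) z‖ ≤ C * (3 / 4) ^ (2 * l + a) := hC _ h₀ z hz.le
      _ ≤ C * (9 / 16) ^ l := by gcongr; exact three_quarters_pow_le a l
      _ ≤ (C + (‖eta 0 s‖ + 1)) * (9 / 16) ^ l := by
        gcongr
        exact le_add_of_nonneg_right (by positivity)

lemma norm_etaSigned_mul_pow_le (a : ℕ) (s : ℂ) {y : ℝ} (hy : y ∈ Set.Icc 0 1) (l : ℕ) :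
    ‖etaSigned a s l * (y : ℂ) ^ (2 * l + a)‖ ≤ ‖etaSigned a s l‖ := by
  rw [norm_mul, norm_pow, norm_real, Real.norm_of_nonneg hy.1]
  exact mul_le_of_le_one_right (norm_nonneg _) (pow_le_one₀ hy.1 hy.2)

lemma differentiableOn_etaSeries (a : ℕ) {y : ℝ} (hy : y ∈ Set.Icc 0 1) :
    DifferentiableOn ℂ (fun s => etaSeries a s y) {0}ᶜ := by
  refine differentiableOn_tsum_of_locally_summable isOpen_compl_singleton (fun l s hs => ?_)
    fun s hs => ?_
  · exact (((differentiableAt_eta (.inr hs)).const_mul _).mul_const _).differentiableWithinAt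
  · obtain ⟨C, hC⟩ := exists_etaSigned_bound a hs
    refine ⟨fun l => C * (9 / 16) ^ l,
      (summable_geometric_of_lt_one (by norm_num) (by norm_num)).mul_left _, ?_⟩
    filter_upwards [hC] with z hz l using (norm_etaSigned_mul_pow_le a z hy l).trans (hz l)

lemma hurwitzTrig_one_sub {a : ℕ} (ha : a ≤ 1) {s : ℂ} (hs : s ≠ 0) {y : ℝ}
    (hy₀ : 0 < y) (hy : y ≤ 1) :
    hurwitzTrig a ((y / 2 : ℝ) : UnitAddCircle) (1 - s) = powTerm s y + etaSeries a s y := by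
  have hyc : (y : ℂ) ≠ 0 := ofReal_ne_zero.2 hy₀.ne'
  have hpow : Differentiable ℂ fun s => powTerm s y := by
    have : Differentiable ℂ fun s : ℂ => (y : ℂ) ^ (s - 1) := fun z =>
      DifferentiableAt.const_cpow (by fun_prop) (.inl hyc)
    unfold powTerm
    fun_prop
  have hneg : ∀ᶠ z : ℂ in 𝓝 (-1), z.re < 0 :=
    (Complex.continuous_re.tendsto _).eventually (gt_mem_nhds (by norm_num))
  refine eq_of_eventuallyEq_of_countable isOpen_compl_singleton
    (differentiableOn_hurwitzTrig_one_sub a ((y / 2 : ℝ) : UnitAddCircle))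
    (hpow.differentiableOn.add (differentiableOn_etaSeries a ⟨hy₀.le, hy⟩))
    (p := s) (q := -1) hs (by simp) ?_ ?_
  · simpa using countable_preimage_line (Set.countable_singleton (0 : ℂ)) (x := s) (y := -1) hs
  · filter_upwards [hneg] with z hz
    exact hurwitzTrig_one_sub_of_re_neg ha hz hy₀ (by linarith)

lemma rgamma_mul_hurwitzTrig {a : ℕ} (ha : a ≤ 1) (x : UnitAddCircle) {s : ℂ} (hs : 1 < s.re) :
    rgamma (s + a) * hurwitzTrig a x (1 - s) = rgamma (1 + a - s) * trigZeta a x s := by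
  have hneg : ∀ n : ℕ, s ≠ -(n : ℂ) := fun n h => by
    rw [h, neg_re, natCast_re] at hs
    linarith [(Nat.cast_nonneg n : (0 : ℝ) ≤ n)]
  have hone : s ≠ 1 := fun h => by rw [h, one_re] at hs; exact lt_irrefl _ hs
  unfold hurwitzTrig trigZeta
  split_ifs with h
  · subst h
    rw [hurwitzZetaEven_one_sub x hneg (.inr hone), Nat.cast_zero, add_zero, add_zero, rgamma,
      rgamma, inv_Gammaℝ_one_sub hneg, Gammaℂ_def]
    ring
  · obtain rfl : a = 1 := by omega
    rw [hurwitzZetaOdd_one_sub x hneg, rgamma, rgamma,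
      show (1 : ℂ) + (1 : ℕ) - s = 2 - s by push_cast; ring, inv_Gammaℝ_two_sub hneg, Gammaℂ_def,
      Nat.cast_one]
    ring

end Hurwitz

/-! ### The bracket as an integral -/

section BracketIntegral

open Complex MeasureTheory

/-- On `(0, 1]`, `f` is the sum of the absolutely convergent series of powers `c i * y ^ e i`. -/
structure IsPowerSum {ι : Type} (f : ℝ → ℂ) (c e : ι → ℂ) : Prop where
  summable : Summable fun i => ‖c i‖
  re_nonneg : ∀ i, 0 ≤ (e i).re
  hasSum : ∀ y ∈ Set.Ioc (0 : ℝ) 1, HasSum (fun i => c i * (y : ℂ) ^ e i) (f y)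

lemma IsPowerSum.norm_le {ι : Type} {f : ℝ → ℂ} {c e : ι → ℂ} (h : IsPowerSum f c e) {y : ℝ}
    (hy : y ∈ Set.Ioc (0 : ℝ) 1) (i : ι) : ‖c i * (y : ℂ) ^ e i‖ ≤ ‖c i‖ := by
  rw [norm_mul, norm_cpow_eq_rpow_re_of_pos hy.1]
  exact mul_le_of_le_one_right (norm_nonneg _) (Real.rpow_le_one hy.1.le hy.2 (h.re_nonneg i))

lemma IsPowerSum.mul {ι κ : Type} {f g : ℝ → ℂ} {c e : ι → ℂ} {c' e' : κ → ℂ}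
    (hf : IsPowerSum f c e) (hg : IsPowerSum g c' e') :
    IsPowerSum (fun y => f y * g y) (fun p : ι × κ => c p.1 * c' p.2)
      (fun p => e p.1 + e' p.2) := by
  refine ⟨?_, fun p => ?_, fun y hy => ?_⟩
  · simp_rw [norm_mul]
    exact hf.summable.mul_of_nonneg hg.summable (fun _ => norm_nonneg _) fun _ => norm_nonneg _
  · rw [add_re]
    exact add_nonneg (hf.re_nonneg _) (hg.re_nonneg _)
  · have hfy : Summable fun i => ‖c i * (y : ℂ) ^ e i‖ :=
      .of_nonneg_of_le (fun _ => norm_nonneg _) (hf.norm_le hy) hf.summable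
    have hgy : Summable fun i => ‖c' i * (y : ℂ) ^ e' i‖ :=
      .of_nonneg_of_le (fun _ => norm_nonneg _) (hg.norm_le hy) hg.summable
    have hprod := summable_mul_of_summable_norm (f := fun i => c i * (y : ℂ) ^ e i)
      (g := fun i => c' i * (y : ℂ) ^ e' i) hfy hgy
    refine ((hf.hasSum y hy).mul (hg.hasSum y hy) hprod).congr_fun fun p => ?_
    rw [cpow_add _ _ (ofReal_ne_zero.2 hy.1.ne')]
    ring

lemma IsPowerSum.integral_eq {ι : Type} [Countable ι] {f : ℝ → ℂ} {c e : ι → ℂ}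
    (hf : IsPowerSum f c e) : ∫ y in (0 : ℝ)..1, f y = ∑' i, c i / (e i + 1) := by
  have hterm : ∀ i, ∫ y in (0 : ℝ)..1, c i * (y : ℂ) ^ e i = c i / (e i + 1) := fun i => by
    have hre : 0 < (e i + 1).re := by
      rw [add_re, one_re]
      linarith [hf.re_nonneg i]
    have hne : e i + 1 ≠ 0 := fun h => by simp [h] at hre
    rw [intervalIntegral.integral_const_mul, integral_cpow (.inl (by linarith [hf.re_nonneg i])),
      ofReal_one, one_cpow, ofReal_zero, zero_cpow hne, sub_zero, mul_one_div]
  simp_rw [← hterm]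
  refine (intervalIntegral.hasSum_integral_of_dominated_convergence (fun i _ => ‖c i‖)
    (fun i => Measurable.aestronglyMeasurable (by fun_prop)) (fun i => .of_forall fun y hy => ?_)
    (.of_forall fun _ _ => hf.summable) intervalIntegrable_const
    (.of_forall fun y hy => ?_)).tsum_eq.symm
  · rw [Set.uIoc_of_le zero_le_one] at hy
    exact hf.norm_le hy i
  · rw [Set.uIoc_of_le zero_le_one] at hy
    exact hf.hasSum y hy

lemma isPowerSum_powTerm {s : ℂ} (hs : 1 < s.re) :
    IsPowerSum (powTerm s) (fun _ : Unit => (2 : ℂ) ^ (-s)) (fun _ => s - 1) where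
  summable := (hasSum_fintype _).summable
  re_nonneg _ := by
    rw [sub_re, one_re]
    linarith
  hasSum y _ := by
    simpa only [Finset.univ_unique, Finset.sum_singleton, powTerm] using
      hasSum_fintype fun _ : Unit => (2 : ℂ) ^ (-s) * (y : ℂ) ^ (s - 1)

lemma isPowerSum_etaSeries (a : ℕ) (s : ℂ) :
    IsPowerSum (etaSeries a s) (etaSigned a s) (fun l => ((2 * l + a : ℕ) : ℂ)) where
  summable := (rapidSeq_etaSigned a s).summable_norm
  re_nonneg l := by
    rw [natCast_re]
    positivity
  hasSum y hy := by
    simp_rw [cpow_natCast]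
    exact (Summable.of_norm_bounded (rapidSeq_etaSigned a s).summable_norm
      (norm_etaSigned_mul_pow_le a s (Set.Ioc_subset_Icc_self hy))).hasSum

lemma continuousOn_powTerm {s : ℂ} (hs : 1 < s.re) : ContinuousOn (powTerm s) (Set.uIcc 0 1) :=
  fun y _ => (continuousAt_const.mul (continuousAt_ofReal_cpow_const y (s - 1)
    (.inl (by rw [sub_re, one_re]; linarith)))).continuousWithinAt

lemma continuousOn_etaSeries (a : ℕ) (s : ℂ) : ContinuousOn (etaSeries a s) (Set.uIcc 0 1) := by
  rw [Set.uIcc_of_le zero_le_one]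
  exact continuousOn_tsum (fun l => by fun_prop) (rapidSeq_etaSigned a s).summable_norm
    fun l y hy => norm_etaSigned_mul_pow_le a s hy l

lemma integral_add_mul_add_mul_add {a b : ℝ} {f f' g g' h h' : ℝ → ℂ}
    (hf : ContinuousOn f (Set.uIcc a b)) (hf' : ContinuousOn f' (Set.uIcc a b))
    (hg : ContinuousOn g (Set.uIcc a b)) (hg' : ContinuousOn g' (Set.uIcc a b))
    (hh : ContinuousOn h (Set.uIcc a b)) (hh' : ContinuousOn h' (Set.uIcc a b)) :
    ∫ y in a..b, (f y + f' y) * ((g y + g' y) * (h y + h' y)) =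
      (∫ y in a..b, f y * (g y * h y)) + (∫ y in a..b, f' y * (g' y * h' y))
      + (∫ y in a..b, h y * (f' y * g' y)) + (∫ y in a..b, f y * (g' y * h' y))
      + (∫ y in a..b, g y * (h' y * f' y)) + (∫ y in a..b, g y * (h y * f' y))
      + (∫ y in a..b, h y * (f y * g' y)) + ∫ y in a..b, f y * (g y * h' y) := by
  have hexpand : ∀ y, (f y + f' y) * ((g y + g' y) * (h y + h' y)) =
      f y * (g y * h y) + f' y * (g' y * h' y) + h y * (f' y * g' y) + f y * (g' y * h' y)
      + g y * (h' y * f' y) + g y * (h y * f' y) + h y * (f y * g' y) + f y * (g y * h' y) :=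
    fun y => by ring
  simp_rw [hexpand]
  rw [intervalIntegral.integral_add, intervalIntegral.integral_add, intervalIntegral.integral_add,
    intervalIntegral.integral_add, intervalIntegral.integral_add, intervalIntegral.integral_add,
    intervalIntegral.integral_add]
  all_goals exact ContinuousOn.intervalIntegrable (by fun_prop)

lemma tsum_punit_prod {β : Type} (f : Unit × β → ℂ) : ∑' k, f k = ∑' b, f ((), b) :=
  ((Equiv.punitProd β).symm.tsum_eq f).symm

lemma two_cpow_neg_mul_two_cpow_neg (z w : ℂ) :
    (2 : ℂ) ^ (-z) * (2 : ℂ) ^ (-w) = (2 : ℂ) ^ (-(z + w)) := by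
  rw [← cpow_add _ _ two_ne_zero, neg_add]

lemma integral_powTerm_mul_powTerm_mul_powTerm {s t u : ℂ} (hs : 1 < s.re) (ht : 1 < t.re)
    (hu : 1 < u.re) : ∫ y in (0 : ℝ)..1, powTerm s y * (powTerm t y * powTerm u y) =
      (2 : ℂ) ^ (-s - t - u) / (s + t + u - 2) := by
  rw [((isPowerSum_powTerm hs).mul ((isPowerSum_powTerm ht).mul
    (isPowerSum_powTerm hu))).integral_eq, tsum_punit_prod, tsum_punit_prod, tsum_fintype]
  simp only [Finset.univ_unique, Finset.sum_singleton, two_cpow_neg_mul_two_cpow_neg]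
  congr 2 <;> ring

lemma integral_etaSeries_mul_etaSeries_mul_etaSeries (a b c : ℕ) (s t u : ℂ) :
    ∫ y in (0 : ℝ)..1, etaSeries a s y * (etaSeries b t y * etaSeries c u y) =
      ∑' k, tripleTerm (etaSigned a s) (etaSigned b t) (etaSigned c u) (a + b + c + 1) k := by
  rw [((isPowerSum_etaSeries a s).mul ((isPowerSum_etaSeries b t).mul
    (isPowerSum_etaSeries c u))).integral_eq]
  refine tsum_congr fun k => ?_
  rw [tripleTerm]
  push_cast
  congr 1 <;> ring

lemma integral_powTerm_mul_etaSeries_mul_etaSeries (a b : ℕ) {s : ℂ} (hs : 1 < s.re) (t u : ℂ) :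
    ∫ y in (0 : ℝ)..1, powTerm s y * (etaSeries a t y * etaSeries b u y) =
      ∑' k, doubleTerm (etaSigned a t) (etaSigned b u) s (s + (a + b)) k := by
  rw [((isPowerSum_powTerm hs).mul ((isPowerSum_etaSeries a t).mul
    (isPowerSum_etaSeries b u))).integral_eq, tsum_punit_prod]
  refine tsum_congr fun k => ?_
  rw [doubleTerm]
  push_cast
  congr 1 <;> ring

lemma integral_powTerm_mul_powTerm_mul_etaSeries (a : ℕ) {s t : ℂ} (hs : 1 < s.re)
    (ht : 1 < t.re) (u : ℂ) :
    ∫ y in (0 : ℝ)..1, powTerm s y * (powTerm t y * etaSeries a u y) =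
      ∑' k, singleTerm (etaSigned a u) (s + t) (s + t - 1 + a) k := by
  rw [((isPowerSum_powTerm hs).mul ((isPowerSum_powTerm ht).mul
    (isPowerSum_etaSeries a u))).integral_eq, tsum_punit_prod, tsum_punit_prod]
  refine tsum_congr fun k => ?_
  rw [singleTerm, ← two_cpow_neg_mul_two_cpow_neg]
  push_cast
  congr 1 <;> ring

lemma integral_eq_bracket (a : ℕ) {s t u : ℂ} (hs : 1 < s.re) (ht : 1 < t.re) (hu : 1 < u.re) :
    ∫ y in (0 : ℝ)..1, (powTerm s y + etaSeries a s y) * ((powTerm t y + etaSeries a t y) *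
      (powTerm u y + etaSeries 0 u y)) = bracket a s t u := by
  rw [integral_add_mul_add_mul_add (continuousOn_powTerm hs) (continuousOn_etaSeries a s)
      (continuousOn_powTerm ht) (continuousOn_etaSeries a t) (continuousOn_powTerm hu)
      (continuousOn_etaSeries 0 u), integral_powTerm_mul_powTerm_mul_powTerm hs ht hu,
    integral_etaSeries_mul_etaSeries_mul_etaSeries,
    integral_powTerm_mul_etaSeries_mul_etaSeries a a hu,
    integral_powTerm_mul_etaSeries_mul_etaSeries a 0 hs,
    integral_powTerm_mul_etaSeries_mul_etaSeries 0 a ht,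
    integral_powTerm_mul_powTerm_mul_etaSeries a ht hu,
    integral_powTerm_mul_powTerm_mul_etaSeries a hu hs,
    integral_powTerm_mul_powTerm_mul_etaSeries 0 hs ht, bracket, two_mul]
  simp only [Nat.cast_zero, add_zero, zero_add]

lemma rgamma_mul_expansion {a : ℕ} (ha : a ≤ 1) {s : ℂ} (hs : 1 < s.re) {y : ℝ}
    (hy : y ∈ Set.Ioc (0 : ℝ) 1) : rgamma (s + a) * (powTerm s y + etaSeries a s y) =
      rgamma (1 + a - s) * trigZeta a ((y / 2 : ℝ) : UnitAddCircle) s := by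
  have hs₀ : s ≠ 0 := fun h => by
    rw [h, zero_re] at hs
    linarith
  rw [← rgamma_mul_hurwitzTrig ha _ hs, hurwitzTrig_one_sub ha hs₀ hy.1 hy.2]

lemma rgamma_mul_integral_trigZeta {a : ℕ} (ha : a ≤ 1) {s t u : ℂ} (hs : 1 < s.re)
    (ht : 1 < t.re) (hu : 1 < u.re) :
    zeroFactor a (s, t, u) * ∫ y in (0 : ℝ)..1, trigZeta a ((y / 2 : ℝ) : UnitAddCircle) s *
      (trigZeta a ((y / 2 : ℝ) : UnitAddCircle) t *
          trigZeta 0 ((y / 2 : ℝ) : UnitAddCircle) u) =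
    gammaFactor a (s, t, u) * bracket a s t u := by
  rw [← integral_eq_bracket a hs ht hu, ← intervalIntegral.integral_const_mul,
    ← intervalIntegral.integral_const_mul]
  refine intervalIntegral.integral_congr_ae (.of_forall fun y hy => ?_)
  rw [Set.uIoc_of_le zero_le_one] at hy
  have hu_expansion := rgamma_mul_expansion zero_le_one hu hy
  rw [Nat.cast_zero, add_zero, add_zero] at hu_expansion
  calc _ = (rgamma (1 + a - s) * trigZeta a ((y / 2 : ℝ) : UnitAddCircle) s) *
        ((rgamma (1 + a - t) * trigZeta a ((y / 2 : ℝ) : UnitAddCircle) t) *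
          (rgamma (1 - u) * trigZeta 0 ((y / 2 : ℝ) : UnitAddCircle) u)) := by
        rw [zeroFactor]
        ring
    _ = _ := by
        rw [← rgamma_mul_expansion ha hs hy, ← rgamma_mul_expansion ha ht hy, ← hu_expansion,
          gammaFactor]
        ring

end BracketIntegral

/-! ### The Tornheim sums as an integral -/

section Fourier

open Complex MeasureTheory HurwitzZeta

/-- The cosine (`a = 0`) or sine (`a = 1`), the trigonometric function in the series of
`trigZeta a`. -/
def trigFun (a : ℕ) (x : ℝ) : ℝ := if a = 0 then Real.cos x else Real.sin x

lemma abs_trigFun_le_one (a : ℕ) (x : ℝ) : |trigFun a x| ≤ 1 := by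
  unfold trigFun
  split_ifs
  exacts [Real.abs_cos_le_one x, Real.abs_sin_le_one x]

@[fun_prop]
lemma continuous_trigFun (a : ℕ) : Continuous (trigFun a) := by
  unfold trigFun
  split_ifs
  exacts [Real.continuous_cos, Real.continuous_sin]

lemma trigFun_mul_mul {a : ℕ} (ha : a ≤ 1) (x y z : ℝ) :
    trigFun a x * (trigFun a y * trigFun 0 z) =
      ((-1) ^ a * Real.cos (x + y + z) + (-1) ^ a * Real.cos (x + y - z) +
        Real.cos (x + z - y) + Real.cos (y + z - x)) / 4 := by
  interval_cases a <;>
  · simp only [trigFun, if_true, one_ne_zero, if_false, Real.cos_add, Real.sin_add, Real.cos_sub]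
    ring

lemma integral_cos_pi_mul (k : ℤ) :
    ∫ y in (0 : ℝ)..1, Real.cos (Real.pi * k * y) = if k = 0 then 1 else 0 := by
  split_ifs with h
  · simp [h]
  · have hk : Real.pi * (k : ℝ) ≠ 0 := mul_ne_zero Real.pi_ne_zero (Int.cast_ne_zero.2 h)
    rw [intervalIntegral.integral_comp_mul_left Real.cos hk, integral_cos]
    simp [mul_comm Real.pi, Real.sin_int_mul_pi]

/-- The indicator of `k + 1 = (i + 1) + (j + 1)`, which selects the terms of `T` among those of
a product of three Dirichlet series. -/
def resonance (i j k : ℕ) : ℂ := if k = i + j + 1 then 1 else 0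

lemma integral_trigFun_mul {a : ℕ} (ha : a ≤ 1) (i j k : ℕ) :
    ∫ y in (0 : ℝ)..1, ((trigFun a (Real.pi * (i + 1) * y) * (trigFun a (Real.pi * (j + 1) * y) *
      trigFun 0 (Real.pi * (k + 1) * y)) : ℝ) : ℂ) =
      ((-1) ^ a * resonance i j k + resonance k i j + resonance j k i) / 4 := by
  have hproduct : ∀ y : ℝ, trigFun a (Real.pi * (i + 1) * y) * (trigFun a (Real.pi * (j + 1) * y) *
      trigFun 0 (Real.pi * (k + 1) * y)) =
      ((-1) ^ a * Real.cos (Real.pi * ((i + j + k + 3 : ℤ) : ℝ) * y) +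
        (-1) ^ a * Real.cos (Real.pi * ((i + j - k + 1 : ℤ) : ℝ) * y) +
        Real.cos (Real.pi * ((i + k - j + 1 : ℤ) : ℝ) * y) +
        Real.cos (Real.pi * ((j + k - i + 1 : ℤ) : ℝ) * y)) / 4 := fun y => by
    rw [trigFun_mul_mul ha]
    push_cast
    congr 5 <;> (congr 2; ring)
  rw [intervalIntegral.integral_ofReal]
  simp_rw [hproduct]
  rw [intervalIntegral.integral_div, intervalIntegral.integral_add, intervalIntegral.integral_add,
    intervalIntegral.integral_add, intervalIntegral.integral_const_mul,
    intervalIntegral.integral_const_mul]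
  · have hijk : ¬(i : ℤ) + j + k + 3 = 0 := by omega
    have hk : (i : ℤ) + j - k + 1 = 0 ↔ k = i + j + 1 := by omega
    have hj : (i : ℤ) + k - j + 1 = 0 ↔ j = k + i + 1 := by omega
    have hi : (j : ℤ) + k - i + 1 = 0 ↔ i = j + k + 1 := by omega
    simp only [integral_cos_pi_mul, resonance, if_neg hijk, hk, hj, hi]
    split_ifs <;> simp
  all_goals exact Continuous.intervalIntegrable (by fun_prop) _ _

/-- `n ↦ (n + 1) ^ (-s)`, the terms of the Dirichlet series. -/
def dirichletTerm (s : ℂ) (n : ℕ) : ℂ := 1 / ((n : ℂ) + 1) ^ s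

/-- The terms of the product of the Dirichlet series at `s`, `t` and `u`. -/
def dirichletProd (s t u : ℂ) (k : ℕ × ℕ × ℕ) : ℂ :=
  dirichletTerm s k.1 * (dirichletTerm t k.2.1 * dirichletTerm u k.2.2)

lemma summable_norm_dirichletTerm {s : ℂ} (hs : 1 < s.re) :
    Summable fun n => ‖dirichletTerm s n‖ :=
  (hasSum_zeta hs).summable.norm

lemma summable_norm_dirichletProd {s t u : ℂ} (hs : 1 < s.re) (ht : 1 < t.re) (hu : 1 < u.re) :
    Summable fun k => ‖dirichletProd s t u k‖ := by
  simp_rw [dirichletProd, norm_mul]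
  exact (summable_norm_dirichletTerm hs).mul_of_nonneg
    ((summable_norm_dirichletTerm ht).mul_of_nonneg (summable_norm_dirichletTerm hu)
      (fun _ => norm_nonneg _) fun _ => norm_nonneg _)
    (fun _ => norm_nonneg _) fun _ => by positivity

lemma hasSum_trigZeta (a : ℕ) (y : ℝ) {s : ℂ} (hs : 1 < s.re) :
    HasSum (fun n : ℕ => dirichletTerm s n * (trigFun a (Real.pi * (n + 1) * y) : ℂ))
      (trigZeta a ((y / 2 : ℝ) : UnitAddCircle) s) := by
  have hsum : HasSum (fun n : ℕ => (trigFun a (2 * Real.pi * (y / 2) * n) : ℂ) / (n : ℂ) ^ s)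
      (trigZeta a ((y / 2 : ℝ) : UnitAddCircle) s) := by
    unfold trigFun trigZeta
    split_ifs
    exacts [hasSum_nat_cosZeta _ hs, hasSum_nat_sinZeta _ hs]
  have hs₀ : s ≠ 0 := fun h => by
    rw [h, zero_re] at hs
    linarith
  rw [← hasSum_nat_add_iff' 1] at hsum
  simp only [Finset.range_one, Finset.sum_singleton, Nat.cast_zero, zero_cpow hs₀, div_zero,
    sub_zero] at hsum
  refine hsum.congr_fun fun n => ?_
  rw [dirichletTerm, show Real.pi * ((n : ℝ) + 1) * y = 2 * Real.pi * (y / 2) * (n + 1) by ring]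
  push_cast
  ring

lemma summable_norm_mul_trigFun {s : ℂ} (hs : 1 < s.re) (a : ℕ) (y : ℝ) :
    Summable fun n : ℕ => ‖dirichletTerm s n * (trigFun a (Real.pi * (n + 1) * y) : ℂ)‖ :=
  .of_nonneg_of_le (fun _ => norm_nonneg _) (fun n => by
    rw [norm_mul, norm_real]
    exact mul_le_of_le_one_right (norm_nonneg _) (abs_trigFun_le_one _ _))
    (summable_norm_dirichletTerm hs)

lemma hasSum_trigZeta_mul (a b c : ℕ) {s t u : ℂ} (hs : 1 < s.re) (ht : 1 < t.re)
    (hu : 1 < u.re) (y : ℝ) :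
    HasSum (fun k : ℕ × ℕ × ℕ => dirichletProd s t u k *
        ((trigFun a (Real.pi * (k.1 + 1) * y) * (trigFun b (Real.pi * (k.2.1 + 1) * y) *
          trigFun c (Real.pi * (k.2.2 + 1) * y)) : ℝ) : ℂ))
      (trigZeta a ((y / 2 : ℝ) : UnitAddCircle) s * (trigZeta b ((y / 2 : ℝ) : UnitAddCircle) t *
        trigZeta c ((y / 2 : ℝ) : UnitAddCircle) u)) := by
  have hnorm_tu := (summable_norm_mul_trigFun ht b y).mul_of_nonneg
    (summable_norm_mul_trigFun hu c y) (fun _ => norm_nonneg _) fun _ => norm_nonneg _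
  simp_rw [← norm_mul] at hnorm_tu
  have hnorm := (summable_norm_mul_trigFun hs a y).mul_of_nonneg hnorm_tu
    (fun _ => norm_nonneg _) fun _ => norm_nonneg _
  simp_rw [← norm_mul] at hnorm
  refine ((hasSum_trigZeta a y hs).mul ((hasSum_trigZeta b y ht).mul (hasSum_trigZeta c y hu)
    hnorm_tu.of_norm) hnorm.of_norm).congr_fun fun k => ?_
  rw [dirichletProd]
  push_cast
  ring

lemma hasSum_resonance {s t u v : ℂ} (h : HasSum (tornheimTerm s t u) v) :
    HasSum (fun k : ℕ × ℕ × ℕ => dirichletProd s t u k * resonance k.1 k.2.1 k.2.2) v := by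
  have hinj : Function.Injective fun k : ℕ × ℕ => (k.1, k.2, k.1 + k.2 + 1) := fun k l h =>
    Prod.ext (by simpa using congrArg (·.1) h) (by simpa using congrArg (·.2.1) h)
  refine (hinj.hasSum_iff fun k hk => ?_).1 (h.congr_fun fun k => ?_)
  · rw [resonance, if_neg fun h => hk ⟨(k.1, k.2.1), by simp [← h]⟩, mul_zero]
  · simp only [Function.comp_apply, resonance, if_true, dirichletProd, dirichletTerm, tornheimTerm]
    push_cast
    rw [show (k.1 : ℂ) + k.2 + 1 + 1 = k.1 + 1 + (k.2 + 1) by ring]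
    simp only [one_div, mul_inv, mul_one]
    ring

lemma hasSum_comp_rotate {α β γ M : Type*} [AddCommMonoid M] [TopologicalSpace M]
    {f : α × β × γ → M} {v : M} (h : HasSum f v) :
    HasSum (fun k : β × γ × α => f (k.2.2, k.1, k.2.1)) v :=
  (Equiv.hasSum_iff (e := (⟨fun k => (k.2.2, k.1, k.2.1), fun k => (k.2.1, k.2.2, k.1),
    fun _ => rfl, fun _ => rfl⟩ : β × γ × α ≃ α × β × γ))).2 h

lemma integral_trigZeta {a : ℕ} (ha : a ≤ 1) {s t u v₁ v₂ v₃ : ℂ} (hs : 1 < s.re)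
    (ht : 1 < t.re) (hu : 1 < u.re) (h₁ : HasSum (tornheimTerm s t u) v₁)
    (h₂ : HasSum (tornheimTerm u s t) v₂) (h₃ : HasSum (tornheimTerm t u s) v₃) :
    ∫ y in (0 : ℝ)..1, trigZeta a ((y / 2 : ℝ) : UnitAddCircle) s *
        (trigZeta a ((y / 2 : ℝ) : UnitAddCircle) t *
          trigZeta 0 ((y / 2 : ℝ) : UnitAddCircle) u) = ((-1) ^ a * v₁ + v₂ + v₃) / 4 := by
  have hintegral := intervalIntegral.hasSum_integral_of_dominated_convergence (μ := volume)
    (a := (0 : ℝ)) (b := 1) (fun k _ => ‖dirichletProd s t u k‖)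
    (fun k => Continuous.aestronglyMeasurable (by fun_prop)) (fun k => .of_forall fun y _ => ?_)
    (.of_forall fun _ _ => summable_norm_dirichletProd hs ht hu) intervalIntegrable_const
    (.of_forall fun y _ => hasSum_trigZeta_mul a a 0 hs ht hu y)
  · simp_rw [intervalIntegral.integral_const_mul, integral_trigFun_mul ha] at hintegral
    have hresonance := ((((hasSum_resonance h₁).mul_left ((-1) ^ a)).add
      (hasSum_comp_rotate (hasSum_resonance h₂))).add
      (hasSum_comp_rotate (hasSum_comp_rotate (hasSum_resonance h₃)))).div_const 4
    refine hintegral.unique (hresonance.congr_fun fun k => ?_)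
    simp only [dirichletProd]
    ring
  · rw [norm_mul, norm_real, norm_mul, norm_mul]
    exact mul_le_of_le_one_right (norm_nonneg _) (mul_le_one₀ (abs_trigFun_le_one _ _)
      (by positivity) (mul_le_one₀ (abs_trigFun_le_one _ _) (by positivity)
        (abs_trigFun_le_one _ _)))

lemma polarFactor_ne_zero_of_one_lt_re (a : ℕ) {s t u : ℂ} (hst : 1 < (s + t).re)
    (htu : 1 < (t + u).re) (hus : 1 < (u + s).re) (hstu : 2 < (s + t + u).re) :
    polarFactor a (s, t, u) ≠ 0 := by
  have : (0 : ℝ) ≤ a := a.cast_nonneg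
  simp only [add_re] at hst htu hus hstu
  refine mul_ne_zero (mul_ne_zero (mul_ne_zero ?_ ?_) ?_) fun h => ?_
  on_goal 4 =>
    have hre := congrArg re h
    simp only [sub_re, add_re, re_ofNat, zero_re] at hre
    linarith
  all_goals
    refine rgamma_ne_zero_of_re_pos ?_
    simp only [sub_re, add_re, one_re, natCast_re]
    linarith

lemma gammaFactor_ne_zero_of_re_pos (a : ℕ) {s t u : ℂ} (hs : 0 < s.re) (ht : 0 < t.re)
    (hu : 0 < u.re) : gammaFactor a (s, t, u) ≠ 0 := by
  refine mul_ne_zero (mul_ne_zero ?_ ?_) (rgamma_ne_zero_of_re_pos hu)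
  all_goals
    refine rgamma_ne_zero_of_re_pos ?_
    rw [add_re, natCast_re]
    positivity

lemma polarFactor_mul_eq_four_mul_numer {a : ℕ} (ha : a ≤ 1) {s t u v₁ v₂ v₃ : ℂ} (hs : 1 < s.re)
    (ht : 1 < t.re) (hu : 1 < u.re) (h₁ : HasSum (tornheimTerm s t u) v₁)
    (h₂ : HasSum (tornheimTerm u s t) v₂) (h₃ : HasSum (tornheimTerm t u s) v₃) :
    polarFactor a (s, t, u) * zeroFactor a (s, t, u) *
      ((-1) ^ a * v₁ + v₂ + v₃) = 4 * numer a (s, t, u) := by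
  have hintegral := rgamma_mul_integral_trigZeta ha hs ht hu
  rw [integral_trigZeta ha hs ht hu h₁ h₂ h₃] at hintegral
  have hpolar : polarFactor a (s, t, u) ≠ 0 := by
    apply polarFactor_ne_zero_of_one_lt_re <;> simp only [add_re] <;> linarith
  rw [numer_eq_mul_bracket (gammaFactor_ne_zero_of_re_pos a (by linarith) (by linarith)
    (by linarith)) hpolar]
  linear_combination 4 * polarFactor a (s, t, u) * hintegral

end Fourier

/-! ### The double series in its region of convergence -/

section Convergence

/-- If `x ≤ y`, then `x + y` is comparable to `y`, and the excess of the exponent of `y` over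
`1 + δ` may be moved to `x`. -/
lemma rpow_mul_le_of_le {x y σ τ υ δ : ℝ} (hx : 1 ≤ x) (hxy : x ≤ y)
    (hτυ : 1 + δ ≤ τ + υ) (hστυ : 2 + 2 * δ ≤ σ + τ + υ) :
    x ^ (-σ) * y ^ (-τ) * (x + y) ^ (-υ) ≤ 2 ^ |υ| * (x ^ (-(1 + δ)) * y ^ (-(1 + δ))) := by
  have hx₀ : 0 < x := by linarith
  have hy₀ : 0 < y := by linarith
  have hadd : (x + y) ^ (-υ) ≤ 2 ^ |υ| * y ^ (-υ) := by
    rw [show x + y = (x + y) / y * y by field_simp, Real.mul_rpow (by positivity) hy₀.le]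
    gcongr
    have hone : 1 ≤ (x + y) / y := by rw [le_div_iff₀ hy₀]; linarith
    have htwo : (x + y) / y ≤ 2 := by rw [div_le_iff₀ hy₀]; linarith
    calc ((x + y) / y) ^ (-υ) ≤ ((x + y) / y) ^ |υ| :=
          Real.rpow_le_rpow_of_exponent_le hone (neg_le_abs υ)
      _ ≤ 2 ^ |υ| := Real.rpow_le_rpow (by positivity) htwo (abs_nonneg υ)
  have hexcess : y ^ (1 + δ - τ - υ) ≤ x ^ (1 + δ - τ - υ) :=
    Real.rpow_le_rpow_of_nonpos hx₀ hxy (by linarith)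
  have hsplit : y ^ (-τ) * y ^ (-υ) = y ^ (1 + δ - τ - υ) * y ^ (-(1 + δ)) := by
    rw [← Real.rpow_add hy₀, ← Real.rpow_add hy₀]
    ring_nf
  have htotal : x ^ (-σ) * x ^ (1 + δ - τ - υ) ≤ x ^ (-(1 + δ)) := by
    rw [← Real.rpow_add hx₀]
    exact Real.rpow_le_rpow_of_exponent_le hx (by linarith)
  calc x ^ (-σ) * y ^ (-τ) * (x + y) ^ (-υ)
      ≤ x ^ (-σ) * y ^ (-τ) * (2 ^ |υ| * y ^ (-υ)) := by gcongr
    _ = 2 ^ |υ| * (x ^ (-σ) * y ^ (1 + δ - τ - υ) * y ^ (-(1 + δ))) := by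
        linear_combination 2 ^ |υ| * x ^ (-σ) * hsplit
    _ ≤ 2 ^ |υ| * (x ^ (-σ) * x ^ (1 + δ - τ - υ) * y ^ (-(1 + δ))) := by gcongr
    _ ≤ _ := by gcongr

lemma rpow_mul_le {x y σ τ υ δ : ℝ} (hx : 1 ≤ x) (hy : 1 ≤ y) (hσυ : 1 + δ ≤ σ + υ)
    (hτυ : 1 + δ ≤ τ + υ) (hστυ : 2 + 2 * δ ≤ σ + τ + υ) :
    x ^ (-σ) * y ^ (-τ) * (x + y) ^ (-υ) ≤ 2 ^ |υ| * (x ^ (-(1 + δ)) * y ^ (-(1 + δ))) := by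
  rcases le_total x y with hxy | hyx
  · exact rpow_mul_le_of_le hx hxy hτυ hστυ
  · rw [add_comm x y, mul_comm (x ^ (-σ)), mul_comm (x ^ (-(1 + δ)))]
    exact rpow_mul_le_of_le hy hyx hσυ (by linarith)

lemma norm_tornheimTerm_le {s t u : ℂ} {δ : ℝ} (hsu : 1 + δ ≤ (s + u).re)
    (htu : 1 + δ ≤ (t + u).re) (hstu : 2 + 2 * δ ≤ (s + t + u).re) (k : ℕ × ℕ) :
    ‖tornheimTerm s t u k‖ ≤
      2 ^ |u.re| * (((k.1 : ℝ) + 1) ^ (-(1 + δ)) * ((k.2 : ℝ) + 1) ^ (-(1 + δ))) := by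
  have hterm : tornheimTerm s t u k = 1 / ((((k.1 + 1 : ℝ) : ℂ)) ^ s * ((k.2 + 1 : ℝ) : ℂ) ^ t *
      ((k.1 + 1 + (k.2 + 1) : ℝ) : ℂ) ^ u) := by
    rw [tornheimTerm]
    push_cast
    rfl
  have hm : (0 : ℝ) < k.1 + 1 := by positivity
  have hn : (0 : ℝ) < k.2 + 1 := by positivity
  have hmn : (0 : ℝ) < k.1 + 1 + (k.2 + 1) := by positivity
  rw [hterm, norm_div, norm_one, norm_mul, norm_mul, Complex.norm_cpow_eq_rpow_re_of_pos hm,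
    Complex.norm_cpow_eq_rpow_re_of_pos hn, Complex.norm_cpow_eq_rpow_re_of_pos hmn, one_div,
    mul_inv, mul_inv, ← Real.rpow_neg hm.le, ← Real.rpow_neg hn.le, ← Real.rpow_neg hmn.le]
  exact rpow_mul_le (by simp) (by simp) hsu htu hstu

lemma summable_rpow_mul {δ : ℝ} (hδ : 0 < δ) : Summable (fun k : ℕ × ℕ =>
    ((k.1 : ℝ) + 1) ^ (-(1 + δ)) * ((k.2 : ℝ) + 1) ^ (-(1 + δ))) := by
  have h : Summable (fun n : ℕ => ((n : ℝ) + 1) ^ (-(1 + δ))) := by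
    simpa using (summable_nat_add_iff 1).2
      (Real.summable_nat_rpow.2 (by linarith : -(1 + δ) < -1))
  exact h.mul_of_nonneg h (fun _ => by positivity) (fun _ => by positivity)

lemma isOpen_setOf_lt_re {X : Type*} [TopologicalSpace X] {f : X → ℂ} (hf : Continuous f) (r : ℝ) :
    IsOpen {x | r < (f x).re} :=
  isOpen_lt continuous_const (Complex.continuous_re.comp hf)

lemma isOpen_convRegion : IsOpen convRegion :=
  (isOpen_setOf_lt_re (by fun_prop) 1).inter
    ((isOpen_setOf_lt_re (by fun_prop) 1).inter (isOpen_setOf_lt_re (by fun_prop) 2))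

lemma convex_convRegion : Convex ℝ convRegion := by
  have hre : ∀ (L : ℂ × ℂ × ℂ →ₗ[ℝ] ℂ) (r : ℝ), Convex ℝ {p | r < (L p).re} := fun L r =>
    convex_halfSpace_gt (Complex.reLm ∘ₗ L).isLinear r
  let fst : ℂ × ℂ × ℂ →ₗ[ℝ] ℂ := .fst ℝ _ _
  let snd : ℂ × ℂ × ℂ →ₗ[ℝ] ℂ := .fst ℝ _ _ ∘ₗ .snd ℝ _ _
  let thd : ℂ × ℂ × ℂ →ₗ[ℝ] ℂ := .snd ℝ _ _ ∘ₗ .snd ℝ _ _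
  exact (hre (fst + thd) 1).inter ((hre (snd + thd) 1).inter (hre (fst + snd + thd) 2))

lemma exists_summable_bound_tornheimTerm {p : ℂ × ℂ × ℂ} (hp : p ∈ convRegion) :
    ∃ v : ℕ × ℕ → ℝ, Summable v ∧
      ∀ᶠ q in 𝓝 p, ∀ k, ‖tornheimTerm q.1 q.2.1 q.2.2 k‖ ≤ v k := by
  obtain ⟨hsu, htu, hstu⟩ := hp
  obtain ⟨δ, hδ, hδ_lt⟩ : ∃ δ : ℝ, 0 < δ ∧ δ < min ((p.1 + p.2.2).re - 1)
      (min ((p.2.1 + p.2.2).re - 1) (((p.1 + p.2.1 + p.2.2).re - 2) / 2)) :=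
    exists_between (by simp only [lt_min_iff]; refine ⟨?_, ?_, ?_⟩ <;> linarith)
  simp only [lt_min_iff] at hδ_lt
  obtain ⟨hδsu, hδtu, hδstu⟩ := hδ_lt
  refine ⟨fun k => 2 ^ (|p.2.2.re| + 1) *
    (((k.1 : ℝ) + 1) ^ (-(1 + δ)) * ((k.2 : ℝ) + 1) ^ (-(1 + δ))),
    (summable_rpow_mul hδ).mul_left _, ?_⟩
  have habs : ∀ᶠ q : ℂ × ℂ × ℂ in 𝓝 p, |q.2.2.re| < |p.2.2.re| + 1 :=
    (Continuous.tendsto (by fun_prop) p).eventually_lt_const (lt_add_one |p.2.2.re|)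
  filter_upwards [
    (isOpen_setOf_lt_re (f := fun q : ℂ × ℂ × ℂ => q.1 + q.2.2) (by fun_prop) (1 + δ)).mem_nhds
      (lt_sub_iff_add_lt'.1 hδsu),
    (isOpen_setOf_lt_re (f := fun q : ℂ × ℂ × ℂ => q.2.1 + q.2.2) (by fun_prop) (1 + δ)).mem_nhds
      (lt_sub_iff_add_lt'.1 hδtu),
    (isOpen_setOf_lt_re (f := fun q : ℂ × ℂ × ℂ => q.1 + q.2.1 + q.2.2) (by fun_prop)
      (2 + 2 * δ)).mem_nhds (show 2 + 2 * δ < _ by linarith),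
    habs] with q hqsu hqtu hqstu hq k
  refine (norm_tornheimTerm_le hqsu.le hqtu.le hqstu.le k).trans ?_
  gcongr
  exact one_le_two

/-- The sum of the double series. -/
def tornheimSum (p : ℂ × ℂ × ℂ) : ℂ := ∑' k, tornheimTerm p.1 p.2.1 p.2.2 k

lemma hasSum_tornheimTerm {s t u : ℂ} (hp : (s, t, u) ∈ convRegion) :
    HasSum (tornheimTerm s t u) (tornheimSum (s, t, u)) := by
  obtain ⟨v, hv, hbound⟩ := exists_summable_bound_tornheimTerm hp
  exact (Summable.of_norm_bounded hv hbound.self_of_nhds).hasSum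

lemma differentiable_tornheimTerm (k : ℕ × ℕ) :
    Differentiable ℂ (fun p : ℂ × ℂ × ℂ => tornheimTerm p.1 p.2.1 p.2.2 k) := by
  have hm : (k.1 : ℂ) + 1 ≠ 0 := Nat.cast_add_one_ne_zero _
  have hn : (k.2 : ℂ) + 1 ≠ 0 := Nat.cast_add_one_ne_zero _
  have hmn : (k.1 : ℂ) + 1 + (k.2 + 1) ≠ 0 := by
    rw [show (k.1 : ℂ) + 1 + (k.2 + 1) = ((k.1 + k.2 + 1 : ℕ) : ℂ) + 1 by push_cast; ring]
    exact Nat.cast_add_one_ne_zero _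
  have hpow : ∀ {b : ℂ}, b ≠ 0 → Differentiable ℂ fun z : ℂ => b ^ z := fun hb =>
    differentiable_id.const_cpow (.inl hb)
  intro p
  refine differentiableAt_div (differentiableAt_const _)
    ((((hpow hm).comp differentiable_fst).mul ((hpow hn).comp (by fun_prop))).mul
      ((hpow hmn).comp (by fun_prop)) p) ?_
  simp [Complex.cpow_eq_zero_iff, hm, hn, hmn]

lemma differentiableOn_tornheimSum : DifferentiableOn ℂ tornheimSum convRegion :=
  differentiableOn_tsum_of_locally_summable isOpen_convRegion
    (fun k => (differentiable_tornheimTerm k).differentiableOn)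
    fun _ hp => exists_summable_bound_tornheimTerm hp

end Convergence

/-! ### The reduced numerator -/

section ReducedNumerator

/-- The points whose three cyclic rotations are all in `convRegion`. -/
def cyclicRegion : Set (ℂ × ℂ × ℂ) :=
  {p | (p.1, p.2.1, p.2.2) ∈ convRegion ∧ (p.2.2, p.1, p.2.1) ∈ convRegion ∧
    (p.2.1, p.2.2, p.1) ∈ convRegion}

lemma mem_cyclicRegion_iff {s t u : ℂ} : (s, t, u) ∈ cyclicRegion ↔
    1 < (s + t).re ∧ 1 < (t + u).re ∧ 1 < (u + s).re ∧ 2 < (s + t + u).re := by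
  simp only [cyclicRegion, convRegion, Set.mem_ofPred_eq, Complex.add_re]
  grind

lemma two_mem_cyclicRegion : ((2, 2, 2) : ℂ × ℂ × ℂ) ∈ cyclicRegion := by
  norm_num [mem_cyclicRegion_iff]

lemma isOpen_cyclicRegion : IsOpen cyclicRegion :=
  (isOpen_convRegion.preimage (by fun_prop)).inter
    ((isOpen_convRegion.preimage (f := fun p : ℂ × ℂ × ℂ => (p.2.2, p.1, p.2.1))
      (by fun_prop)).inter
    (isOpen_convRegion.preimage (f := fun p : ℂ × ℂ × ℂ => (p.2.1, p.2.2, p.1)) (by fun_prop)))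

lemma convex_cyclicRegion : Convex ℝ cyclicRegion := by
  rintro p ⟨hp₁, hp₂, hp₃⟩ q ⟨hq₁, hq₂, hq₃⟩ a b ha hb hab
  exact ⟨convex_convRegion hp₁ hq₁ ha hb hab, convex_convRegion hp₂ hq₂ ha hb hab,
    convex_convRegion hp₃ hq₃ ha hb hab⟩

/-- The combination of the three cyclic rotations of `T`, with sign `(-1) ^ a` for the first one:
`S₃` for `a = 0` and `S₄` for `a = 1`. -/
def cyclicSum (a : ℕ) (T : ℂ × ℂ × ℂ → ℂ) (p : ℂ × ℂ × ℂ) : ℂ :=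
  (-1) ^ a * T (p.1, p.2.1, p.2.2) + T (p.2.2, p.1, p.2.1) + T (p.2.1, p.2.2, p.1)

lemma differentiableOn_cyclicSum (a : ℕ) {T : ℂ × ℂ × ℂ → ℂ} {U V : Set (ℂ × ℂ × ℂ)}
    (hT : DifferentiableOn ℂ T U) (hVU : ∀ p ∈ V, (p.1, p.2.1, p.2.2) ∈ U ∧
      (p.2.2, p.1, p.2.1) ∈ U ∧ (p.2.1, p.2.2, p.1) ∈ U) :
    DifferentiableOn ℂ (cyclicSum a T) V := by
  have hcomp : ∀ {f : ℂ × ℂ × ℂ → ℂ × ℂ × ℂ}, Differentiable ℂ f → (∀ p ∈ V, f p ∈ U) →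
      DifferentiableOn ℂ (fun p => T (f p)) V := fun hf hmaps =>
    hT.comp hf.differentiableOn hmaps
  exact (((hcomp (by fun_prop) fun p hp => (hVU p hp).1).const_mul _).add
    (hcomp (by fun_prop) fun p hp => (hVU p hp).2.1)).add
      (hcomp (by fun_prop) fun p hp => (hVU p hp).2.2)

lemma differentiableOn_cyclicSum_tornheimSum (a : ℕ) :
    DifferentiableOn ℂ (cyclicSum a tornheimSum) cyclicRegion :=
  differentiableOn_cyclicSum a differentiableOn_tornheimSum fun _ hp => hp

lemma polarFactor_mul_cyclicSum {a : ℕ} (ha : a ≤ 1) {p : ℂ × ℂ × ℂ} (hp : p ∈ cyclicRegion) :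
    polarFactor a p * zeroFactor a p * cyclicSum a tornheimSum p = 4 * numer a p := by
  have hdiff : DifferentiableOn ℂ (fun p => polarFactor a p * zeroFactor a p *
      cyclicSum a tornheimSum p) cyclicRegion :=
    Differentiable.differentiableOn (by fun_prop) |>.mul
      (differentiableOn_cyclicSum_tornheimSum a)
  refine eqOn_of_eventuallyEq_of_convex isOpen_cyclicRegion convex_cyclicRegion hdiff
    (g := fun p => 4 * numer a p) (by fun_prop) two_mem_cyclicRegion ?_ hp
  filter_upwards [isOpen_cyclicRegion.mem_nhds two_mem_cyclicRegion,
    (isOpen_setOf_lt_re (f := fun q : ℂ × ℂ × ℂ => q.1) (by fun_prop) 1).mem_nhds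
      (show 1 < (2 : ℂ).re by norm_num),
    (isOpen_setOf_lt_re (f := fun q : ℂ × ℂ × ℂ => q.2.1) (by fun_prop) 1).mem_nhds
      (show 1 < (2 : ℂ).re by norm_num),
    (isOpen_setOf_lt_re (f := fun q : ℂ × ℂ × ℂ => q.2.2) (by fun_prop) 1).mem_nhds
      (show 1 < (2 : ℂ).re by norm_num)] with q hq hs ht hu
  exact polarFactor_mul_eq_four_mul_numer ha hs ht hu (hasSum_tornheimTerm hq.1)
    (hasSum_tornheimTerm hq.2.1) (hasSum_tornheimTerm hq.2.2)

lemma one_le_re_of_rgamma_eq_zero {b : ℕ} {z : ℂ} (h : rgamma (1 + b - z) = 0) : 1 ≤ z.re := by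
  contrapose! h
  refine rgamma_ne_zero_of_re_pos ?_
  simp only [Complex.sub_re, Complex.add_re, Complex.one_re, Complex.natCast_re]
  linarith [(b.cast_nonneg : (0 : ℝ) ≤ b)]

lemma eq_zero_of_forall_one_lt_re {f : ℂ × ℂ → ℂ} (hf : Differentiable ℂ f)
    (h : ∀ x y : ℂ, 1 < x.re → 1 < y.re → f (x, y) = 0) (p : ℂ × ℂ) : f p = 0 := by
  refine eqOn_of_eventuallyEq_of_convex isOpen_univ convex_univ hf.differentiableOn
    (differentiableOn_const 0) (Set.mem_univ ((2, 2) : ℂ × ℂ)) ?_ (Set.mem_univ p)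
  filter_upwards [(isOpen_setOf_lt_re continuous_fst 1).mem_nhds
      (show 1 < (2 : ℂ).re by norm_num),
    (isOpen_setOf_lt_re continuous_snd 1).mem_nhds (show 1 < (2 : ℂ).re by norm_num)]
    with q hx hy
  exact h q.1 q.2 hx hy

lemma numer_eq_zero_of_mem_cyclicRegion {a : ℕ} (ha : a ≤ 1) {p : ℂ × ℂ × ℂ}
    (hp : p ∈ cyclicRegion) (h : zeroFactor a p = 0) : numer a p = 0 := by
  have hnumer := polarFactor_mul_cyclicSum ha hp
  rw [h, mul_zero, zero_mul] at hnumer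
  simpa using hnumer.symm

/-- A hyperplane on which a factor of `zeroFactor` vanishes meets `cyclicRegion` in a nonempty
open subset of itself. -/
lemma numer_eq_zero_of_zeroFactor_eq_zero {a : ℕ} (ha : a ≤ 1) {p : ℂ × ℂ × ℂ}
    (h : zeroFactor a p = 0) : numer a p = 0 := by
  obtain ⟨s, t, u⟩ := p
  have hzero := h
  simp only [zeroFactor, mul_eq_zero] at hzero
  rcases hzero with (hs | ht) | hu
  · have hre := one_le_re_of_rgamma_eq_zero hs
    refine eq_zero_of_forall_one_lt_re (f := fun q => numer a (s, q.1, q.2)) (by fun_prop)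
      (fun x y hx hy => numer_eq_zero_of_mem_cyclicRegion ha ?_ (by simp [zeroFactor, hs])) (t, u)
    simp only [mem_cyclicRegion_iff, Complex.add_re]
    refine ⟨?_, ?_, ?_, ?_⟩ <;> linarith
  · have hre := one_le_re_of_rgamma_eq_zero ht
    refine eq_zero_of_forall_one_lt_re (f := fun q => numer a (q.1, t, q.2)) (by fun_prop)
      (fun x y hx hy => numer_eq_zero_of_mem_cyclicRegion ha ?_ (by simp [zeroFactor, ht])) (s, u)
    simp only [mem_cyclicRegion_iff, Complex.add_re]
    refine ⟨?_, ?_, ?_, ?_⟩ <;> linarith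
  · have hre := one_le_re_of_rgamma_eq_zero (b := 0) (by simpa using hu)
    refine eq_zero_of_forall_one_lt_re (f := fun q => numer a (q.1, q.2, u)) (by fun_prop)
      (fun x y hx hy => numer_eq_zero_of_mem_cyclicRegion ha ?_ (by simp [zeroFactor, hu])) (s, t)
    simp only [mem_cyclicRegion_iff, Complex.add_re]
    refine ⟨?_, ?_, ?_, ?_⟩ <;> linarith

lemma deriv_rgamma_sub_ne_zero {c z : ℂ} (h : rgamma (c - z) = 0) :
    deriv (fun z => rgamma (c - z)) z ≠ 0 := by
  rw [deriv_comp_const_sub]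
  exact neg_ne_zero.2 (deriv_rgamma_ne_zero h)

lemma exists_numer_eq_zeroFactor_mul {a : ℕ} (ha : a ≤ 1) :
    ∃ N : ℂ × ℂ × ℂ → ℂ, Differentiable ℂ N ∧ ∀ p, numer a p = zeroFactor a p * N p :=
  exists_eq_mul_mul_mul_of_vanishing (D₁ := fun z => rgamma (1 + a - z))
    (D₂ := fun z => rgamma (1 + a - z)) (D₃ := fun z => rgamma (1 - z)) (differentiable_numer a)
    (by fun_prop) (by fun_prop) (by fun_prop) (fun _ => deriv_rgamma_sub_ne_zero)
    (fun _ => deriv_rgamma_sub_ne_zero) (fun _ => deriv_rgamma_sub_ne_zero)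
    fun _ h => numer_eq_zero_of_zeroFactor_eq_zero ha h

/-- The continuation of the cyclic combination of Tornheim sums, where `N` is the quotient of
`numer a` by `zeroFactor a`. -/
def continuedSum (a : ℕ) (N : ℂ × ℂ × ℂ → ℂ) (p : ℂ × ℂ × ℂ) : ℂ := 4 * N p / polarFactor a p

lemma isOpen_polarFactor_ne_zero (a : ℕ) : IsOpen {p | polarFactor a p ≠ 0} :=
  isOpen_ne_fun (differentiable_polarFactor a).continuous continuous_const

lemma differentiableOn_continuedSum (a : ℕ) {N : ℂ × ℂ × ℂ → ℂ} (hN : Differentiable ℂ N) :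
    DifferentiableOn ℂ (continuedSum a N) {p | polarFactor a p ≠ 0} := fun p hp =>
  (differentiableAt_div ((hN p).const_mul 4) (differentiable_polarFactor a p)
    hp).differentiableWithinAt

lemma polarFactor_ne_zero_of_mem_cyclicRegion (a : ℕ) {p : ℂ × ℂ × ℂ} (hp : p ∈ cyclicRegion) :
    polarFactor a p ≠ 0 := by
  obtain ⟨hst, htu, hus, hstu⟩ := mem_cyclicRegion_iff.1 hp
  exact polarFactor_ne_zero_of_one_lt_re a hst htu hus hstu

lemma zeroFactor_three_halves_ne_zero {a : ℕ} (ha : a ≤ 1) :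
    zeroFactor a (3 / 2, 3 / 2, 3 / 2) ≠ 0 := by
  have hneg_half : rgamma (1 - 3 / 2) ≠ 0 := fun h => by
    obtain ⟨n, hn⟩ := rgamma_eq_zero_iff.1 h
    have hcast : ((4 * n : ℕ) : ℂ) = (1 : ℕ) := by
      push_cast
      linear_combination 2 * hn
    have := Nat.cast_injective hcast
    omega
  have hfactor : rgamma (1 + a - 3 / 2) ≠ 0 := by
    interval_cases a
    · simpa using hneg_half
    · exact rgamma_ne_zero_of_re_pos (by norm_num)
  exact mul_ne_zero (mul_ne_zero hfactor hfactor) hneg_half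

lemma continuedSum_eq_cyclicSum {a : ℕ} (ha : a ≤ 1) {N : ℂ × ℂ × ℂ → ℂ}
    (hN : Differentiable ℂ N) (hnumer : ∀ p, numer a p = zeroFactor a p * N p) {p : ℂ × ℂ × ℂ}
    (hp : p ∈ cyclicRegion) : continuedSum a N p = cyclicSum a tornheimSum p := by
  have hdiff : DifferentiableOn ℂ
      (fun p => cyclicSum a tornheimSum p * polarFactor a p) cyclicRegion :=
    (differentiableOn_cyclicSum_tornheimSum a).mul (by fun_prop)
  have hmem : ((3 / 2, 3 / 2, 3 / 2) : ℂ × ℂ × ℂ) ∈ cyclicRegion := by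
    norm_num [mem_cyclicRegion_iff]
  rw [continuedSum, div_eq_iff (polarFactor_ne_zero_of_mem_cyclicRegion a hp)]
  refine eqOn_of_eventuallyEq_of_convex isOpen_cyclicRegion convex_cyclicRegion
    (f := fun p => 4 * N p) (by fun_prop) hdiff hmem ?_ hp
  filter_upwards [isOpen_cyclicRegion.mem_nhds hmem,
    (differentiable_zeroFactor a).continuous.continuousAt.eventually_ne
      (zeroFactor_three_halves_ne_zero ha)] with q hq hzero
  have heq := polarFactor_mul_cyclicSum ha hq
  rw [hnumer q] at heq
  refine mul_left_cancel₀ hzero ?_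
  linear_combination -heq

end ReducedNumerator

/-! ### The singular and the exceptional sets -/

section Sets

lemma mem_evenLEZero_iff {z : ℂ} : z ∈ evenLEZero ↔ rgamma z = 0 := by
  rw [rgamma_eq_zero_iff]
  constructor
  · rintro ⟨n, hn, ⟨k, rfl⟩, rfl⟩
    obtain ⟨m, rfl⟩ : ∃ m : ℕ, k = -m := ⟨k.natAbs, by omega⟩
    exact ⟨m, by push_cast; ring⟩
  · rintro ⟨n, rfl⟩
    exact ⟨-(2 * n), by omega, ⟨-n, by ring⟩, by push_cast; ring⟩

lemma mem_oddLEOne_iff {z : ℂ} : z ∈ oddLEOne ↔ rgamma (z - 1) = 0 := by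
  rw [← mem_evenLEZero_iff]
  constructor
  · rintro ⟨n, hn, hodd, rfl⟩
    exact ⟨n - 1, by omega, hodd.sub_odd odd_one, by push_cast; ring⟩
  · rintro ⟨n, hn, heven, hz⟩
    exact ⟨n + 1, by omega, heven.add_one, by push_cast; linear_combination hz⟩

lemma notMem_intLEOne_iff {z : ℂ} : z ∉ intLEOne ↔ rgamma (z - 1) ≠ 0 ∧ rgamma z ≠ 0 := by
  rw [← not_or, not_iff_not, ← mem_oddLEOne_iff, ← mem_evenLEZero_iff]
  constructor
  · rintro ⟨n, hn, rfl⟩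
    rcases Int.even_or_odd n with heven | hodd
    · exact .inr ⟨n, by obtain ⟨k, rfl⟩ := heven; omega, heven, rfl⟩
    · exact .inl ⟨n, hn, hodd, rfl⟩
  · rintro (⟨n, hn, -, rfl⟩ | ⟨n, hn, -, rfl⟩)
    · exact ⟨n, hn, rfl⟩
    · exact ⟨n, by omega, rfl⟩

lemma regularSet3_eq : regularSet3 = {p | polarFactor 0 p ≠ 0} := by
  ext p
  simp only [regularSet3, polarFactor, Set.mem_ofPred_eq, mem_oddLEOne_iff, mul_ne_zero_iff,
    sub_ne_zero, Nat.cast_zero, add_zero, and_assoc, ne_eq]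

lemma regularSet4_eq : regularSet4 = {p | polarFactor 1 p ≠ 0} := by
  ext p
  simp only [regularSet4, polarFactor, Set.mem_ofPred_eq, mem_oddLEOne_iff, mem_evenLEZero_iff,
    mul_ne_zero_iff, sub_ne_zero, Nat.cast_one, sub_add_cancel, and_assoc, ne_eq]

lemma rgamma_ne_zero_of_notMem_cosExceptional {s : ℂ} (h : s ∉ cosExceptional) :
    rgamma s ≠ 0 ∧ rgamma (1 - s) ≠ 0 := by
  refine ⟨fun hzero => h ?_, fun hzero => h ?_⟩ <;> obtain ⟨n, hn⟩ := rgamma_eq_zero_iff.1 hzero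
  · refine ⟨-2 * n, .inl ⟨by omega, ⟨-n, by ring⟩⟩, ?_⟩
    push_cast
    linear_combination hn
  · refine ⟨2 * n + 1, .inr ⟨by omega, ⟨n, by ring⟩⟩, ?_⟩
    push_cast
    linear_combination -hn

lemma rgamma_ne_zero_of_notMem_sinExceptional {s : ℂ} (h : s ∉ sinExceptional) :
    rgamma (s + 1) ≠ 0 ∧ rgamma (2 - s) ≠ 0 := by
  refine ⟨fun hzero => h ?_, fun hzero => h ?_⟩ <;> obtain ⟨n, hn⟩ := rgamma_eq_zero_iff.1 hzero
  · refine ⟨-2 * n - 1, .inl ⟨by omega, ⟨-n - 1, by ring⟩⟩, ?_⟩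
    push_cast
    linear_combination hn
  · refine ⟨2 * n + 2, .inr ⟨by omega, ⟨n + 1, by ring⟩⟩, ?_⟩
    push_cast
    linear_combination -hn

end Sets

/-! ### The expansions -/

section Expansions

variable {N : ℂ × ℂ × ℂ → ℂ} {s t u : ℂ}

lemma continuedSum_eq_mul_bracket {a : ℕ} (hnumer : ∀ p, numer a p = zeroFactor a p * N p)
    (hgamma : gammaFactor a (s, t, u) ≠ 0) (hzero : zeroFactor a (s, t, u) ≠ 0)
    (hpolar : polarFactor a (s, t, u) ≠ 0) :
    continuedSum a N (s, t, u) =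
      4 * gammaFactor a (s, t, u) / zeroFactor a (s, t, u) * bracket a s t u := by
  have heq := hnumer (s, t, u)
  rw [numer_eq_mul_bracket hgamma hpolar] at heq
  rw [continuedSum, div_eq_iff hpolar]
  field_simp
  linear_combination -heq

lemma continuedSum_eq_expansion3 (hnumer : ∀ p, numer 0 p = zeroFactor 0 p * N p)
    (hregular : (s, t, u) ∈ regularSet3) (hgeneric : (s, t, u) ∈ genericSet3) :
    continuedSum 0 N (s, t, u) = expansion3 s t u := by
  obtain ⟨hs, hs'⟩ := rgamma_ne_zero_of_notMem_cosExceptional hgeneric.1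
  obtain ⟨ht, ht'⟩ := rgamma_ne_zero_of_notMem_cosExceptional hgeneric.2.1
  obtain ⟨hu, hu'⟩ := rgamma_ne_zero_of_notMem_cosExceptional hgeneric.2.2
  rw [regularSet3_eq] at hregular
  rw [continuedSum_eq_mul_bracket hnumer (by simp_all [gammaFactor]) (by simp_all [zeroFactor])
    hregular, expansion3_eq, Gccc, gammaCos_eq hs, gammaCos_eq ht, gammaCos_eq hu]
  simp only [gammaFactor, zeroFactor, Nat.cast_zero, add_zero]
  field_simp

lemma continuedSum_eq_expansion4 (hnumer : ∀ p, numer 1 p = zeroFactor 1 p * N p)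
    (hregular : (s, t, u) ∈ regularSet4) (hgeneric : (s, t, u) ∈ genericSet4) :
    continuedSum 1 N (s, t, u) = expansion4 s t u := by
  obtain ⟨hs, hs'⟩ := rgamma_ne_zero_of_notMem_sinExceptional hgeneric.1
  obtain ⟨ht, ht'⟩ := rgamma_ne_zero_of_notMem_sinExceptional hgeneric.2.1
  obtain ⟨hu, hu'⟩ := rgamma_ne_zero_of_notMem_cosExceptional hgeneric.2.2
  rw [regularSet4_eq] at hregular
  rw [continuedSum_eq_mul_bracket hnumer (by simp_all [gammaFactor])
    (by simp_all [zeroFactor, one_add_one_eq_two]) hregular, expansion4_eq, Gssc, gammaSin_eq hs,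
    gammaSin_eq ht, gammaCos_eq hu]
  simp only [gammaFactor, zeroFactor, Nat.cast_one, one_add_one_eq_two]
  field_simp

end Expansions

/-! ### True singularities -/

section Singularities

lemma eventually_comp_affine_ne_zero {f g : ℂ → ℂ} {k : ℂ} (hf : Differentiable ℂ f) {w : ℂ}
    (hw : f w ≠ 0) (hk : k ≠ 0) (hg : ∀ z, g z = g 0 + z * k) :
    ∀ᶠ z in 𝓝[≠] (0 : ℂ), f (g z) ≠ 0 := by
  filter_upwards [eventually_ne_zero_of_entire (f := fun z => f (g 0 + z * k))
    (hf.comp (by fun_prop)) (z₁ := (w - g 0) / k)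
    (by rwa [div_mul_cancel₀ _ hk, add_sub_cancel]) 0] with z hz
  rwa [hg]

lemma eventually_rgamma_affine_ne_zero {g : ℂ → ℂ} {k : ℂ} (hk : k ≠ 0)
    (hg : ∀ z, g z = g 0 + z * k) : ∀ᶠ z in 𝓝[≠] (0 : ℂ), rgamma (g z) ≠ 0 :=
  eventually_comp_affine_ne_zero differentiable_rgamma (w := 1)
    (rgamma_ne_zero_of_re_pos (by simp)) hk hg

lemma eventually_etaReg_affine_ne_zero (a n : ℕ) {g : ℂ → ℂ} {k : ℂ} (hk : k ≠ 0)
    (hg : ∀ z, g z = g 0 + z * k) : ∀ᶠ z in 𝓝[≠] (0 : ℂ), etaReg a n (g z) ≠ 0 :=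
  eventually_comp_affine_ne_zero (differentiable_etaReg a n) (etaReg_ne_zero a n) hk hg

lemma eventually_affine_ne_zero {g : ℂ → ℂ} {k : ℂ} (hk : k ≠ 0)
    (hg : ∀ z, g z = g 0 + z * k) : ∀ᶠ z in 𝓝[≠] (0 : ℂ), g z ≠ 0 :=
  eventually_comp_affine_ne_zero (f := id) differentiable_id (w := 1) one_ne_zero hk hg

lemma singleSum_neg_two_mul (a n : ℕ) (x : ℂ) :
    singleSum a x (-(2 * n)) = etaReg a n x * rgammaQuot n (-(2 * n)) :=
  tsum_eq_single n fun m hm => by rw [rgammaQuot_eq_zero hm, mul_zero]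

/-- The zeros of `polarFactor a` which are not zeros of `numer a`. They are dense among all zeros
of `polarFactor a`. -/
def poleSet (a : ℕ) : Set (ℂ × ℂ × ℂ) := {p | polarFactor a p = 0 ∧ numer a p ≠ 0}

variable {a : ℕ} {s t u : ℂ}

lemma mem_closure_poleSet_of_line {p : ℂ × ℂ × ℂ} {γ : ℂ → ℂ × ℂ × ℂ} (hγ : Continuous γ)
    (hp : γ 0 = p) (hpolar : ∀ z, polarFactor a (γ z) = 0)
    (hnumer : ∀ᶠ z in 𝓝[≠] 0, numer a (γ z) ≠ 0) : p ∈ closure (poleSet a) :=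
  mem_closure_of_tendsto ((hp ▸ hγ.tendsto 0).mono_left nhdsWithin_le_nhds)
    (hnumer.mono fun z hz => ⟨hpolar z, hz⟩)

lemma mem_closure_poleSet_of_rgamma_first (h : rgamma (s + t - 1) = 0) :
    (s, t, u) ∈ closure (poleSet a) := by
  obtain ⟨n, hn⟩ := rgamma_eq_zero_iff.1 h
  have hconst : ∀ z : ℂ, s + z + (t - z) - 1 = -(2 * n) := fun z => by linear_combination hn
  have hpolar : ∀ z : ℂ, polarFactor a (s + z, t - z, u + 2 * z) = 0 := fun z => by
    simp only [polarFactor, hconst, rgamma_neg_two_mul, zero_mul]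
  refine mem_closure_poleSet_of_line (by fun_prop) (by simp) hpolar ?_
  filter_upwards [
    eventually_affine_ne_zero (g := fun z => s + t + (u + 2 * z) - 2) (k := 2)
      (by norm_num) fun z => by ring,
    eventually_rgamma_affine_ne_zero (g := fun z => s + z + a) (k := 1)
      (by norm_num) fun z => by ring,
    eventually_rgamma_affine_ne_zero (g := fun z => t - z + a) (k := -1)
      (by norm_num) fun z => by ring,
    eventually_rgamma_affine_ne_zero (g := fun z => t - z + (u + 2 * z) - 1 + a) (k := 1)
      (by norm_num) fun z => by ring,
    eventually_rgamma_affine_ne_zero (g := fun z => u + 2 * z + (s + z) - 1 + a) (k := 3)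
      (by norm_num) fun z => by ring,
    eventually_etaReg_affine_ne_zero 0 n (g := fun z => u + 2 * z) (k := 2)
      (by norm_num) fun z => by ring] with z htotal hs ht htu hus heta
  simp [numer, rgamma_neg_two_mul, singleSum_neg_two_mul, rgammaQuot_self_ne_zero, *]

lemma mem_closure_poleSet_of_rgamma_second (h : rgamma (t + u - 1 + a) = 0) :
    (s, t, u) ∈ closure (poleSet a) := by
  obtain ⟨n, hn⟩ := rgamma_eq_zero_iff.1 h
  have hconst : ∀ z : ℂ, t + z + (u - z) - 1 + a = -(2 * n) := fun z => by linear_combination hn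
  have hpolar : ∀ z : ℂ, polarFactor a (s + 2 * z, t + z, u - z) = 0 := fun z => by
    simp only [polarFactor, hconst, rgamma_neg_two_mul, zero_mul, mul_zero]
  refine mem_closure_poleSet_of_line (by fun_prop) (by simp) hpolar ?_
  filter_upwards [
    eventually_affine_ne_zero (g := fun z => s + 2 * z + (t + z) + (u - z) - 2) (k := 2)
      (by norm_num) fun z => by ring,
    eventually_rgamma_affine_ne_zero (g := fun z => t + z + a) (k := 1)
      (by norm_num) fun z => by ring,
    eventually_rgamma_affine_ne_zero (g := fun z => u - z) (k := -1)
      (by norm_num) fun z => by ring,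
    eventually_rgamma_affine_ne_zero (g := fun z => s + 2 * z + (t + z) - 1) (k := 3)
      (by norm_num) fun z => by ring,
    eventually_rgamma_affine_ne_zero (g := fun z => u - z + (s + 2 * z) - 1 + a) (k := 1)
      (by norm_num) fun z => by ring,
    eventually_etaReg_affine_ne_zero a n (g := fun z => s + 2 * z) (k := 2)
      (by norm_num) fun z => by ring] with z htotal ht hu hst hus heta
  simp [numer, rgamma_neg_two_mul, singleSum_neg_two_mul, rgammaQuot_self_ne_zero, *]

lemma mem_closure_poleSet_of_rgamma_third (h : rgamma (u + s - 1 + a) = 0) :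
    (s, t, u) ∈ closure (poleSet a) := by
  obtain ⟨n, hn⟩ := rgamma_eq_zero_iff.1 h
  have hconst : ∀ z : ℂ, u - z + (s + z) - 1 + a = -(2 * n) := fun z => by linear_combination hn
  have hpolar : ∀ z : ℂ, polarFactor a (s + z, t + 2 * z, u - z) = 0 := fun z => by
    simp only [polarFactor, hconst, rgamma_neg_two_mul, zero_mul, mul_zero]
  refine mem_closure_poleSet_of_line (by fun_prop) (by simp) hpolar ?_
  filter_upwards [
    eventually_affine_ne_zero (g := fun z => s + z + (t + 2 * z) + (u - z) - 2) (k := 2)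
      (by norm_num) fun z => by ring,
    eventually_rgamma_affine_ne_zero (g := fun z => u - z) (k := -1)
      (by norm_num) fun z => by ring,
    eventually_rgamma_affine_ne_zero (g := fun z => s + z + a) (k := 1)
      (by norm_num) fun z => by ring,
    eventually_rgamma_affine_ne_zero (g := fun z => s + z + (t + 2 * z) - 1) (k := 3)
      (by norm_num) fun z => by ring,
    eventually_rgamma_affine_ne_zero (g := fun z => t + 2 * z + (u - z) - 1 + a) (k := 1)
      (by norm_num) fun z => by ring,
    eventually_etaReg_affine_ne_zero a n (g := fun z => t + 2 * z) (k := 2)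
      (by norm_num) fun z => by ring] with z htotal hu hs hst htu heta
  simp [numer, rgamma_neg_two_mul, singleSum_neg_two_mul, rgammaQuot_self_ne_zero, *]

lemma mem_closure_poleSet_of_add_eq_two (h : s + t + u - 2 = 0) :
    (s, t, u) ∈ closure (poleSet a) := by
  have hconst : ∀ z : ℂ, s + z + (t + z) + (u - 2 * z) - 2 = 0 := fun z => by
    linear_combination h
  have hpolar : ∀ z : ℂ, polarFactor a (s + z, t + z, u - 2 * z) = 0 := fun z => by
    simp only [polarFactor, hconst, mul_zero]
  refine mem_closure_poleSet_of_line (by fun_prop) (by simp) hpolar ?_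
  filter_upwards [
    eventually_rgamma_affine_ne_zero (g := fun z => s + z + a) (k := 1)
      (by norm_num) fun z => by ring,
    eventually_rgamma_affine_ne_zero (g := fun z => t + z + a) (k := 1)
      (by norm_num) fun z => by ring,
    eventually_rgamma_affine_ne_zero (g := fun z => u - 2 * z) (k := -2)
      (by norm_num) fun z => by ring,
    eventually_rgamma_affine_ne_zero (g := fun z => s + z + (t + z) - 1) (k := 2)
      (by norm_num) fun z => by ring,
    eventually_rgamma_affine_ne_zero (g := fun z => t + z + (u - 2 * z) - 1 + a) (k := -1)
      (by norm_num) fun z => by ring,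
    eventually_rgamma_affine_ne_zero (g := fun z => u - 2 * z + (s + z) - 1 + a) (k := -1)
      (by norm_num) fun z => by ring] with z hs ht hu hst htu hus
  simp [numer, gammaFactor, *]

lemma mem_closure_poleSet {p : ℂ × ℂ × ℂ} (hp : polarFactor a p = 0) :
    p ∈ closure (poleSet a) := by
  simp only [polarFactor, mul_eq_zero] at hp
  rcases hp with ((hst | htu) | hus) | htotal
  exacts [mem_closure_poleSet_of_rgamma_first hst, mem_closure_poleSet_of_rgamma_second htu,
    mem_closure_poleSet_of_rgamma_third hus, mem_closure_poleSet_of_add_eq_two htotal]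

lemma dense_polarFactor_ne_zero (a : ℕ) : Dense {p | polarFactor a p ≠ 0} := by
  intro p
  by_contra hp
  have hzero : polarFactor a =ᶠ[𝓝 p] fun _ => 0 := by
    rw [mem_closure_iff_frequently, Filter.not_frequently] at hp
    filter_upwards [hp] with q hq
    exact not_not.1 hq
  exact polarFactor_ne_zero_of_mem_cyclicRegion a two_mem_cyclicRegion
    (eqOn_of_eventuallyEq_of_convex isOpen_univ convex_univ (by fun_prop)
      (differentiableOn_const 0) (Set.mem_univ p) hzero (Set.mem_univ _))

lemma isTrueSingularity_continuedSum {N : ℂ × ℂ × ℂ → ℂ} (hN : Differentiable ℂ N)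
    (hnumer : ∀ p, numer a p = zeroFactor a p * N p) {p : ℂ × ℂ × ℂ} (hp : polarFactor a p = 0) :
    IsTrueSingularity (continuedSum a N) {p | polarFactor a p ≠ 0} p := by
  rintro ⟨V, g, hV, hpV, hg, heq⟩
  have hcont : ContinuousOn (fun q => g q * polarFactor a q) V :=
    hg.continuousOn.mul (differentiable_polarFactor a).continuous.continuousOn
  have hclear : Set.EqOn (fun q => g q * polarFactor a q) (fun q => 4 * N q) V := by
    refine Set.EqOn.of_subset_closure (s := V ∩ {q | polarFactor a q ≠ 0}) (fun q hq => ?_) hcont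
      (hN.continuous.const_mul 4).continuousOn Set.inter_subset_left
      ((dense_polarFactor_ne_zero a).open_subset_closure_inter hV)
    rw [heq hq, continuedSum, div_mul_cancel₀ _ hq.2]
  obtain ⟨q, hqV, hpolar, hq⟩ := mem_closure_iff.1 (mem_closure_poleSet hp) V hV hpV
  have hNq := hclear hqV
  simp only [hpolar, mul_zero] at hNq
  rw [hnumer, (mul_eq_zero.1 hNq.symm).resolve_left (by norm_num), mul_zero] at hq
  exact hq rfl

end Singularities

/-! ### Uniqueness and existence of the continued double series -/

section Continuation

lemma countable_intLEOne : intLEOne.Countable :=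
  (Set.countable_range (fun n : ℤ => (n : ℂ))).mono (by rintro z ⟨n, -, rfl⟩; exact ⟨n, rfl⟩)

lemma isOpen_notMem_intLEOne {X : Type*} [TopologicalSpace X] {f : X → ℂ} (hf : Continuous f) :
    IsOpen {x | f x ∉ intLEOne} := by
  simp only [notMem_intLEOne_iff]
  exact (isOpen_ne_fun (differentiable_rgamma.continuous.comp (hf.sub continuous_const))
    continuous_const).inter (isOpen_ne_fun (differentiable_rgamma.continuous.comp hf)
    continuous_const)

/-- The points whose three cyclic rotations are all in `tornheimDomain`. -/
def cyclicDomain : Set (ℂ × ℂ × ℂ) :=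
  {p | p.1 + p.2.1 ∉ intLEOne ∧ p.2.1 + p.2.2 ∉ intLEOne ∧ p.2.2 + p.1 ∉ intLEOne ∧
    p.1 + p.2.1 + p.2.2 ≠ 2}

lemma mem_cyclicDomain_iff {s t u : ℂ} : (s, t, u) ∈ cyclicDomain ↔ InCyclicDomain s t u := by
  have hsut : s + u + t = s + t + u := by ring
  have htus : t + u + s = s + t + u := by ring
  simp only [InCyclicDomain, cyclicDomain, tornheimDomain, Set.mem_ofPred_eq, htus,
    add_comm u t, add_comm t s, add_comm u s, hsut]
  tauto

lemma isOpen_cyclicDomain : IsOpen cyclicDomain :=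
  (isOpen_notMem_intLEOne (by fun_prop)).inter ((isOpen_notMem_intLEOne (by fun_prop)).inter
    ((isOpen_notMem_intLEOne (by fun_prop)).inter (isOpen_ne_fun (by fun_prop) continuous_const)))

lemma isOpen_tornheimDomain : IsOpen tornheimDomain :=
  (isOpen_notMem_intLEOne (by fun_prop)).inter ((isOpen_notMem_intLEOne (by fun_prop)).inter
    (isOpen_ne_fun (by fun_prop) continuous_const))

lemma notMem_intLEOne_of_one_lt_re {z : ℂ} (h : 1 < z.re) : z ∉ intLEOne := by
  rintro ⟨n, hn, rfl⟩
  rw [Complex.intCast_re] at h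
  exact absurd hn (not_le.2 (by exact_mod_cast h))

lemma convRegion_subset_tornheimDomain : convRegion ⊆ tornheimDomain := by
  rintro p ⟨hsu, htu, htotal⟩
  refine ⟨notMem_intLEOne_of_one_lt_re hsu, notMem_intLEOne_of_one_lt_re htu, fun h => ?_⟩
  simp [h] at htotal

lemma cyclicRegion_subset_cyclicDomain : cyclicRegion ⊆ cyclicDomain := fun _ hp =>
  mem_cyclicDomain_iff.2 ⟨convRegion_subset_tornheimDomain hp.1,
    convRegion_subset_tornheimDomain hp.2.1, convRegion_subset_tornheimDomain hp.2.2⟩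

lemma polarFactor_ne_zero_of_mem_cyclicDomain {a : ℕ} (ha : a ≤ 1) {p : ℂ × ℂ × ℂ}
    (hp : p ∈ cyclicDomain) : polarFactor a p ≠ 0 := by
  simp only [cyclicDomain, Set.mem_ofPred_eq, notMem_intLEOne_iff, ← sub_ne_zero (b := (2 : ℂ))]
    at hp
  interval_cases a <;> simp [polarFactor, hp]

lemma countable_line_notMem_cyclicDomain {p : ℂ × ℂ × ℂ} (hp : p ∈ cyclicDomain) :
    {z : ℂ | p + z • (((2, 2, 2) : ℂ × ℂ × ℂ) - p) ∉ cyclicDomain}.Countable := by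
  obtain ⟨s, t, u⟩ := p
  obtain ⟨hst, htu, hus, htotal⟩ := hp
  have hpair {x : ℂ} (hx : x ∉ intLEOne) :=
    countable_preimage_line (y := 4) countable_intLEOne hx
  have hsum := countable_preimage_line (y := 6) (Set.countable_singleton (2 : ℂ)) htotal
  refine ((((hpair hst).union (hpair htu)).union (hpair hus)).union hsum).mono fun z => ?_
  contrapose!
  simp only [Set.mem_union, Set.mem_ofPred_eq, not_or, not_not, and_assoc]
  rintro ⟨hst, htu, hus, htotal⟩
  change (s + z * (2 - s), t + z * (2 - t), u + z * (2 - u)) ∈ cyclicDomain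
  refine ⟨?_, ?_, ?_, ?_⟩
  · convert hst using 2; ring
  · convert htu using 2; ring
  · convert hus using 2; ring
  · convert htotal using 1; ring_nf; simp

lemma eqOn_cyclicDomain {f g : ℂ × ℂ × ℂ → ℂ} (hf : DifferentiableOn ℂ f cyclicDomain)
    (hg : DifferentiableOn ℂ g cyclicDomain) (h : Set.EqOn f g cyclicRegion) :
    Set.EqOn f g cyclicDomain := fun _ hp =>
  eq_of_eventuallyEq_of_countable isOpen_cyclicDomain hf hg hp
    (cyclicRegion_subset_cyclicDomain two_mem_cyclicRegion) (countable_line_notMem_cyclicDomain hp)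
    (h.eventuallyEq_of_mem (isOpen_cyclicRegion.mem_nhds two_mem_cyclicRegion))

lemma IsTornheim.eq_tornheimSum {T : ℂ × ℂ × ℂ → ℂ} (hT : IsTornheim T) {p : ℂ × ℂ × ℂ}
    (hp : p ∈ convRegion) : T p = tornheimSum p :=
  (hT.2 p.1 p.2.1 p.2.2 hp).unique (hasSum_tornheimTerm hp)

lemma IsTornheim.continuedSum_eq_cyclicSum {T : ℂ × ℂ × ℂ → ℂ} (hT : IsTornheim T) {a : ℕ}
    (ha : a ≤ 1) {N : ℂ × ℂ × ℂ → ℂ} (hN : Differentiable ℂ N)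
    (hnumer : ∀ p, numer a p = zeroFactor a p * N p) {s t u : ℂ} (hp : InCyclicDomain s t u) :
    continuedSum a N (s, t, u) = cyclicSum a T (s, t, u) := by
  refine eqOn_cyclicDomain ((differentiableOn_continuedSum a hN).mono
      fun p hp => polarFactor_ne_zero_of_mem_cyclicDomain ha hp)
    (differentiableOn_cyclicSum a hT.1 fun p hp => mem_cyclicDomain_iff.1 hp) (fun p hp => ?_)
    (mem_cyclicDomain_iff.2 hp)
  rw [Tornheim.continuedSum_eq_cyclicSum ha hN hnumer hp, cyclicSum, cyclicSum,
    hT.eq_tornheimSum hp.1, hT.eq_tornheimSum hp.2.1, hT.eq_tornheimSum hp.2.2]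

lemma exists_differentiableOn_union {𝕜 E F : Type*} [NontriviallyNormedField 𝕜]
    [NormedAddCommGroup E] [NormedSpace 𝕜 E] [NormedAddCommGroup F] [NormedSpace 𝕜 F]
    {f g : E → F} {U V : Set E} (hU : IsOpen U) (hV : IsOpen V) (hf : DifferentiableOn 𝕜 f U)
    (hg : DifferentiableOn 𝕜 g V) (h : Set.EqOn f g (U ∩ V)) :
    ∃ F : E → F, DifferentiableOn 𝕜 F (U ∪ V) ∧ Set.EqOn F f U := by
  classical
  have hfirst : Set.EqOn (U.piecewise f g) f U := Set.piecewise_eqOn U f g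
  have hsecond : Set.EqOn (U.piecewise f g) g V := fun x hx => by
    by_cases hxU : x ∈ U
    · rw [hfirst hxU, h ⟨hxU, hx⟩]
    · exact Set.piecewise_eq_of_notMem U f g hxU
  exact ⟨U.piecewise f g, (hf.congr hfirst).union_of_isOpen (hg.congr hsecond) hU hV, hfirst⟩

/-- The part of `tornheimDomain` off the singular hyperplanes `s + t = 1, -1, -3, …` of `S₃` and
`S₄`. -/
def firstChart : Set (ℂ × ℂ × ℂ) := tornheimDomain ∩ {p | rgamma (p.1 + p.2.1 - 1) ≠ 0}

/-- The part of `tornheimDomain` off the singular hyperplanes `s + t = 0, -2, -4, …` of the two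
rotations of `S₄`. -/
def secondChart : Set (ℂ × ℂ × ℂ) := tornheimDomain ∩ {p | rgamma (p.1 + p.2.1) ≠ 0}

lemma isOpen_firstChart : IsOpen firstChart :=
  isOpen_tornheimDomain.inter
    (isOpen_ne_fun (differentiable_rgamma.continuous.comp (by fun_prop)) continuous_const)

lemma isOpen_secondChart : IsOpen secondChart :=
  isOpen_tornheimDomain.inter
    (isOpen_ne_fun (differentiable_rgamma.continuous.comp (by fun_prop)) continuous_const)

lemma tornheimDomain_subset_union : tornheimDomain ⊆ firstChart ∪ secondChart := by
  intro p hp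
  by_cases hodd : rgamma (p.1 + p.2.1 - 1) = 0
  · refine .inr ⟨hp, fun heven => ?_⟩
    obtain ⟨n, hn⟩ := rgamma_eq_zero_iff.1 hodd
    obtain ⟨m, hm⟩ := rgamma_eq_zero_iff.1 heven
    have hparity : ((2 * m + 1 : ℕ) : ℂ) = ((2 * n : ℕ) : ℂ) := by
      push_cast
      linear_combination hm - hn
    have := Nat.cast_injective hparity
    omega
  · exact .inl ⟨hp, hodd⟩

lemma firstChart_inter_secondChart : firstChart ∩ secondChart = cyclicDomain := by
  ext p
  simp only [firstChart, secondChart, tornheimDomain, cyclicDomain, Set.mem_inter_iff,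
    Set.mem_ofPred_eq, notMem_intLEOne_iff, add_comm p.2.2 p.1]
  tauto

lemma exists_eqOn_tornheimSum_firstChart : ∃ A : ℂ × ℂ × ℂ → ℂ,
    DifferentiableOn ℂ A firstChart ∧ Set.EqOn A tornheimSum cyclicRegion := by
  obtain ⟨N₀, hN₀, hnumer₀⟩ := exists_numer_eq_zeroFactor_mul zero_le_one
  obtain ⟨N₁, hN₁, hnumer₁⟩ := exists_numer_eq_zeroFactor_mul le_rfl
  have hpolar {a : ℕ} (ha : a ≤ 1) : ∀ p ∈ firstChart, polarFactor a p ≠ 0 := by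
    rintro p ⟨⟨hsu, htu, htotal⟩, hst⟩
    rw [add_comm, notMem_intLEOne_iff] at hsu
    rw [notMem_intLEOne_iff] at htu
    rw [← sub_ne_zero] at htotal
    interval_cases a <;> simp_all [polarFactor]
  refine ⟨fun p => 1 / 2 * (continuedSum 0 N₀ p - continuedSum 1 N₁ p),
    (((differentiableOn_continuedSum 0 hN₀).mono (hpolar zero_le_one)).sub
      ((differentiableOn_continuedSum 1 hN₁).mono (hpolar le_rfl))).const_mul _, fun p hp => ?_⟩
  simp only [continuedSum_eq_cyclicSum zero_le_one hN₀ hnumer₀ hp,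
    continuedSum_eq_cyclicSum le_rfl hN₁ hnumer₁ hp, cyclicSum]
  ring

lemma exists_eqOn_tornheimSum_secondChart : ∃ B : ℂ × ℂ × ℂ → ℂ,
    DifferentiableOn ℂ B secondChart ∧ Set.EqOn B tornheimSum cyclicRegion := by
  obtain ⟨N, hN, hnumer⟩ := exists_numer_eq_zeroFactor_mul le_rfl
  have hpolar : ∀ p ∈ secondChart, polarFactor 1 (p.2.2, p.1, p.2.1) ≠ 0 ∧
      polarFactor 1 (p.2.1, p.2.2, p.1) ≠ 0 := by
    rintro ⟨s, t, u⟩ ⟨⟨hsu, htu, htotal⟩, hst⟩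
    rw [add_comm, notMem_intLEOne_iff] at hsu
    rw [notMem_intLEOne_iff] at htu
    have hust : u + s + t - 2 ≠ 0 := fun h => htotal (by linear_combination h)
    have htus : t + u + s - 2 ≠ 0 := fun h => htotal (by linear_combination h)
    simp_all [polarFactor]
  have hcomp {f : ℂ × ℂ × ℂ → ℂ × ℂ × ℂ} (hf : Differentiable ℂ f)
      (hmaps : ∀ p ∈ secondChart, polarFactor 1 (f p) ≠ 0) :
      DifferentiableOn ℂ (fun p => continuedSum 1 N (f p)) secondChart :=
    (differentiableOn_continuedSum 1 hN).comp hf.differentiableOn hmaps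
  refine ⟨fun p => 1 / 2 * (continuedSum 1 N (p.2.2, p.1, p.2.1) +
      continuedSum 1 N (p.2.1, p.2.2, p.1)),
    ((hcomp (by fun_prop) fun p hp => (hpolar p hp).1).add
      (hcomp (by fun_prop) fun p hp => (hpolar p hp).2)).const_mul _, fun p hp => ?_⟩
  have hrot : (p.2.2, p.1, p.2.1) ∈ cyclicRegion := ⟨hp.2.1, hp.2.2, hp.1⟩
  have hrot' : (p.2.1, p.2.2, p.1) ∈ cyclicRegion := ⟨hp.2.2, hp.1, hp.2.1⟩
  simp only [continuedSum_eq_cyclicSum le_rfl hN hnumer hrot,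
    continuedSum_eq_cyclicSum le_rfl hN hnumer hrot', cyclicSum]
  ring

/-- On each chart a combination of `S₃`, `S₄` and the rotations of `S₄` isolates one term. -/
lemma exists_isTornheim : ∃ T, IsTornheim T := by
  obtain ⟨A, hA, hAsum⟩ := exists_eqOn_tornheimSum_firstChart
  obtain ⟨B, hB, hBsum⟩ := exists_eqOn_tornheimSum_secondChart
  have hAB : Set.EqOn A B (firstChart ∩ secondChart) := by
    have hAdiff := hA.mono (Set.inter_subset_left (t := secondChart))
    have hBdiff := hB.mono (Set.inter_subset_right (s := firstChart))
    rw [firstChart_inter_secondChart] at hAdiff hBdiff ⊢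
    exact eqOn_cyclicDomain hAdiff hBdiff (hAsum.trans hBsum.symm)
  obtain ⟨T, hT, hTA⟩ :=
    exists_differentiableOn_union isOpen_firstChart isOpen_secondChart hA hB hAB
  have hTdiff := hT.mono tornheimDomain_subset_union
  refine ⟨T, hTdiff, fun s t u hp => ?_⟩
  have hTsum : Set.EqOn T tornheimSum cyclicRegion := fun p hp => by
    have hchart := cyclicRegion_subset_cyclicDomain hp
    rw [← firstChart_inter_secondChart] at hchart
    exact (hTA hchart.1).trans (hAsum hp)
  rw [eqOn_of_eventuallyEq_of_convex isOpen_convRegion convex_convRegion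
    (hTdiff.mono convRegion_subset_tornheimDomain) differentiableOn_tornheimSum
    two_mem_cyclicRegion.1 (hTsum.eventuallyEq_of_mem
      (isOpen_cyclicRegion.mem_nhds two_mem_cyclicRegion)) hp]
  exact hasSum_tornheimTerm hp

end Continuation

lemma tendsto_nhdsWithin_of_eqOn {X Y : Type*} [TopologicalSpace X] [TopologicalSpace Y]
    {f g : X → Y} {U G : Set X} (hU : IsOpen U) (hf : ContinuousOn f U)
    (h : Set.EqOn f g (U ∩ G)) {p : X} (hp : p ∈ U) : Tendsto g (𝓝[U ∩ G] p) (𝓝 (f p)) :=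
  ((hf.continuousAt (hU.mem_nhds hp)).tendsto.mono_left nhdsWithin_le_nhds).congr'
    (h.eventuallyEq_nhdsWithin)

end

end Tornheim

theorem theorem2 :
    (∃ T : ℂ × ℂ × ℂ → ℂ, IsTornheim T) ∧
    ∀ T : ℂ × ℂ × ℂ → ℂ, IsTornheim T →
      (∃ S₃ : ℂ × ℂ × ℂ → ℂ,
        DifferentiableOn ℂ S₃ regularSet3 ∧
        (∀ s t u : ℂ, InCyclicDomain s t u →
          S₃ (s, t, u) = T (s, t, u) + T (u, s, t) + T (t, u, s)) ∧
        (∀ s t u : ℂ, (s, t, u) ∈ regularSet3 → (s, t, u) ∈ genericSet3 →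
          RapidExpansion3 s t u ∧ S₃ (s, t, u) = expansion3 s t u) ∧
        (∀ p ∈ regularSet3, Tendsto (fun q : ℂ × ℂ × ℂ => expansion3 q.1 q.2.1 q.2.2)
          (𝓝[regularSet3 ∩ genericSet3] p) (𝓝 (S₃ p))) ∧
        (∀ p ∉ regularSet3, IsTrueSingularity S₃ regularSet3 p)) ∧
      (∃ S₄ : ℂ × ℂ × ℂ → ℂ,
        DifferentiableOn ℂ S₄ regularSet4 ∧
        (∀ s t u : ℂ, InCyclicDomain s t u →
          S₄ (s, t, u) = -T (s, t, u) + T (u, s, t) + T (t, u, s)) ∧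
        (∀ s t u : ℂ, (s, t, u) ∈ regularSet4 → (s, t, u) ∈ genericSet4 →
          RapidExpansion4 s t u ∧ S₄ (s, t, u) = expansion4 s t u) ∧
        (∀ p ∈ regularSet4, Tendsto (fun q : ℂ × ℂ × ℂ => expansion4 q.1 q.2.1 q.2.2)
          (𝓝[regularSet4 ∩ genericSet4] p) (𝓝 (S₄ p))) ∧
        (∀ p ∉ regularSet4, IsTrueSingularity S₄ regularSet4 p)) := by
  refine ⟨exists_isTornheim, fun T hT => ⟨?_, ?_⟩⟩
  · obtain ⟨N, hN, hnumer⟩ := exists_numer_eq_zeroFactor_mul zero_le_one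
    have hdiff : DifferentiableOn ℂ (continuedSum 0 N) regularSet3 :=
      regularSet3_eq ▸ differentiableOn_continuedSum 0 hN
    have hopen : IsOpen regularSet3 := regularSet3_eq ▸ isOpen_polarFactor_ne_zero 0
    refine ⟨continuedSum 0 N, hdiff, fun s t u hp => ?_, fun s t u hp hgeneric =>
      ⟨rapidExpansion3 s t u, continuedSum_eq_expansion3 hnumer hp hgeneric⟩, fun p hp =>
      tendsto_nhdsWithin_of_eqOn hopen hdiff.continuousOn
        (fun q hq => continuedSum_eq_expansion3 hnumer hq.1 hq.2) hp, fun p hp => ?_⟩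
    · simpa [cyclicSum] using hT.continuedSum_eq_cyclicSum zero_le_one hN hnumer hp
    · rw [regularSet3_eq] at hp ⊢
      exact isTrueSingularity_continuedSum hN hnumer (not_not.1 hp)
  · obtain ⟨N, hN, hnumer⟩ := exists_numer_eq_zeroFactor_mul le_rfl
    have hdiff : DifferentiableOn ℂ (continuedSum 1 N) regularSet4 :=
      regularSet4_eq ▸ differentiableOn_continuedSum 1 hN
    have hopen : IsOpen regularSet4 := regularSet4_eq ▸ isOpen_polarFactor_ne_zero 1
    refine ⟨continuedSum 1 N, hdiff, fun s t u hp => ?_, fun s t u hp hgeneric =>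
      ⟨rapidExpansion4 s t u, continuedSum_eq_expansion4 hnumer hp hgeneric⟩, fun p hp =>
      tendsto_nhdsWithin_of_eqOn hopen hdiff.continuousOn
        (fun q hq => continuedSum_eq_expansion4 hnumer hq.1 hq.2) hp, fun p hp => ?_⟩
    · simpa [cyclicSum] using hT.continuedSum_eq_cyclicSum le_rfl hN hnumer hp
    · rw [regularSet4_eq] at hp ⊢
      exact isTrueSingularity_continuedSum hN hnumer (not_not.1 hp)
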